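/- **Setting and conventions.** Let $(M,\theta,\xi,J,g_\theta)$ be a connected contact metric manifold of dimension $2d+1$: $\theta\wedge(d\theta)^d\neq0$ everywhere, $\theta(\xi)=1$, $d\theta(\xi,\cdot)=0$, $g_\theta(\xi,X)=\theta(X)$, $J^2=-\mathrm{Id}+\theta\otimes\xi$, $g_\theta(JX,Y)=d\theta(X,Y)$, where $d\theta(X,Y)=X\theta(Y)-Y\theta(X)-\theta([X,Y])$. Put $H=\ker\theta$, $\omega=d\theta$, and let $N(Y,Z)=J^2[Y,Z]+[JY,JZ]-J[Y,JZ]-J[JY,Z]+\omega(Y,Z)\xi$. Assume that $M$ is a strictly pseudoconvex CR manifold, i.e. $N=0$ on $H\times H$. For a connection use $T(X,Y)=[X,Y]-\nabla_XY+\nabla_YX$ and $R(X,Y)=[\nabla_Y,\nabla_X]-\nabla_{[Y,X]}$. Let $\nabla$ be the Tanaka–Webster connection, that is, the unique affine connection with $\nabla\theta=0$, $\nabla\xi=0$, $\nabla g_\theta=0$, $\nabla J=0$, $T(X,Y)=-\omega(X,Y)\xi$ for $X,Y\in H$, and $T(\xi,\cdot)=-\frac12N(\xi,\cdot)$. Put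 $\tau=T(\xi,\cdot)$, $A(X,Y)=g_\theta(\tau X,Y)$, $B(X,Y)=\omega(\tau X,Y)$ and $|\tau|^2=\sum_i|\tau e_i|^2$. Here and below $(e_i)_{1\le i\le2d}$ is any $g_\theta$-orthonormal frame of $H$, and all tensors are evaluated on $H$. For $2$-tensors $h,k$ let $(h\odot k)(X,Y,Z,W)=h(X,Y)k(Z,W)+h(Z,W)k(X,Y)$, and let the Kulkarni product be $(h\circ k)(X,Y,Z,W)=(h\odot k)(X,Z,Y,W)-(h\odot k)(X,W,Y,Z)$. For a $2$-form $\gamma$ let $\Lambda\gamma=\frac12\sum_i\gamma(e_i,Je_i)$. For a $4$-tensor $Q$ let $(\widehat Q\gamma)(X,Y)=\frac12\sum_{i,j}Q(e_i,e_j,X,Y)\gamma(e_i,e_j)$ and $$Q_0=Q-\tfrac1d(\widehat Q\omega)\odot\omega+\tfrac1{2d^2}\bigl(\Lambda(\widehat Q\omega)\bigr)\,\omega\odot\omega .$$ Put $$I^{\mathbb C}_H=\tfrac18\bigl(g_\theta\circ g_\theta+\omega\circ\omega+2\,\omega\odot\omega\bigr),\qquad T_H=\tfrac18\bigl(A\circ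 A+B\circ B\bigr).$$ The pseudo-Hermitian curvature tensor is $R^W(X,Y,Z,W)=\frac12g_\theta\bigl((R(X,Y)+R(JX,JY))Z,W\bigr)$. Its Ricci tensor is $\mathrm{Ric}(X,Y)=\sum_iR^W(e_i,X,e_i,Y)$, its scalar curvature is $s^W=\sum_i\mathrm{Ric}(e_i,e_i)$, and its Ricci form is $\rho=-\widehat{R^W}\omega$. With $\mathrm{Ric}_0=\mathrm{Ric}-\frac{s^W}{2d}g_\theta$ and $\rho_0=\rho-\frac{\Lambda\rho}{d}\omega$, the Chern–Moser tensor $C$ is defined by $$R^W=\frac{s^W}{d(d+1)}I^{\mathbb C}_H+\frac1{d+2}\Bigl(\tfrac12\bigl(\mathrm{Ric}_0\circ g_\theta-\rho_0\circ\omega\bigr)-\rho_0\odot\omega\Bigr)+C .$$ $M$ is called a *contact locally sub-symmetric space* if for every $x_0\in M$ there is a local isometry $\psi$ of the contact metric structure (a diffeomorphism between open sets, defined near $x_0$ and preserving $g_\theta$ and $\theta$) with $\psi(x_0)=x_0$ and $d\psi(x_0)|_{H_{x_0}}=-\mathrm{id}$. **Theorem 3.3.** Assume that $\nabla_X\tau=0$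 for all $X\in H$ and that $\tau$ is not identically zero. Then $|\tau|^2>0$ at every point, and $$R^W=\frac{s^W}{d^2}\Bigl(I^{\mathbb C}_H+\frac{2d}{|\tau|^2}T_H\Bigr),\qquad C=\frac{s^W}{d^2}\Bigl(\frac1{d+1}(I^{\mathbb C}_H)_0+\frac{2d}{|\tau|^2}(T_H)_0\Bigr).$$ If moreover $d\ge2$, then $M$ is a contact locally sub-symmetric space. -/

import Mathlib

open Bundle VectorField FiberBundle
open scoped Manifold ContDiff Topology

noncomputable section

/-! ### Multilinear algebra

Covariant tensors on a real vector space are written as real functions of their arguments. -/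

namespace TensorAlg

variable {V : Type*}

/-- The symmetric product `h ⊙ k` of two covariant `2`-tensors. -/
def symProd (h k : V → V → ℝ) (X Y Z W : V) : ℝ :=
  h X Y * k Z W + h Z W * k X Y

/-- The Kulkarni product of two covariant `2`-tensors:
`(h ∧ k)(X,Y,Z,W) = (h ⊙ k)(X,Z,Y,W) - (h ⊙ k)(X,W,Y,Z)`. -/
def kulkarni (h k : V → V → ℝ) (X Y Z W : V) : ℝ :=
  symProd h k X Z Y W - symProd h k X W Y Z

/-- The trace of a `2`-tensor in the frame `e`. -/
def frameTrace {n : ℕ} (e : Fin n → V) (h : V → V → ℝ) : ℝ :=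
  ∑ i, h (e i) (e i)

/-- The Ricci contraction `c(Q)(X,Y) = tr Q(·,X,·,Y)` in the frame `e`. -/
def ricciContraction {n : ℕ} (e : Fin n → V) (Q : V → V → V → V → ℝ) (X Y : V) : ℝ :=
  ∑ i, Q (e i) X (e i) Y

/-- The action of a `4`-tensor `Q` on a `2`-form `γ`, in the frame `e`:
`(Q̂ γ)(X,Y) = ½ ∑ᵢⱼ Q(eᵢ,eⱼ,X,Y) γ(eᵢ,eⱼ)`. -/
def hatAction {n : ℕ} (e : Fin n → V) (Q : V → V → V → V → ℝ) (γ : V → V → ℝ) (X Y : V) : ℝ :=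
  (1 / 2) * ∑ i, ∑ j, Q (e i) (e j) X Y * γ (e i) (e j)

/-- The adjoint Lefschetz operator on `2`-forms, `Λ γ = ½ tr γ(·, J ·)`, in the frame `e`. -/
def lefschetzAdj {n : ℕ} (e : Fin n → V) (J : V → V) (γ : V → V → ℝ) : ℝ :=
  (1 / 2) * ∑ i, γ (e i) (J (e i))

/-- The primitive part of a `2`-form, `γ₀ = γ - (Λ γ / d) η`, where the rank is `2 d`. -/
def primitiveForm {d : ℕ} (e : Fin (2 * d) → V) (J : V → V) (η γ : V → V → ℝ) (X Y : V) : ℝ :=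
  γ X Y - lefschetzAdj e J γ / d * η X Y

/-- The traceless part of a `2`-tensor with respect to the metric `g`, where the rank is `2 d`. -/
def tracelessPart {d : ℕ} (e : Fin (2 * d) → V) (g h : V → V → ℝ) (X Y : V) : ℝ :=
  h X Y - frameTrace e h / (2 * d) * g X Y

/-- The primitive part `Q₀ = Q - (1/d) (Q̂ η) ⊙ η + (1/(2 d²)) (Λ (Q̂ η)) η ⊙ η` of a symmetric
`4`-tensor `Q` on `2`-forms. -/
def primitivePart {d : ℕ} (e : Fin (2 * d) → V) (J : V → V) (η : V → V → ℝ)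
    (Q : V → V → V → V → ℝ) (X Y Z W : V) : ℝ :=
  Q X Y Z W - 1 / d * symProd (hatAction e Q η) η X Y Z W
    + 1 / (2 * d ^ 2) * lefschetzAdj e J (hatAction e Q η) * symProd η η X Y Z W

/-- The holomorphic curvature tensor
`I^ℂ = (1/8) (g ∧ g + η ∧ η + 2 η ⊙ η)`, with Kulkarni products. -/
def holoCurv (g η : V → V → ℝ) (X Y Z W : V) : ℝ :=
  1 / 8 * (kulkarni g g X Y Z W + kulkarni η η X Y Z W + 2 * symProd η η X Y Z W)

end TensorAlg

open TensorAlg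

/-! ### Contact metric manifolds -/

section Contact

variable {d : ℕ} {M : Type*} [TopologicalSpace M]
  [ChartedSpace (EuclideanSpace ℝ (Fin (2 * d + 1))) M]

/-- The exterior derivative of a `1`-form, `dθ(X,Y) = X(θ(Y)) - Y(θ(X)) - θ([X,Y])`. It is evaluated
on tangent vectors by extending them to local smooth vector fields; the value does not depend on
the extensions. -/
def extDerivForm [IsManifold (𝓡 (2 * d + 1)) ∞ M]
    (θ : ∀ x : M, TangentSpace (𝓡 (2 * d + 1)) x →L[ℝ] ℝ) (x : M)
    (u v : TangentSpace (𝓡 (2 * d + 1)) x) : ℝ :=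
  let U : ∀ y : M, TangentSpace (𝓡 (2 * d + 1)) y := extend (EuclideanSpace ℝ (Fin (2 * d + 1))) u
  let V : ∀ y : M, TangentSpace (𝓡 (2 * d + 1)) y := extend (EuclideanSpace ℝ (Fin (2 * d + 1))) v
  mvfderiv (𝓡 (2 * d + 1)) (fun y ↦ θ y (V y)) x u
    - mvfderiv (𝓡 (2 * d + 1)) (fun y ↦ θ y (U y)) x v
    - θ x (mlieBracket (𝓡 (2 * d + 1)) U V x)

variable (d M) in
/-- A contact metric structure `(θ, ξ, J, g)` on a manifold of dimension `2 d + 1`. -/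
structure ContactMetricStructure [IsManifold (𝓡 (2 * d + 1)) ∞ M] where
  /-- the contact form -/
  θ : ∀ x : M, TangentSpace (𝓡 (2 * d + 1)) x →L[ℝ] ℝ
  /-- the Reeb field -/
  ξ : ∀ x : M, TangentSpace (𝓡 (2 * d + 1)) x
  /-- the `(1,1)`-tensor field -/
  J : ∀ x : M, TangentSpace (𝓡 (2 * d + 1)) x →L[ℝ] TangentSpace (𝓡 (2 * d + 1)) x
  /-- the Webster metric -/
  g : ContMDiffRiemannianMetric (𝓡 (2 * d + 1)) ∞ (EuclideanSpace ℝ (Fin (2 * d + 1)))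
    (fun x : M ↦ TangentSpace (𝓡 (2 * d + 1)) x)
  smooth_θ : ContMDiff (𝓡 (2 * d + 1))
    ((𝓡 (2 * d + 1)).prod 𝓘(ℝ, EuclideanSpace ℝ (Fin (2 * d + 1)) →L[ℝ] ℝ)) ∞
    (fun x ↦ TotalSpace.mk' (EuclideanSpace ℝ (Fin (2 * d + 1)) →L[ℝ] ℝ) x (θ x))
  smooth_ξ : ContMDiff (𝓡 (2 * d + 1))
    ((𝓡 (2 * d + 1)).prod 𝓘(ℝ, EuclideanSpace ℝ (Fin (2 * d + 1)))) ∞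
    (fun x ↦ TotalSpace.mk' (EuclideanSpace ℝ (Fin (2 * d + 1))) x (ξ x))
  smooth_J : ContMDiff (𝓡 (2 * d + 1))
    ((𝓡 (2 * d + 1)).prod 𝓘(ℝ, EuclideanSpace ℝ (Fin (2 * d + 1)) →L[ℝ]
      EuclideanSpace ℝ (Fin (2 * d + 1)))) ∞
    (fun x ↦ TotalSpace.mk' (EuclideanSpace ℝ (Fin (2 * d + 1)) →L[ℝ]
      EuclideanSpace ℝ (Fin (2 * d + 1))) x (J x))
  /-- `θ ∧ (dθ)^d ≠ 0` at every point (the sum is a positive multiple of this form evaluated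
  on `v`) -/
  contact : ∀ x, ∃ v : Fin (2 * d + 1) → TangentSpace (𝓡 (2 * d + 1)) x,
    ∑ σ : Equiv.Perm (Fin (2 * d + 1)), ((Equiv.Perm.sign σ : ℤ) : ℝ) *
      (θ x (v (σ 0)) * ∏ i : Fin d, extDerivForm θ x
        (v (σ ⟨2 * i.val + 1, by omega⟩)) (v (σ ⟨2 * i.val + 2, by omega⟩))) ≠ 0
  θ_ξ : ∀ x, θ x (ξ x) = 1
  dθ_ξ : ∀ x u, extDerivForm θ x (ξ x) u = 0
  g_ξ : ∀ x u, g.inner x (ξ x) u = θ x u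
  J_J : ∀ x u, J x (J x u) = -u + θ x u • ξ x
  g_J : ∀ x u v, g.inner x (J x u) v = extDerivForm θ x u v

namespace ContactMetricStructure

variable [IsManifold (𝓡 (2 * d + 1)) ∞ M] (S : ContactMetricStructure d M)

/-- The Webster metric at `x`, as a bilinear function. -/
def met (x : M) (u v : TangentSpace (𝓡 (2 * d + 1)) x) : ℝ := S.g.inner x u v

/-- The `2`-form `ω = dθ` at `x`. -/
def omega (x : M) (u v : TangentSpace (𝓡 (2 * d + 1)) x) : ℝ := extDerivForm S.θ x u v

/-- The tensor `N(Y,Z) = J²[Y,Z] + [JY,JZ] - J[Y,JZ] - J[JY,Z] + ω(Y,Z) ξ`, evaluated on tangent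
vectors by extending them to local smooth vector fields. -/
def nijenhuis (x : M) (u v : TangentSpace (𝓡 (2 * d + 1)) x) : TangentSpace (𝓡 (2 * d + 1)) x :=
  let U : ∀ y : M, TangentSpace (𝓡 (2 * d + 1)) y := extend (EuclideanSpace ℝ (Fin (2 * d + 1))) u
  let V : ∀ y : M, TangentSpace (𝓡 (2 * d + 1)) y := extend (EuclideanSpace ℝ (Fin (2 * d + 1))) v
  let JU : ∀ y : M, TangentSpace (𝓡 (2 * d + 1)) y := fun y ↦ S.J y (U y)
  let JV : ∀ y : M, TangentSpace (𝓡 (2 * d + 1)) y := fun y ↦ S.J y (V y)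
  S.J x (S.J x (mlieBracket (𝓡 (2 * d + 1)) U V x)) + mlieBracket (𝓡 (2 * d + 1)) JU JV x
    - S.J x (mlieBracket (𝓡 (2 * d + 1)) U JV x) - S.J x (mlieBracket (𝓡 (2 * d + 1)) JU V x)
    + S.omega x u v • S.ξ x

/-- The projection onto the contact hyperplane `H = ker θ` along the Reeb field. -/
def projH (x : M) (u : TangentSpace (𝓡 (2 * d + 1)) x) : TangentSpace (𝓡 (2 * d + 1)) x :=
  u - S.θ x u • S.ξ x

/-- The structure is a strictly pseudoconvex CR structure: `J` is integrable, i.e. `N_H = 0`. -/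
def IsStrictlyPseudoconvexCR : Prop :=
  ∀ (x : M) (u v : TangentSpace (𝓡 (2 * d + 1)) x), S.nijenhuis x (S.projH x u) (S.projH x v) = 0

/-- The torsion of an affine connection with the convention `T(X,Y) = [X,Y] - ∇_X Y + ∇_Y X`
(the opposite of Mathlib's torsion). -/
def tors (cov : CovariantDerivative (𝓡 (2 * d + 1)) (EuclideanSpace ℝ (Fin (2 * d + 1)))
    (fun x : M ↦ TangentSpace (𝓡 (2 * d + 1)) x)) (x : M)
    (u v : TangentSpace (𝓡 (2 * d + 1)) x) : TangentSpace (𝓡 (2 * d + 1)) x :=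
  -cov.torsion x u v

/-- The curvature of an affine connection, with the convention
`R(X,Y)Z = ∇_Y ∇_X Z - ∇_X ∇_Y Z - ∇_[Y,X] Z`, evaluated on tangent vectors by extending them to
local smooth vector fields. -/
def curv (cov : CovariantDerivative (𝓡 (2 * d + 1)) (EuclideanSpace ℝ (Fin (2 * d + 1)))
    (fun x : M ↦ TangentSpace (𝓡 (2 * d + 1)) x)) (x : M)
    (u v w : TangentSpace (𝓡 (2 * d + 1)) x) : TangentSpace (𝓡 (2 * d + 1)) x :=
  let U : ∀ y : M, TangentSpace (𝓡 (2 * d + 1)) y := extend (EuclideanSpace ℝ (Fin (2 * d + 1))) u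
  let V : ∀ y : M, TangentSpace (𝓡 (2 * d + 1)) y := extend (EuclideanSpace ℝ (Fin (2 * d + 1))) v
  let W : ∀ y : M, TangentSpace (𝓡 (2 * d + 1)) y := extend (EuclideanSpace ℝ (Fin (2 * d + 1))) w
  cov (fun y ↦ cov W y (U y)) x v - cov (fun y ↦ cov W y (V y)) x u
    - cov W x (mlieBracket (𝓡 (2 * d + 1)) V U x)

/-- The covariant derivative `(∇_u A)(v) = ∇_u (A V) - A (∇_u V)` of a field `A` of endomorphisms
of the tangent spaces, `V` being a local smooth vector field extending `v`. -/
def covEnd (cov : CovariantDerivative (𝓡 (2 * d + 1)) (EuclideanSpace ℝ (Fin (2 * d + 1)))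
    (fun x : M ↦ TangentSpace (𝓡 (2 * d + 1)) x))
    (A : ∀ x : M, TangentSpace (𝓡 (2 * d + 1)) x → TangentSpace (𝓡 (2 * d + 1)) x) (x : M)
    (u v : TangentSpace (𝓡 (2 * d + 1)) x) : TangentSpace (𝓡 (2 * d + 1)) x :=
  let V : ∀ y : M, TangentSpace (𝓡 (2 * d + 1)) y := extend (EuclideanSpace ℝ (Fin (2 * d + 1))) v
  cov (fun y ↦ A y (V y)) x u - A x (cov V x u)

/-- `cov` is the (generalized) Tanaka-Webster connection of the contact metric structure `S`:
the unique affine connection with the following properties. -/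
structure IsTanakaWebster
    (cov : CovariantDerivative (𝓡 (2 * d + 1)) (EuclideanSpace ℝ (Fin (2 * d + 1)))
      (fun x : M ↦ TangentSpace (𝓡 (2 * d + 1)) x)) : Prop where
  /-- the connection is smooth -/
  smooth : CovariantDerivative.ContMDiffCovariantDerivative cov ∞
  /-- `∇θ = 0` -/
  cov_θ : ∀ (Y : ∀ x : M, TangentSpace (𝓡 (2 * d + 1)) x) (x : M)
    (u : TangentSpace (𝓡 (2 * d + 1)) x),
    MDifferentiableAt (𝓡 (2 * d + 1))
      ((𝓡 (2 * d + 1)).prod 𝓘(ℝ, EuclideanSpace ℝ (Fin (2 * d + 1))))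
      (fun y ↦ TotalSpace.mk' (EuclideanSpace ℝ (Fin (2 * d + 1))) y (Y y)) x →
    mvfderiv (𝓡 (2 * d + 1)) (fun y ↦ S.θ y (Y y)) x u = S.θ x (cov Y x u)
  /-- `∇ξ = 0` -/
  cov_ξ : ∀ (x : M) (u : TangentSpace (𝓡 (2 * d + 1)) x), cov S.ξ x u = 0
  /-- `∇g = 0` -/
  cov_g : ∀ (Y Z : ∀ x : M, TangentSpace (𝓡 (2 * d + 1)) x) (x : M)
    (u : TangentSpace (𝓡 (2 * d + 1)) x),
    MDifferentiableAt (𝓡 (2 * d + 1))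
      ((𝓡 (2 * d + 1)).prod 𝓘(ℝ, EuclideanSpace ℝ (Fin (2 * d + 1))))
      (fun y ↦ TotalSpace.mk' (EuclideanSpace ℝ (Fin (2 * d + 1))) y (Y y)) x →
    MDifferentiableAt (𝓡 (2 * d + 1))
      ((𝓡 (2 * d + 1)).prod 𝓘(ℝ, EuclideanSpace ℝ (Fin (2 * d + 1))))
      (fun y ↦ TotalSpace.mk' (EuclideanSpace ℝ (Fin (2 * d + 1))) y (Z y)) x →
    mvfderiv (𝓡 (2 * d + 1)) (fun y ↦ S.met y (Y y) (Z y)) x u =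
      S.met x (cov Y x u) (Z x) + S.met x (Y x) (cov Z x u)
  /-- `T_H = -ω ⊗ ξ` -/
  tors_H : ∀ (x : M) (u v : TangentSpace (𝓡 (2 * d + 1)) x), S.θ x u = 0 → S.θ x v = 0 →
    tors cov x u v = -(S.omega x u v • S.ξ x)
  /-- `i(ξ)T = -½ i(ξ)N` -/
  tors_ξ : ∀ (x : M) (v : TangentSpace (𝓡 (2 * d + 1)) x),
    tors cov x (S.ξ x) v = -((1 / 2 : ℝ) • S.nijenhuis x (S.ξ x) v)
  /-- `g((∇_X J)Y, Z) = ½ ω(X, N_H(Y,Z))` -/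
  cov_J : ∀ (x : M) (u v w : TangentSpace (𝓡 (2 * d + 1)) x),
    S.met x (covEnd cov (fun y ↦ S.J y) x u v) w =
      1 / 2 * S.omega x u (S.nijenhuis x (S.projH x v) (S.projH x w))

/-- A `g`-orthonormal frame of the contact hyperplane `H_x = ker θ_x` (of rank `2 d`). -/
def IsHorizontalFrame (x : M) (e : Fin (2 * d) → TangentSpace (𝓡 (2 * d + 1)) x) : Prop :=
  (∀ i, S.θ x (e i) = 0) ∧ ∀ i j, S.met x (e i) (e j) = if i = j then 1 else 0

section Curvature

variable (cov : CovariantDerivative (𝓡 (2 * d + 1)) (EuclideanSpace ℝ (Fin (2 * d + 1)))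
  (fun x : M ↦ TangentSpace (𝓡 (2 * d + 1)) x))

/-- The Tanaka-Webster torsion `τ = i(ξ)T`. -/
def tau (x : M) (v : TangentSpace (𝓡 (2 * d + 1)) x) : TangentSpace (𝓡 (2 * d + 1)) x :=
  tors cov x (S.ξ x) v

/-- `A(X,Y) = g(τX, Y)`. -/
def tensA (x : M) (u v : TangentSpace (𝓡 (2 * d + 1)) x) : ℝ := S.met x (S.tau cov x u) v

/-- `B(X,Y) = ω(τX, Y)`. -/
def tensB (x : M) (u v : TangentSpace (𝓡 (2 * d + 1)) x) : ℝ := S.omega x (S.tau cov x u) v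

/-- The tensor `(1/8) (A ∧ A + B ∧ B)`, with Kulkarni products. -/
def tensT (x : M) (X Y Z W : TangentSpace (𝓡 (2 * d + 1)) x) : ℝ :=
  1 / 8 * (kulkarni (S.tensA cov x) (S.tensA cov x) X Y Z W
    + kulkarni (S.tensB cov x) (S.tensB cov x) X Y Z W)

/-- The pseudo-Hermitian curvature tensor `R^W(X,Y,Z,W) = g(R_H^+(X,Y)Z, W)`, where
`R_H^+(X,Y) = ½ (R(X,Y) + R(JX,JY))` is the `J`-invariant part of the horizontal curvature. It is
used for horizontal arguments only. -/
def curvW (x : M) (X Y Z W : TangentSpace (𝓡 (2 * d + 1)) x) : ℝ :=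
  S.met x ((1 / 2 : ℝ) • (curv cov x X Y Z + curv cov x (S.J x X) (S.J x Y) Z)) W

/-- `|τ|²` at `x`, in the frame `e` of `H_x`. -/
def tauNormSq (x : M) (e : Fin (2 * d) → TangentSpace (𝓡 (2 * d + 1)) x) : ℝ :=
  ∑ i, S.met x (S.tau cov x (e i)) (S.tau cov x (e i))

/-- The pseudo-Hermitian Ricci tensor. -/
def ricW (x : M) (e : Fin (2 * d) → TangentSpace (𝓡 (2 * d + 1)) x) :
    TangentSpace (𝓡 (2 * d + 1)) x → TangentSpace (𝓡 (2 * d + 1)) x → ℝ :=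
  ricciContraction e (S.curvW cov x)

/-- The pseudo-Hermitian Ricci form. -/
def rhoW (x : M) (e : Fin (2 * d) → TangentSpace (𝓡 (2 * d + 1)) x)
    (u v : TangentSpace (𝓡 (2 * d + 1)) x) : ℝ :=
  -hatAction e (S.curvW cov x) (S.omega x) u v

/-- The pseudo-Hermitian scalar curvature. -/
def scalW (x : M) (e : Fin (2 * d) → TangentSpace (𝓡 (2 * d + 1)) x) : ℝ :=
  frameTrace e (S.ricW cov x e)

/-- The Chern-Moser tensor `C`, i.e. the last term of the decomposition
`R^W = s/(d(d+1)) I^ℂ + 1/(d+2) (½ (Ric₀ ∧ g - ρ₀ ∧ ω) - ρ₀ ⊙ ω) + C`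
in which `Ric₀` is the traceless part of the Ricci tensor, `ρ₀` the primitive part of the Ricci
form, and `∧` the Kulkarni product. -/
def chernMoser (x : M) (e : Fin (2 * d) → TangentSpace (𝓡 (2 * d + 1)) x)
    (X Y Z W : TangentSpace (𝓡 (2 * d + 1)) x) : ℝ :=
  let ric₀ := tracelessPart e (S.met x) (S.ricW cov x e)
  let rho₀ := primitiveForm e (S.J x) (S.omega x) (S.rhoW cov x e)
  S.curvW cov x X Y Z W
    - S.scalW cov x e / (d * (d + 1)) * holoCurv (S.met x) (S.omega x) X Y Z W
    - 1 / (d + 2) * (1 / 2 * (kulkarni ric₀ (S.met x) X Y Z W - kulkarni rho₀ (S.omega x) X Y Z W)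
      - symProd rho₀ (S.omega x) X Y Z W)

end Curvature

/-- The structure is contact locally sub-symmetric: around every point `x₀` there is a local
isometry `ψ` of the contact metric structure (a diffeomorphism between open sets that preserves `g`
and `θ`, hence also `ξ` and `J`) with `ψ(x₀) = x₀` and `dψ(x₀) = -id` on `H_{x₀}`. -/
def IsContactLocallySubSymmetric : Prop :=
  ∀ x₀ : M, ∃ ψ : OpenPartialHomeomorph M M, x₀ ∈ ψ.source ∧
    ContMDiffOn (𝓡 (2 * d + 1)) (𝓡 (2 * d + 1)) ∞ ψ ψ.source ∧
    ContMDiffOn (𝓡 (2 * d + 1)) (𝓡 (2 * d + 1)) ∞ ψ.symm ψ.target ∧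
    (∀ x ∈ ψ.source, ∀ u v : TangentSpace (𝓡 (2 * d + 1)) x,
      S.met (ψ x) (mfderiv (𝓡 (2 * d + 1)) (𝓡 (2 * d + 1)) ψ x u)
        (mfderiv (𝓡 (2 * d + 1)) (𝓡 (2 * d + 1)) ψ x v) = S.met x u v) ∧
    (∀ x ∈ ψ.source, ∀ u : TangentSpace (𝓡 (2 * d + 1)) x,
      S.θ (ψ x) (mfderiv (𝓡 (2 * d + 1)) (𝓡 (2 * d + 1)) ψ x u) = S.θ x u) ∧
    ψ x₀ = x₀ ∧
    ∀ u : TangentSpace (𝓡 (2 * d + 1)) x₀, S.θ x₀ u = 0 →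
      tangentMap (𝓡 (2 * d + 1)) (𝓡 (2 * d + 1)) ψ ⟨x₀, u⟩ = ⟨x₀, -u⟩

/-- Orthonormal frames of the contact hyperplanes exist at every point. -/
theorem exists_isHorizontalFrame (x : M) :
    ∃ e : Fin (2 * d) → TangentSpace (𝓡 (2 * d + 1)) x, S.IsHorizontalFrame x e := by
  let _ : RiemannianBundle (fun x : M ↦ TangentSpace (𝓡 (2 * d + 1)) x) :=
    ⟨S.g.toRiemannianMetric⟩
  let K : Submodule ℝ (TangentSpace (𝓡 (2 * d + 1)) x) := LinearMap.ker (S.θ x).toLinearMap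
  have _ : FiniteDimensional ℝ (TangentSpace (𝓡 (2 * d + 1)) x) :=
    inferInstanceAs (FiniteDimensional ℝ (EuclideanSpace ℝ (Fin (2 * d + 1))))
  have hfin : Module.finrank ℝ (TangentSpace (𝓡 (2 * d + 1)) x) = 2 * d + 1 :=
    finrank_euclideanSpace_fin (𝕜 := ℝ) (n := 2 * d + 1)
  have hsurj : Function.Surjective (S.θ x).toLinearMap := fun c ↦
    ⟨c • S.ξ x, by simp [S.θ_ξ]⟩
  have hK : Module.finrank ℝ K = 2 * d := by
    have h := LinearMap.finrank_range_add_finrank_ker (S.θ x).toLinearMap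
    rw [LinearMap.range_eq_top.2 hsurj, finrank_top, Module.finrank_self, hfin] at h
    change 1 + Module.finrank ℝ K = _ at h
    omega
  let b := (stdOrthonormalBasis ℝ K).reindex (finCongr hK)
  refine ⟨fun i ↦ (b i : TangentSpace (𝓡 (2 * d + 1)) x), fun i ↦ (b i).2, fun i j ↦ ?_⟩
  exact (orthonormal_iff_ite.1 b.orthonormal) i j

end ContactMetricStructure

end Contact

end

/-! Put `ν = ∇_ξ τ`. Horizontal parallelism means `∇τ = θ ⊗ ν`, and differentiating once more gives
the Ricci identity: on `H` the commutator of the curvature with `τ` is `ω ⊗ ν` up to sign. The first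
Bianchi identity shows that `τ` is symmetric, that `R(ξ, ·) = 0`, and that on `H` the curvature is a
Kähler tensor `K` plus an explicit expression `torsionPart` in `g`, `ω`, `A`, `B`. Under `(X, Y) ↦
(JX, JY)` both `K` and `ω` are invariant while `torsionPart` changes sign. Hence `R^W = K`, and the
Ricci identity splits in two (`comm_both`). One half is purely algebraic: `torsionPart` commutes
with `τ`, and a contraction of this yields `τ² = l² Id` on `H` with `l² = |τ|² / 2d` (`τ_τ`).

The other half, `[K, τ] = -ω ⊗ ν`, determines `K` up to one scalar (`exists_curvature_eq`). The
eigenspaces of `τ` are a Lagrangian space `V` and `JV`. On `V × JV` the commutator is multiplication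
by `±2l`, so the mixed components of `K` are expressed by `ω` and `ν`; the pair symmetry of `K` then
forces `g(ν ·, J ·)` to be a multiple of `g` on `V`, and the Bianchi identity gives the remaining
components. The outcome is `K = 2c (I^ℂ + T / l²)` and `ν = -2c Jτ`. For this model the Ricci tensor
is a multiple of `g` and the Ricci form a multiple of `ω`, so traces identify `2c = s^W / d²` and
give the formula for `C` (`frame_formulas`).

If `df = q θ` for a function `f`, then `d(df) = 0` evaluated on `(v, Jv)` with `v` horizontal gives
`q = 0` (`fderiv_trace_eq_zero`). Applied to `tr τ²` and `tr(ν J τ) = -2c tr τ²`, this makes `l` and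
`c` locally constant; by connectedness `τ` vanishes nowhere.

For the symmetry, replace `∇` by `∇ + c θ ⊗ J`. This connection makes `g`, `J`, `ξ` and also `τ`
parallel, and its torsion and curvature are expressed by these tensors with constant coefficients.
In the manner of Cartan, every linear map of a tangent space preserving the tensors then integrates
to a local automorphism `exp ∘ σ ∘ exp⁻¹` (`exists_local_automorphism`): in a frame transported
along geodesics, the variation of `exp` solves a linear system with constant coefficients, and `σ`
preserves that system. The map `σ = -1 + 2 θ ⊗ ξ` gives the required symmetry. -/

noncomputable section

/-! ### Smooth dependence of solutions of differential equations on parameters -/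

namespace ContinuousMap

universe u v

variable {K : Type*} [TopologicalSpace K] [CompactSpace K]

set_option synthInstance.maxHeartbeats 400000 in
/-- Pointwise application of a continuous family of linear maps to a continuous function. -/
def clmApplyL (K : Type*) [TopologicalSpace K] [CompactSpace K] (F F' : Type*)
    [NormedAddCommGroup F] [NormedSpace ℝ F] [NormedAddCommGroup F'] [NormedSpace ℝ F'] :
    C(K, F →L[ℝ] F') →L[ℝ] C(K, F) →L[ℝ] C(K, F') :=
  LinearMap.mkContinuous₂
    (LinearMap.mk₂ ℝ (fun (A : C(K, F →L[ℝ] F')) (δ : C(K, F)) ↦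
        (⟨fun t ↦ A t (δ t), by fun_prop⟩ : C(K, F')))
      (by intros; ext; simp) (by intros; ext; simp) (by intros; ext; simp)
      (by intros; ext; simp)) 1 (by
    intro A δ
    rw [ContinuousMap.norm_le _ (by positivity)]
    intro t
    simpa using (A t).le_of_opNorm_le_of_le (A.norm_coe_le_norm t) (δ.norm_coe_le_norm t))

set_option synthInstance.maxHeartbeats 400000 in
@[simp] theorem clmApplyL_apply {F F' : Type*}
    [NormedAddCommGroup F] [NormedSpace ℝ F] [NormedAddCommGroup F'] [NormedSpace ℝ F']
    (A : C(K, F →L[ℝ] F')) (δ : C(K, F)) (t : K) : clmApplyL K F F' A δ t = A t (δ t) := rfl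

set_option synthInstance.maxHeartbeats 400000 in
/-- Composition with a `C¹` map is differentiable on spaces of continuous functions. -/
theorem hasFDerivAt_postcomp {F F' : Type*}
    [NormedAddCommGroup F] [NormedSpace ℝ F] [NormedAddCommGroup F'] [NormedSpace ℝ F']
    (f : C(F, F')) (f' : C(F, F →L[ℝ] F')) (hf : ∀ y, HasFDerivAt f (f' y) y) (γ : C(K, F)) :
    HasFDerivAt (fun γ : C(K, F) ↦ f.comp γ) (clmApplyL K F F' (f'.comp γ)) γ := by
  rw [hasFDerivAt_iff_isLittleO_nhds_zero, Asymptotics.isLittleO_iff]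
  intro ε hε
  -- The image of `γ` is compact, so one radius `r` controls the variation of `f'` near `γ t` for
  -- every `t`.
  have hK : IsCompact (Set.range γ) := isCompact_range γ.continuous
  have hu := hK.uniformContinuousAt_of_continuousAt f' (fun a _ ↦ f'.continuous.continuousAt)
    (Metric.dist_mem_uniformity hε)
  obtain ⟨r, hr, hr'⟩ := Metric.mem_uniformity_dist.1 hu
  filter_upwards [Metric.ball_mem_nhds (0 : C(K, F)) hr] with δ hδ
  rw [ContinuousMap.norm_le _ (by positivity)]
  intro t
  have hδt : ‖δ t‖ ≤ ‖δ‖ := δ.norm_coe_le_norm t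
  have hδr : ‖δ‖ < r := by simpa using hδ
  have key := (convex_ball (γ t) r).norm_image_sub_le_of_norm_hasFDerivWithin_le'
    (f := f) (f' := f') (φ := f' (γ t)) (C := ε) (x := γ t) (y := γ t + δ t)
    (fun y _ ↦ (hf y).hasFDerivWithinAt) (by
      intro y hy
      have := hr' (a := γ t) (b := y) (by simpa [dist_comm] using hy) ⟨t, rfl⟩
      rw [← dist_eq_norm, dist_comm]
      exact le_of_lt this)
    (Metric.mem_ball_self hr) (by simpa using hδt.trans_lt hδr)
  have e1 : γ t + δ t - γ t = δ t := by abel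
  rw [e1] at key
  calc _ ≤ ε * ‖δ t‖ := by simpa using key
    _ ≤ ε * ‖δ‖ := by gcongr

set_option synthInstance.maxHeartbeats 400000 in
/-- Composition with a smooth map is smooth on spaces of continuous functions. -/
theorem contDiff_postcomp_nat {F : Type u} [NormedAddCommGroup F] [NormedSpace ℝ F] (n : ℕ) :
    ∀ {F' : Type (max u v)} [NormedAddCommGroup F'] [NormedSpace ℝ F'] (f : C(F, F')),
      ContDiff ℝ n f → ContDiff ℝ n (fun γ : C(K, F) ↦ f.comp γ) := by
  -- The codomain is quantified inside the induction, in a universe above that of `F`, because the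
  -- derivative takes values in `F →L[ℝ] F'`.
  induction n with
  | zero =>
    intro F' _ _ f _
    exact contDiff_zero.2 (ContinuousMap.continuous_postcomp f)
  | succ n ih =>
    intro F' _ _ f hf
    obtain ⟨f', hf', hff'⟩ := contDiff_succ_iff_hasFDerivAt.1 (by exact_mod_cast hf)
    refine contDiff_succ_iff_hasFDerivAt.2 ⟨fun γ ↦ clmApplyL K F F'
      ((⟨f', hf'.continuous⟩ : C(F, F →L[ℝ] F')).comp γ), ?_, fun γ ↦
      hasFDerivAt_postcomp f ⟨f', hf'.continuous⟩ hff' γ⟩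
    exact (clmApplyL K F F').contDiff.comp (ih (F' := F →L[ℝ] F') ⟨f', hf'.continuous⟩ hf')

set_option synthInstance.maxHeartbeats 400000 in
theorem contDiff_postcomp {F : Type u} {F' : Type v} [NormedAddCommGroup F] [NormedSpace ℝ F]
    [NormedAddCommGroup F'] [NormedSpace ℝ F'] (f : C(F, F')) (hf : ContDiff ℝ ∞ f) :
    ContDiff ℝ ∞ (fun γ : C(K, F) ↦ f.comp γ) := by
  -- both spaces are embedded in their product, which lives in a common universe
  have h (n : ℕ) : ContDiff ℝ n (fun γ : C(K, F) ↦
      (⟨fun y ↦ ((0 : F), f y), by fun_prop⟩ : C(F, F × F')).comp γ) := by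
    have := contDiff_postcomp_nat.{u, v} (K := K) n (⟨fun y ↦ ((0 : F), f y), by fun_prop⟩ : C(F, F × F'))
      (contDiff_const.prodMk (hf.of_le (by exact_mod_cast le_top)))
    exact this
  refine contDiff_infty.2 fun n ↦ ?_
  exact ((ContinuousLinearMap.snd ℝ F F').compLeftContinuous ℝ K).contDiff.comp (h n)

end ContinuousMap

/-- A solution of `Φ (v, c v) = 0` that is smooth on a neighbourhood, when `Φ (0, ·)` is the
subtraction of `γ₀`. -/
theorem exists_eventually_contDiffAt_implicit {P X : Type*} [NormedAddCommGroup P]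
    [NormedSpace ℝ P] [CompleteSpace P] [NormedAddCommGroup X] [NormedSpace ℝ X] [CompleteSpace X]
    (Φ : P × X → X) (hΦ : ContDiff ℝ ∞ Φ) (γ₀ : X) (hΦ0 : ∀ γ, Φ (0, γ) = γ - γ₀) :
    ∃ c : P → X, c 0 = γ₀ ∧ ∀ᶠ v in 𝓝 0, ContDiffAt ℝ ∞ c v ∧ Φ (v, c v) = 0 := by
  have hn : (∞ : WithTop ℕ∞) ≠ 0 := by simp
  have hdiff : ContinuousAt (fun u : P × X ↦ fderiv ℝ Φ u ∘L .inr ℝ P X) (0, γ₀) := by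
    have := hΦ.continuous_fderiv hn
    fun_prop
  have h0 : fderiv ℝ Φ (0, γ₀) ∘L .inr ℝ P X = ContinuousLinearMap.id ℝ X := by
    have h1 : HasFDerivAt (fun γ ↦ Φ (0, γ)) (fderiv ℝ Φ (0, γ₀) ∘L .inr ℝ P X) γ₀ :=
      ((hΦ.differentiable hn) (0, γ₀)).hasFDerivAt.comp γ₀ (hasFDerivAt_prodMk_right (0 : P) γ₀)
    simp only [hΦ0] at h1
    exact h1.unique ((hasFDerivAt_id γ₀).sub_const γ₀)
  have hinv : ∀ᶠ u in 𝓝 ((0 : P), γ₀), (fderiv ℝ Φ u ∘L .inr ℝ P X).IsInvertible := by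
    have h1 : {A : X →L[ℝ] X | A.IsInvertible} ∈ 𝓝 (ContinuousLinearMap.id ℝ X) := by
      have := ContinuousLinearEquiv.nhds (ContinuousLinearEquiv.refl ℝ X)
      exact this
    rw [← h0] at h1
    exact hdiff.eventually h1
  have hinv0 := hinv.self_of_nhds
  have hcd (u : P × X) : ContDiffAt ℝ ∞ Φ u := hΦ.contDiffAt
  let c := (hcd (0, γ₀)).implicitFunction hn hinv0
  have hc0 : c 0 = γ₀ := (hcd (0, γ₀)).implicitFunction_apply_self hn hinv0
  have hcs : ContDiffAt ℝ ∞ c 0 := (hcd (0, γ₀)).contDiffAt_implicitFunction hn hinv0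
  have hceq : ∀ᶠ v in 𝓝 (0 : P), Φ (v, c v) = 0 := by
    have := (hcd (0, γ₀)).eventually_apply_implicitFunction hn hinv0
    simpa [hΦ0] using this
  have hcc : ∀ᶠ v in 𝓝 (0 : P), ContinuousAt c v :=
    (((hcs.of_le (m := 1) (by simp)).eventually (by simp))).mono fun v hv ↦ hv.continuousAt
  have hcinv : ∀ᶠ v in 𝓝 (0 : P), (fderiv ℝ Φ (v, c v) ∘L .inr ℝ P X).IsInvertible := by
    have : Filter.Tendsto (fun v ↦ (v, c v)) (𝓝 0) (𝓝 (0, γ₀)) := by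
      have := continuousAt_id.prodMk hcs.continuousAt
      simpa [ContinuousAt, hc0] using this
    exact this.eventually hinv
  refine ⟨c, hc0, ?_⟩
  filter_upwards [hceq.eventually_nhds, hcc, hcinv] with v hv hvc hvi
  refine ⟨?_, hv.self_of_nhds⟩
  -- For the order `∞`, smoothness at `0` gives no common neighbourhood of smoothness. The implicit
  -- function theorem is therefore applied again at each nearby `(v, c v)`, and local uniqueness
  -- identifies the new implicit function with `c`.
  have h2 := (hcd (v, c v)).eventually_apply_eq_iff_implicitFunction hn hvi
  have h3 : Filter.Tendsto (fun v ↦ (v, c v)) (𝓝 v) (𝓝 (v, c v)) := continuousAt_id.prodMk hvc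
  refine ((hcd (v, c v)).contDiffAt_implicitFunction hn hvi).congr_of_eventuallyEq ?_
  filter_upwards [h3.eventually h2, hv] with v' h4 h5
  exact (h4.1 (by rw [h5, hv.self_of_nhds])).symm

/-- Integration from `0`, as an operator on continuous functions on `[0, 1]`. -/
def integL (F : Type*) [NormedAddCommGroup F] [NormedSpace ℝ F] :
    C(Set.Icc (0 : ℝ) 1, F) →L[ℝ] C(Set.Icc (0 : ℝ) 1, F) :=
  LinearMap.mkContinuous
    { toFun := fun γ ↦ ⟨fun t ↦ ∫ s in (0 : ℝ)..t, γ (Set.projIcc 0 1 zero_le_one s), by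
        have h : Continuous fun s : ℝ ↦ γ (Set.projIcc 0 1 zero_le_one s) := by fun_prop
        exact (intervalIntegral.continuous_primitive (fun _ _ ↦ h.intervalIntegrable _ _) 0).comp
          continuous_subtype_val⟩
      map_add' := fun γ δ ↦ by
        ext t
        have h (γ : C(Set.Icc (0 : ℝ) 1, F)) :
          Continuous fun s : ℝ ↦ γ (Set.projIcc 0 1 zero_le_one s) := by fun_prop
        simpa using intervalIntegral.integral_add ((h γ).intervalIntegrable _ _)
          ((h δ).intervalIntegrable _ _)
      map_smul' := fun a γ ↦ by
        ext t
        simp } 1 (by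
    intro γ
    rw [ContinuousMap.norm_le _ (by positivity)]
    intro t
    have := intervalIntegral.norm_integral_le_of_norm_le_const (a := (0 : ℝ)) (b := t)
      (f := fun s ↦ γ (Set.projIcc 0 1 zero_le_one s)) (C := ‖γ‖)
      (fun s _ ↦ γ.norm_coe_le_norm _)
    refine this.trans ?_
    have h1 : |(t : ℝ) - 0| ≤ 1 := by
      rw [sub_zero, abs_of_nonneg t.2.1]; exact t.2.2
    nlinarith [norm_nonneg γ])

/-- A continuous function on `[0, 1]`, extended to the real line by constants. -/
def extendIcc {F : Type*} [TopologicalSpace F] (γ : C(Set.Icc (0 : ℝ) 1, F)) (t : ℝ) : F :=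
  γ (Set.projIcc 0 1 zero_le_one t)

/-- The integral equation is equivalent to the initial value problem. Derivatives are taken within
`[0, 1]`, so the constant extension beyond the interval is harmless. -/
theorem extendIcc_eq_of_eq_add_integL {F : Type*} [NormedAddCommGroup F] [NormedSpace ℝ F]
    [CompleteSpace F] {γ β : C(Set.Icc (0 : ℝ) 1, F)} {y : F}
    (h : γ = ContinuousMap.const _ y + integL F β) :
    extendIcc γ 0 = y ∧ ∀ t ∈ Set.Icc (0 : ℝ) 1,
      HasDerivWithinAt (extendIcc γ) (extendIcc β t) (Set.Icc 0 1) t := by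
  have hγ (t : ℝ) (ht : t ∈ Set.Icc (0 : ℝ) 1) :
      extendIcc γ t = y + ∫ s in (0 : ℝ)..t, extendIcc β s := by
    rw [extendIcc, Set.projIcc_of_mem zero_le_one ht, h]
    rfl
  have hc : Continuous (extendIcc β) := by unfold extendIcc; fun_prop
  refine ⟨by rw [hγ 0 (by simp)]; simp, fun t ht ↦ ?_⟩
  exact ((hc.integral_hasStrictDerivAt 0 t).hasDerivAt.const_add y).hasDerivWithinAt.congr hγ
    (hγ t ht)

set_option synthInstance.maxHeartbeats 400000 in
/-- Solutions of `y' = G (v, y)` on `[0, 1]` depend smoothly on the parameter `v` near `0`, when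
`G (0, ·) = 0`; their derivatives solve the linearized equation. -/
theorem exists_smooth_solution_family {P F : Type*} [NormedAddCommGroup P] [NormedSpace ℝ P]
    [CompleteSpace P] [NormedAddCommGroup F] [NormedSpace ℝ F] [CompleteSpace F]
    (G : P × F → F) (hG : ContDiff ℝ ∞ G) (hG0 : ∀ y, G (0, y) = 0) (y₀ : F) :
    ∃ c : P → ℝ → F, (∀ t, c 0 t = y₀) ∧
      (∀ O ∈ 𝓝 y₀, ∀ᶠ v in 𝓝 (0 : P), ∀ t, c v t ∈ O) ∧
      ∀ᶠ v in 𝓝 (0 : P), (∀ t, ContDiffAt ℝ ∞ (fun v ↦ c v t) v) ∧ c v 0 = y₀ ∧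
        (∀ t ∈ Set.Icc (0 : ℝ) 1, HasDerivWithinAt (c v) (G (v, c v t)) (Set.Icc 0 1) t) ∧
        ∀ w, fderiv ℝ (fun v ↦ c v 0) v w = 0 ∧
          ∀ t ∈ Set.Icc (0 : ℝ) 1, HasDerivWithinAt (fun t ↦ fderiv ℝ (fun v ↦ c v t) v w)
            (fderiv ℝ G (v, c v t) (w, fderiv ℝ (fun v ↦ c v t) v w)) (Set.Icc 0 1) t := by
  let K := Set.Icc (0 : ℝ) 1
  have hn : (∞ : WithTop ℕ∞) ≠ 0 := by simp
  let Gc : C(P × F, F) := ⟨G, hG.continuous⟩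
  let G' : C(P × F, P × F →L[ℝ] F) := ⟨fderiv ℝ G, hG.continuous_fderiv hn⟩
  let pair : P × C(K, F) →L[ℝ] C(K, P × F) :=
    ((ContinuousLinearMap.inl ℝ P F).compLeftContinuous ℝ K ∘L ContinuousLinearMap.const ℝ K) ∘L
      .fst ℝ P C(K, F) +
    (ContinuousLinearMap.inr ℝ P F).compLeftContinuous ℝ K ∘L .snd ℝ P C(K, F)
  have hpair (v : P) (γ : C(K, F)) (t : K) : pair (v, γ) t = (v, γ t) := by simp [pair]
  -- The zeros of `Φ (v, ·)` are the solutions with initial value `y₀`. At `v = 0` the equation is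
  -- `γ = y₀`, whose linearization is the identity; this is why the whole interval `[0, 1]` is
  -- reached for small `v`.
  let Φ : P × C(K, F) → C(K, F) := fun u ↦
    u.2 - ContinuousMap.const K y₀ - integL F (Gc.comp (pair u))
  have hΦ : ContDiff ℝ ∞ Φ := by
    refine (contDiff_snd.sub contDiff_const).sub ((integL F).contDiff.comp ?_)
    exact (ContinuousMap.contDiff_postcomp Gc hG).comp pair.contDiff
  have hΦ0 (γ : C(K, F)) : Φ (0, γ) = γ - ContinuousMap.const K y₀ := by
    have : Gc.comp (pair (0, γ)) = 0 := by
      ext t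
      simp [Gc, hpair, hG0]
    simp [Φ, this]
  obtain ⟨c, hc0, hc⟩ := exists_eventually_contDiffAt_implicit Φ hΦ _ hΦ0
  have hev (t : ℝ) (v w : P) (hv : ContDiffAt ℝ ∞ c v) :
      fderiv ℝ (fun v ↦ extendIcc (c v) t) v w = extendIcc (fderiv ℝ c v w) t := by
    have h1 := (ContinuousMap.evalCLM ℝ (Set.projIcc (0 : ℝ) 1 zero_le_one t) :
      C(K, F) →L[ℝ] F).hasFDerivAt.comp v (hv.differentiableAt hn).hasFDerivAt
    exact congrArg (fun A : P →L[ℝ] F ↦ A w) h1.fderiv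
  refine ⟨fun v ↦ extendIcc (c v), fun t ↦ congrArg (fun γ ↦ extendIcc γ t) hc0, fun O hO ↦ ?_, ?_⟩
  · obtain ⟨r, hr, hrO⟩ := Metric.mem_nhds_iff.1 hO
    have h1 := hc.self_of_nhds.1.continuousAt.eventually (Metric.ball_mem_nhds _ hr)
    filter_upwards [h1] with v hv t
    apply hrO
    rw [hc0, dist_eq_norm] at hv
    rw [mem_ball_iff_norm]
    exact ((c v - ContinuousMap.const K y₀).norm_coe_le_norm _).trans_lt hv
  filter_upwards [hc.eventually_nhds] with v hv
  obtain ⟨hvs, hv0⟩ := hv.self_of_nhds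
  have e1 : c v = ContinuousMap.const K y₀ + integL F (Gc.comp (pair (v, c v))) := by
    have : c v - ContinuousMap.const K y₀ - integL F (Gc.comp (pair (v, c v))) = 0 := hv0
    rw [← sub_eq_zero, ← this]; abel
  obtain ⟨e2, e3⟩ := extendIcc_eq_of_eq_add_integL e1
  refine ⟨fun t ↦ ?_, e2, fun t ht ↦ ?_, fun w ↦ ?_⟩
  · exact (ContinuousMap.evalCLM ℝ (Set.projIcc (0 : ℝ) 1 zero_le_one t) :
      C(K, F) →L[ℝ] F).contDiff.contDiffAt.comp v hvs
  · have := e3 t ht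
    simp only [extendIcc, ContinuousMap.comp_apply, hpair] at this
    exact this
  have hcv : HasFDerivAt c (fderiv ℝ c v) v := (hvs.differentiableAt hn).hasFDerivAt
  -- Differentiating the identity `Φ (v, c v) = 0` in `v` gives the linearized equation, in integral
  -- form.
  have h1 : HasFDerivAt (fun v ↦ Φ (v, c v)) (fderiv ℝ c v - integL F ∘L
      (ContinuousMap.clmApplyL K (P × F) F (G'.comp (pair (v, c v))) ∘L
        (pair ∘L ((ContinuousLinearMap.id ℝ P).prod (fderiv ℝ c v))))) v := by
    have hp : HasFDerivAt (fun v ↦ pair (v, c v))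
        (pair ∘L ((ContinuousLinearMap.id ℝ P).prod (fderiv ℝ c v))) v :=
      pair.hasFDerivAt.comp v ((hasFDerivAt_id v).prodMk hcv)
    have hq := (ContinuousMap.hasFDerivAt_postcomp (K := K) Gc G'
      (fun y ↦ (hG.differentiable hn y).hasFDerivAt) (pair (v, c v))).comp v hp
    exact (hcv.sub_const _).sub ((integL F).hasFDerivAt.comp v hq)
  have h2 : HasFDerivAt (fun v ↦ Φ (v, c v)) (0 : P →L[ℝ] C(K, F)) v :=
    (hasFDerivAt_const (0 : C(K, F)) v).congr_of_eventuallyEq (hv.mono fun v' h ↦ h.2)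
  have h3 := congrArg (fun A : P →L[ℝ] C(K, F) ↦ A w) (h1.unique h2)
  have h4 : fderiv ℝ c v w = ContinuousMap.const K 0 + integL F
      (ContinuousMap.clmApplyL K (P × F) F (G'.comp (pair (v, c v))) (pair (w, fderiv ℝ c v w))) := by
    rw [← sub_eq_zero]
    refine Eq.trans ?_ h3
    ext t
    simp
  obtain ⟨e4, e5⟩ := extendIcc_eq_of_eq_add_integL h4
  simp only [fun t ↦ hev t v w hvs]
  refine ⟨e4, fun t ht ↦ ?_⟩
  have h6 := e5 t ht
  have h7 : extendIcc (ContinuousMap.clmApplyL K (P × F) F (G'.comp (pair (v, c v)))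
      (pair (w, fderiv ℝ c v w))) t =
      fderiv ℝ G (v, extendIcc (c v) t) (w, extendIcc (fderiv ℝ c v w) t) := by
    unfold extendIcc
    rw [← hpair, ← hpair]
    rfl
  rw [h7] at h6
  exact h6

end

noncomputable section

set_option synthInstance.maxHeartbeats 200000

/-! ### Local automorphisms of affine connections with parallel torsion and curvature -/

/-- Grönwall's inequality, `A` being bounded on the compact interval. Later uniqueness statements
are reduced to it by writing a defect as the solution of a homogeneous linear equation. -/
theorem eq_zero_of_linear_ode {F : Type*} [NormedAddCommGroup F] [NormedSpace ℝ F]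
    {δ : ℝ → F} {A : ℝ → F →L[ℝ] F} (hA : ContinuousOn A (Set.Icc 0 1)) (h0 : δ 0 = 0)
    (hδ : ∀ t ∈ Set.Icc (0 : ℝ) 1, HasDerivWithinAt δ (A t (δ t)) (Set.Icc 0 1) t) :
    ∀ t ∈ Set.Icc (0 : ℝ) 1, δ t = 0 := by
  obtain ⟨K, hK⟩ := isCompact_Icc.exists_bound_of_continuousOn hA
  refine eq_zero_of_abs_deriv_le_mul_abs_self_of_eq_zero_right (f' := fun t ↦ A t (δ t)) (K := K)
    (fun t ht ↦ (hδ t ht).continuousWithinAt) (fun t ht ↦ ?_) h0 (fun t ht ↦ ?_)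
  · have := hδ t ⟨ht.1, ht.2.le⟩
    exact this.mono_of_mem_nhdsWithin (Icc_mem_nhdsGE_of_mem ht)
  · exact (A t).le_of_opNorm_le (hK t ⟨ht.1, ht.2.le⟩) _

variable {E : Type*} [NormedAddCommGroup E] [NormedSpace ℝ E]

/-- The torsion of the affine connection `D + Γ` on a vector space, `T(u,v) = Γ(u)v - Γ(v)u`. -/
def chartTorsion (Γ : E → E →L[ℝ] E →L[ℝ] E) (x u v : E) : E := Γ x u v - Γ x v u

/-- The curvature `[∇_u, ∇_v] - ∇_[u,v]` of the affine connection `∇ = D + Γ`. -/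
def chartCurv (Γ : E → E →L[ℝ] E →L[ℝ] E) (x u v : E) : E →L[ℝ] E :=
  fderiv ℝ Γ x u v - fderiv ℝ Γ x v u + (Γ x u ∘L Γ x v - Γ x v ∘L Γ x u)

/-- Fields of a bilinear form, of endomorphisms and of a vector on a vector space. -/
structure TensorFields (E : Type*) [NormedAddCommGroup E] [NormedSpace ℝ E] (ι : Type*) where
  /-- the bilinear form -/
  g : E → E →L[ℝ] E →L[ℝ] ℝ
  /-- the endomorphisms -/
  P : ι → E → E →L[ℝ] E
  /-- the vector -/
  ξ : E → E

namespace TensorFields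

variable {ι : Type*} (S : TensorFields E ι)

/-- The linear map `h` carries the tensors at `x` to those at `y`. -/
structure Intertwines (x y : E) (h : E →L[ℝ] E) : Prop where
  g : ∀ a b, S.g y (h a) (h b) = S.g x a b
  P : ∀ i a, h (S.P i x a) = S.P i y (h a)
  ξ : h (S.ξ x) = S.ξ y

/-- The tensors are differentiable and parallel at `x` for the connection `D + Γ`. -/
structure IsParallelAt (Γ : E → E →L[ℝ] E →L[ℝ] E) (x : E) : Prop where
  diff_g : DifferentiableAt ℝ S.g x
  diff_P : ∀ i, DifferentiableAt ℝ (S.P i) x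
  diff_ξ : DifferentiableAt ℝ S.ξ x
  g : ∀ u a b, fderiv ℝ S.g x u a b = S.g x (Γ x u a) b + S.g x a (Γ x u b)
  P : ∀ i u a, fderiv ℝ (S.P i) x u a = S.P i x (Γ x u a) - Γ x u (S.P i x a)
  ξ : ∀ u, fderiv ℝ S.ξ x u = -Γ x u (S.ξ x)

variable {S}

theorem Intertwines.comp {x y z : E} {h k : E →L[ℝ] E} (hk : S.Intertwines y z k)
    (hh : S.Intertwines x y h) : S.Intertwines x z (k ∘L h) where
  g a b := by simp [hk.g, hh.g]
  P i a := by simp [hk.P, hh.P]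
  ξ := by simp [hk.ξ, hh.ξ]

theorem Intertwines.inverse {x y : E} {h k : E →L[ℝ] E} (hh : S.Intertwines x y h)
    (h1 : ∀ a, h (k a) = a) (h2 : ∀ a, k (h a) = a) : S.Intertwines y x k where
  g a b := by rw [← hh.g, h1, h1]
  P i a := by
    have := hh.P i (k a)
    rw [h1] at this
    rw [← this, h2]
  ξ := by rw [← hh.ξ, h2]

/-- Parallel transport along a curve intertwines parallel tensors. -/
theorem intertwines_of_transport {Γ : E → E →L[ℝ] E →L[ℝ] E} {x : ℝ → E} {h : ℝ → E →L[ℝ] E}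
    {x' : ℝ → E} {x₀ : E} (hΓ : Continuous Γ) (hx' : ContinuousOn x' (Set.Icc 0 1))
    (hpar : ∀ t ∈ Set.Icc (0 : ℝ) 1, S.IsParallelAt Γ (x t))
    (hx0 : x 0 = x₀) (hh0 : h 0 = ContinuousLinearMap.id ℝ E)
    (hx : ∀ t ∈ Set.Icc (0 : ℝ) 1, HasDerivWithinAt x (x' t) (Set.Icc 0 1) t)
    (hh : ∀ t ∈ Set.Icc (0 : ℝ) 1,
      HasDerivWithinAt h (-(Γ (x t) (x' t) ∘L h t)) (Set.Icc 0 1) t) :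
    ∀ t ∈ Set.Icc (0 : ℝ) 1, S.Intertwines x₀ (x t) (h t) := by
  have hxc : ContinuousOn x (Set.Icc 0 1) := fun t ht ↦ (hx t ht).continuousWithinAt
  have hA : ContinuousOn (fun t ↦ -Γ (x t) (x' t)) (Set.Icc 0 1) :=
    ((hΓ.comp_continuousOn hxc).clm_apply hx').neg
  have ha (a : E) (t : ℝ) (ht : t ∈ Set.Icc (0 : ℝ) 1) :
      HasDerivWithinAt (fun t ↦ h t a) (-(Γ (x t) (x' t) (h t a))) (Set.Icc 0 1) t := by
    simpa using (hh t ht).clm_apply (hasDerivWithinAt_const t _ a)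
  intro t ht
  refine ⟨fun a b ↦ ?_, fun i a ↦ ?_, ?_⟩
  -- Each defect vanishes at `0` and solves a homogeneous linear equation: that of `g` is constant,
  -- those of `P` and `ξ` are parallel along the curve.
  · have hd : ∀ t ∈ Set.Icc (0 : ℝ) 1, HasDerivWithinAt
        (fun t ↦ S.g (x t) (h t a) (h t b) - S.g x₀ a b)
        ((0 : ℝ →L[ℝ] ℝ) (S.g (x t) (h t a) (h t b) - S.g x₀ a b)) (Set.Icc 0 1) t := by
      intro t ht
      have h0 : HasDerivWithinAt (fun t ↦ S.g (x t)) (fderiv ℝ S.g (x t) (x' t)) (Set.Icc 0 1) t :=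
        HasFDerivAt.comp_hasDerivWithinAt (E := E →L[ℝ] E →L[ℝ] ℝ) (l := S.g) t
          (hpar t ht).diff_g.hasFDerivAt (hx t ht)
      have h1 := (h0.clm_apply (ha a t ht)).clm_apply (ha b t ht)
      refine (h1.sub_const _).congr_deriv ?_
      simp only [add_apply, (hpar t ht).g, map_neg,
        neg_apply, zero_apply]
      ring
    have := eq_zero_of_linear_ode (continuousOn_const) (by simp [hx0, hh0]) hd t ht
    linarith
  · have hd : ∀ t ∈ Set.Icc (0 : ℝ) 1, HasDerivWithinAt
        (fun t ↦ h t (S.P i x₀ a) - S.P i (x t) (h t a))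
        ((-Γ (x t) (x' t)) (h t (S.P i x₀ a) - S.P i (x t) (h t a))) (Set.Icc 0 1) t := by
      intro t ht
      have h1 : HasDerivWithinAt (fun t ↦ S.P i (x t)) (fderiv ℝ (S.P i) (x t) (x' t))
          (Set.Icc 0 1) t :=
        ((hpar t ht).diff_P i).hasFDerivAt.comp_hasDerivWithinAt t (hx t ht)
      refine ((ha _ t ht).sub (h1.clm_apply (ha a t ht))).congr_deriv ?_
      simp only [(hpar t ht).P, map_neg, map_sub,
        neg_apply]
      abel
    exact sub_eq_zero.1 (eq_zero_of_linear_ode hA (by simp [hx0, hh0]) hd t ht)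
  · have hd : ∀ t ∈ Set.Icc (0 : ℝ) 1, HasDerivWithinAt
        (fun t ↦ h t (S.ξ x₀) - S.ξ (x t))
        ((-Γ (x t) (x' t)) (h t (S.ξ x₀) - S.ξ (x t))) (Set.Icc 0 1) t := by
      intro t ht
      have h1 : HasDerivWithinAt (fun t ↦ S.ξ (x t)) (fderiv ℝ S.ξ (x t) (x' t)) (Set.Icc 0 1) t :=
        (hpar t ht).diff_ξ.hasFDerivAt.comp_hasDerivWithinAt t (hx t ht)
      refine ((ha _ t ht).sub h1).congr_deriv ?_
      simp only [(hpar t ht).ξ, map_sub, neg_apply]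
    exact sub_eq_zero.1 (eq_zero_of_linear_ode hA (by simp [hx0, hh0]) hd t ht)

end TensorFields

/-- The vector field whose flow is geodesics with parallel transport: `x' = h v`,
`h' = - Γ(h v) h`. -/
def transportField (Γ : E → E →L[ℝ] E →L[ℝ] E) (p : E × E × (E →L[ℝ] E)) : E × (E →L[ℝ] E) :=
  (p.2.2 p.1, -(Γ p.2.1 (p.2.2 p.1) ∘L p.2.2))

theorem contDiff_transportField {Γ : E → E →L[ℝ] E →L[ℝ] E} (hΓ : ContDiff ℝ ∞ Γ) :
    ContDiff ℝ ∞ (transportField Γ) := by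
  unfold transportField
  have h1 : ContDiff ℝ ∞ fun p : E × E × (E →L[ℝ] E) ↦ p.2.2 p.1 :=
    (contDiff_snd.comp contDiff_snd).clm_apply contDiff_fst
  have h2 : ContDiff ℝ ∞ fun p : E × E × (E →L[ℝ] E) ↦ Γ p.2.1 :=
    hΓ.comp (contDiff_fst.comp contDiff_snd)
  exact h1.prodMk ((h2.clm_apply h1).clm_comp (contDiff_snd.comp contDiff_snd)).neg

theorem fderiv_transportField {Γ : E → E →L[ℝ] E →L[ℝ] E} (hΓ : ContDiff ℝ ∞ Γ)
    (v x : E) (h : E →L[ℝ] E) (w X : E) (H : E →L[ℝ] E) :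
    fderiv ℝ (transportField Γ) (v, x, h) (w, X, H) =
      (H v + h w, -((fderiv ℝ Γ x X (h v) + Γ x (H v + h w)) ∘L h + Γ x (h v) ∘L H)) := by
  have hp : HasFDerivAt (fun p : E × E × (E →L[ℝ] E) ↦ p.2.2)
      (ContinuousLinearMap.snd ℝ E (E →L[ℝ] E) ∘L ContinuousLinearMap.snd ℝ E _) (v, x, h) :=
    ((ContinuousLinearMap.snd ℝ E (E →L[ℝ] E)) ∘L
      (ContinuousLinearMap.snd ℝ E (E × (E →L[ℝ] E)))).hasFDerivAt
  have hx : HasFDerivAt (fun p : E × E × (E →L[ℝ] E) ↦ p.2.1)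
      (ContinuousLinearMap.fst ℝ E (E →L[ℝ] E) ∘L ContinuousLinearMap.snd ℝ E _) (v, x, h) :=
    ((ContinuousLinearMap.fst ℝ E (E →L[ℝ] E)) ∘L
      (ContinuousLinearMap.snd ℝ E (E × (E →L[ℝ] E)))).hasFDerivAt
  have hv : HasFDerivAt (fun p : E × E × (E →L[ℝ] E) ↦ p.1)
      (ContinuousLinearMap.fst ℝ E _) (v, x, h) := hasFDerivAt_fst
  have h1 := hp.clm_apply hv
  have hΓx : HasFDerivAt Γ (fderiv ℝ Γ x) x := (hΓ.differentiable (by simp) x).hasFDerivAt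
  have h2 := (HasFDerivAt.comp (v, x, h) (g := Γ) hΓx hx).clm_apply h1
  have h3 := (h1.prodMk (h2.clm_comp hp).neg).fderiv
  have h4 : fderiv ℝ (transportField Γ) (v, x, h) = _ := h3
  rw [h4]
  ext a <;> simp
  all_goals abel

/-- The derivative `-h⁻¹ h' h⁻¹` of the inverse becomes `h⁻¹ A` when `h' = -A h`. -/
theorem hasDerivWithinAt_inverse_transport [CompleteSpace E] {h : ℝ → E →L[ℝ] E}
    {A : E →L[ℝ] E} {t : ℝ} {s : Set ℝ} (hu : IsUnit (h t))
    (hh : HasDerivWithinAt h (-(A ∘L h t)) s t) :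
    HasDerivWithinAt (fun t ↦ Ring.inverse (h t)) (Ring.inverse (h t) ∘L A) s t := by
  obtain ⟨u, hu⟩ := hu
  have h1 := hasFDerivAt_ringInverse (𝕜 := ℝ) u
  rw [hu] at h1
  refine (h1.comp_hasDerivWithinAt t hh).congr_deriv ?_
  have h2 : (↑u⁻¹ : E →L[ℝ] E) * h t = 1 := by rw [← hu]; simp
  have h3 : h t * (↑u⁻¹ : E →L[ℝ] E) = 1 := by rw [← hu]; simp
  have h4 : Ring.inverse (h t) = ↑u⁻¹ := by rw [← hu]; simp
  rw [h4]
  change -(↑u⁻¹ * (-(A * h t)) * ↑u⁻¹) = (↑u⁻¹ : E →L[ℝ] E) * A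
  rw [mul_neg, neg_mul, neg_neg, mul_assoc, mul_assoc, h3, mul_one]

/-- The variation of geodesics and of parallel transport, read in the transported frame. -/
theorem hasDerivWithinAt_variation [CompleteSpace E] {Γ : E → E →L[ℝ] E →L[ℝ] E}
    (hΓ : ContDiff ℝ ∞ Γ) {v w : E} {x X : ℝ → E} {h H : ℝ → E →L[ℝ] E} {t : ℝ} {s : Set ℝ}
    (hu : IsUnit (h t))
    (hx : HasDerivWithinAt x (h t v) s t)
    (hh : HasDerivWithinAt h (-(Γ (x t) (h t v) ∘L h t)) s t)
    (hX : HasDerivWithinAt X (H t v + h t w) s t)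
    (hH : HasDerivWithinAt H (-((fderiv ℝ Γ (x t) (X t) (h t v) + Γ (x t) (H t v + h t w)) ∘L h t +
      Γ (x t) (h t v) ∘L H t)) s t) :
    HasDerivWithinAt (fun t ↦ Ring.inverse (h t) (X t))
      (w + (Ring.inverse (h t) ∘L (H t + Γ (x t) (X t) ∘L h t)) v +
        Ring.inverse (h t) (chartTorsion Γ (x t) (h t v) (X t))) s t ∧
    HasDerivWithinAt (fun t ↦ Ring.inverse (h t) ∘L (H t + Γ (x t) (X t) ∘L h t))
      (Ring.inverse (h t) ∘L chartCurv Γ (x t) (h t v) (X t) ∘L h t) s t := by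
  have hk := hasDerivWithinAt_inverse_transport hu hh
  have hkh (a : E) : Ring.inverse (h t) (h t a) = a :=
    congrArg (fun A : E →L[ℝ] E ↦ A a) (Ring.inverse_mul_cancel _ hu)
  have hΓx : HasDerivWithinAt (fun t ↦ Γ (x t)) (fderiv ℝ Γ (x t) (h t v)) s t :=
    HasFDerivAt.comp_hasDerivWithinAt (E := E →L[ℝ] E →L[ℝ] E) (l := Γ) t
      (hΓ.differentiable (by simp) (x t)).hasFDerivAt hx
  -- Here `X` is the variation of the curve, `H` that of the frame, and `H + Γ(X) h` is the
  -- covariant derivative of the frame along the variation. Exchanging it with the derivative in `t`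
  -- produces the torsion in the first equation and the curvature in the second.
  constructor
  · refine (hk.clm_apply hX).congr_deriv ?_
    simp only [chartTorsion, ContinuousLinearMap.comp_apply, add_apply, map_add, map_sub, hkh]
    abel
  · refine (hk.clm_comp (hH.add ((hΓx.clm_apply hX).clm_comp hh))).congr_deriv ?_
    ext a
    simp only [chartCurv, ContinuousLinearMap.comp_apply, Pi.add_apply, add_apply, map_add, map_sub, neg_apply,
      map_neg, sub_apply]
    abel

end

/-! ### Equivariance of the exponential map -/

noncomputable section

set_option synthInstance.maxHeartbeats 200000

variable {E : Type*} [NormedAddCommGroup E] [NormedSpace ℝ E]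

/-- Solutions of the variation equation in a transported frame are equivariant under linear maps that
preserve torsion and curvature. -/
theorem variation_equivariant {Γ : E → E →L[ℝ] E →L[ℝ] E} {x₀ v w : E} {σ : E →L[ℝ] E}
    (hTσ : ∀ a b, σ (chartTorsion Γ x₀ a b) = chartTorsion Γ x₀ (σ a) (σ b))
    (hRσ : ∀ a b c, σ (chartCurv Γ x₀ a b c) = chartCurv Γ x₀ (σ a) (σ b) (σ c))
    {Θ Θ' : ℝ → E} {Om Om' : ℝ → E →L[ℝ] E}
    (hΘ : ∀ t ∈ Set.Icc (0 : ℝ) 1,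
      HasDerivWithinAt Θ (w + Om t v + chartTorsion Γ x₀ v (Θ t)) (Set.Icc 0 1) t)
    (hOm : ∀ t ∈ Set.Icc (0 : ℝ) 1,
      HasDerivWithinAt Om (chartCurv Γ x₀ v (Θ t)) (Set.Icc 0 1) t)
    (hΘ' : ∀ t ∈ Set.Icc (0 : ℝ) 1,
      HasDerivWithinAt Θ' (σ w + Om' t (σ v) + chartTorsion Γ x₀ (σ v) (Θ' t)) (Set.Icc 0 1) t)
    (hOm' : ∀ t ∈ Set.Icc (0 : ℝ) 1,
      HasDerivWithinAt Om' (chartCurv Γ x₀ (σ v) (Θ' t)) (Set.Icc 0 1) t)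
    (hΘ0 : Θ 0 = 0) (hOm0 : Om 0 = 0) (hΘ'0 : Θ' 0 = 0) (hOm'0 : Om' 0 = 0) :
    Θ' 1 = σ (Θ 1) := by
  -- The operator of the linear system satisfied by the defects `Θ' - σ Θ` and `Om' ∘ σ - σ ∘ Om`.
  -- Precomposing `Om'` with `σ` lets the second defect, evaluated at `v`, enter the equation of the
  -- first.
  let A : E × (E →L[ℝ] E) →L[ℝ] E × (E →L[ℝ] E) :=
    (ContinuousLinearMap.apply ℝ E v ∘L ContinuousLinearMap.snd ℝ E (E →L[ℝ] E) +
      (Γ x₀ (σ v) - (Γ x₀).flip (σ v)) ∘L ContinuousLinearMap.fst ℝ E (E →L[ℝ] E)).prod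
    ((ContinuousLinearMap.compL ℝ E E E).flip σ ∘L
      (fderiv ℝ Γ x₀ (σ v) - (fderiv ℝ Γ x₀).flip (σ v) +
        (ContinuousLinearMap.compL ℝ E E E (Γ x₀ (σ v)) ∘L Γ x₀ -
          (ContinuousLinearMap.compL ℝ E E E).flip (Γ x₀ (σ v)) ∘L Γ x₀)) ∘L
      ContinuousLinearMap.fst ℝ E (E →L[ℝ] E))
  have hA (a : E) (B : E →L[ℝ] E) :
      A (a, B) = (B v + chartTorsion Γ x₀ (σ v) a, chartCurv Γ x₀ (σ v) a ∘L σ) := rfl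
  let δ (t : ℝ) : E × (E →L[ℝ] E) :=
    (Θ' t - σ (Θ t), Om' t ∘L σ - σ ∘L Om t)
  have hTadd (a b : E) : chartTorsion Γ x₀ (σ v) (a - b) =
      chartTorsion Γ x₀ (σ v) a - chartTorsion Γ x₀ (σ v) b := by
    simp only [chartTorsion, map_sub, sub_apply]; abel
  have hRadd (a b : E) : chartCurv Γ x₀ (σ v) (a - b) =
      chartCurv Γ x₀ (σ v) a - chartCurv Γ x₀ (σ v) b := by
    ext z
    simp only [chartCurv, map_sub, sub_apply, add_apply, ContinuousLinearMap.comp_apply]; abel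
  have hδ : ∀ t ∈ Set.Icc (0 : ℝ) 1, HasDerivWithinAt δ (A (δ t)) (Set.Icc 0 1) t := by
    intro t ht
    have h5 : HasDerivWithinAt (fun t ↦ σ (Θ t)) _ (Set.Icc 0 1) t :=
      σ.hasFDerivAt.comp_hasDerivWithinAt t (hΘ t ht)
    have h6 := (hOm' t ht).clm_comp (hasDerivWithinAt_const t (Set.Icc 0 1) σ)
    have h7 := (hasDerivWithinAt_const t (Set.Icc 0 1) σ).clm_comp (hOm t ht)
    refine (((hΘ' t ht).sub h5).prodMk (h6.sub h7)).congr_deriv ?_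
    rw [hA]
    refine Prod.ext ?_ ?_
    · simp only [map_add, hTσ, hTadd, sub_apply, ContinuousLinearMap.comp_apply]
      abel
    · ext a
      simp only [hRadd, sub_apply, ContinuousLinearMap.comp_apply, add_apply, hRσ, zero_apply,
        map_zero]
      abel
  have hfin := eq_zero_of_linear_ode (A := fun _ ↦ A) continuousOn_const
    (by simp [δ, hΘ0, hOm0, hΘ'0, hOm'0]) hδ 1 (by simp)
  exact sub_eq_zero.1 (congrArg Prod.fst hfin)

namespace TensorFields

variable {ι : Type*} {S : TensorFields E ι}

set_option maxHeartbeats 400000 in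
/-- The exponential map at `x₀` of a connection with parallel tensors that determine the torsion and
the curvature: it is smooth near `0`, and its differential is equivariant, up to maps that intertwine
the tensors. -/
theorem exists_equivariant_exp [CompleteSpace E] {Γ : E → E →L[ℝ] E →L[ℝ] E}
    (hΓ : ContDiff ℝ ∞ Γ) {U : Set E} (hU : IsOpen U) {x₀ : E} (hx₀ : x₀ ∈ U)
    (hpar : ∀ x ∈ U, S.IsParallelAt Γ x)
    (hT : ∀ x ∈ U, ∀ y ∈ U, ∀ h : E →L[ℝ] E, IsUnit h → S.Intertwines x y h → ∀ a b,
      h (chartTorsion Γ x a b) = chartTorsion Γ y (h a) (h b))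
    (hR : ∀ x ∈ U, ∀ y ∈ U, ∀ h : E →L[ℝ] E, IsUnit h → S.Intertwines x y h → ∀ a b c,
      h (chartCurv Γ x a b c) = chartCurv Γ y (h a) (h b) (h c)) :
    ∃ (ex : E → E) (h : E → E →L[ℝ] E), ex 0 = x₀ ∧ h 0 = ContinuousLinearMap.id ℝ E ∧
      fderiv ℝ ex 0 = ContinuousLinearMap.id ℝ E ∧
      (∀ᶠ v in 𝓝 0, ContDiffAt ℝ ∞ ex v ∧ ex v ∈ U ∧ IsUnit (h v) ∧
        S.Intertwines x₀ (ex v) (h v)) ∧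
      ∀ σ : E →L[ℝ] E, IsUnit σ → S.Intertwines x₀ x₀ σ → ∀ᶠ v in 𝓝 0, ∀ w,
        fderiv ℝ ex (σ v) (σ w) = h (σ v) (σ (Ring.inverse (h v) (fderiv ℝ ex v w))) := by
  obtain ⟨c, hc0, hcO, hc⟩ := exists_smooth_solution_family (transportField Γ)
    (contDiff_transportField hΓ) (fun y ↦ by simp [transportField])
    (x₀, ContinuousLinearMap.id ℝ E)
  have hn : (∞ : WithTop ℕ∞) ≠ 0 := by simp
  -- components of the solutions
  have hO := hcO (U ×ˢ {A : E →L[ℝ] E | IsUnit A}) ((hU.prod Units.isOpen).mem_nhds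
    ⟨hx₀, isUnit_one⟩)
  let X (v w : E) (t : ℝ) : E := (fderiv ℝ (fun v ↦ c v t) v w).1
  let H (v w : E) (t : ℝ) : E →L[ℝ] E := (fderiv ℝ (fun v ↦ c v t) v w).2
  let good (v : E) : Prop :=
    (∀ t ∈ Set.Icc (0 : ℝ) 1, (c v t).1 ∈ U ∧ IsUnit (c v t).2 ∧
      S.Intertwines x₀ (c v t).1 (c v t).2 ∧
      HasDerivWithinAt (fun t ↦ (c v t).1) ((c v t).2 v) (Set.Icc 0 1) t ∧
      HasDerivWithinAt (fun t ↦ (c v t).2) (-(Γ (c v t).1 ((c v t).2 v) ∘L (c v t).2))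
        (Set.Icc 0 1) t) ∧
    (∀ t, ContDiffAt ℝ ∞ (fun v ↦ c v t) v) ∧
    ∀ w, (X v w 0 = 0 ∧ H v w 0 = 0) ∧ ∀ t ∈ Set.Icc (0 : ℝ) 1,
      HasDerivWithinAt (X v w) (H v w t v + (c v t).2 w) (Set.Icc 0 1) t ∧
      HasDerivWithinAt (H v w) (-((fderiv ℝ Γ (c v t).1 (X v w t) ((c v t).2 v) +
        Γ (c v t).1 (H v w t v + (c v t).2 w)) ∘L (c v t).2 +
        Γ (c v t).1 ((c v t).2 v) ∘L H v w t)) (Set.Icc 0 1) t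
  have hgood : ∀ᶠ v in 𝓝 0, good v := by
    filter_upwards [hc, hO] with v hv hvO
    obtain ⟨hv1, hv2, hv3, hv4⟩ := hv
    have hx (t) (ht : t ∈ Set.Icc (0 : ℝ) 1) :
        HasDerivWithinAt (fun t ↦ (c v t).1) ((c v t).2 v) (Set.Icc 0 1) t :=
      (hv3 t ht).fst
    have hh (t) (ht : t ∈ Set.Icc (0 : ℝ) 1) : HasDerivWithinAt (fun t ↦ (c v t).2)
        (-(Γ (c v t).1 ((c v t).2 v) ∘L (c v t).2)) (Set.Icc 0 1) t :=
      (hv3 t ht).snd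
    have hhc : ContinuousOn (fun t ↦ (c v t).2 v) (Set.Icc (0 : ℝ) 1) :=
      ContinuousOn.clm_apply (fun t ht ↦ (hh t ht).continuousWithinAt) continuousOn_const
    have hI := intertwines_of_transport hΓ.continuous hhc (fun t _ ↦ hpar _ (hvO t).1)
      (by rw [hv2]) (by rw [hv2]) hx hh
    refine ⟨fun t ht ↦ ⟨(hvO t).1, (hvO t).2, hI t ht, hx t ht, hh t ht⟩, hv1, fun w ↦ ?_⟩
    obtain ⟨h1, h2⟩ := hv4 w
    refine ⟨⟨by simp [X, h1], by simp [H, h1]⟩, fun t ht ↦ ?_⟩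
    have h3 := h2 t ht
    have h4 : fderiv ℝ (transportField Γ) (v, c v t) (w, fderiv ℝ (fun v ↦ c v t) v w) =
        (H v w t v + (c v t).2 w, -((fderiv ℝ Γ (c v t).1 (X v w t) ((c v t).2 v) +
        Γ (c v t).1 (H v w t v + (c v t).2 w)) ∘L (c v t).2 +
        Γ (c v t).1 ((c v t).2 v) ∘L H v w t)) :=
      fderiv_transportField hΓ v (c v t).1 (c v t).2 w (X v w t) (H v w t)
    rw [h4] at h3
    exact ⟨h3.fst, h3.snd⟩
  have hX1 (v w : E) (hv : good v) (t : ℝ) : fderiv ℝ (fun v ↦ (c v t).1) v w = X v w t := by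
    have h1 := ((hv.2.1 t).differentiableAt hn).hasFDerivAt.fst
    rw [h1.fderiv]
    rfl
  -- the variation in the transported frame
  let Θ (v w : E) (t : ℝ) : E := Ring.inverse (c v t).2 (X v w t)
  let Om (v w : E) (t : ℝ) : E →L[ℝ] E :=
    Ring.inverse (c v t).2 ∘L (H v w t + Γ (c v t).1 (X v w t) ∘L (c v t).2)
  have hvar (v w : E) (hv : good v) (t : ℝ) (ht : t ∈ Set.Icc (0 : ℝ) 1) :
      HasDerivWithinAt (Θ v w) (w + Om v w t v + chartTorsion Γ x₀ v (Θ v w t)) (Set.Icc 0 1) t ∧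
      HasDerivWithinAt (Om v w) (chartCurv Γ x₀ v (Θ v w t)) (Set.Icc 0 1) t := by
    obtain ⟨h1, h2, h3, h4, h5⟩ := hv.1 t ht
    obtain ⟨h6, h7⟩ := (hv.2.2 w).2 t ht
    have hkh (a : E) : Ring.inverse (c v t).2 ((c v t).2 a) = a :=
      congrArg (fun A : E →L[ℝ] E ↦ A a) (Ring.inverse_mul_cancel _ h2)
    have hhk (a : E) : (c v t).2 (Ring.inverse (c v t).2 a) = a :=
      congrArg (fun A : E →L[ℝ] E ↦ A a) (Ring.mul_inverse_cancel _ h2)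
    obtain ⟨h8, h9⟩ := hasDerivWithinAt_variation (x := fun t ↦ (c v t).1) (X := X v w)
      (h := fun t ↦ (c v t).2) (H := H v w) hΓ h2 h4 h5 h6 h7
    refine ⟨h8.congr_deriv ?_, h9.congr_deriv ?_⟩
    -- The transported frame intertwines the tensors, hence carries torsion and curvature at `x₀` to
    -- those at the point of the curve: the system has constant coefficients.
    · have := hT x₀ hx₀ _ h1 _ h2 h3 v (Θ v w t)
      simp only [Θ, hhk] at this
      rw [← this, hkh]
    · ext a
      have := hR x₀ hx₀ _ h1 _ h2 h3 v (Θ v w t) a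
      simp only [Θ, hhk] at this
      simp only [ContinuousLinearMap.comp_apply]
      rw [← this, hkh]
  have hgood0 : good 0 := hgood.self_of_nhds
  refine ⟨fun v ↦ (c v 1).1, fun v ↦ (c v 1).2, by simp [hc0], by simp [hc0], ?_, ?_, ?_⟩
  · ext w
    rw [hX1 0 w hgood0]
    -- At `v = 0` the curve and the frame are constant, so the variation is `t • w` and the
    -- differential of `exp` at `0` is the identity.
    have hd : ∀ t ∈ Set.Icc (0 : ℝ) 1, HasDerivWithinAt (fun t ↦ X 0 w t - t • w)
        ((0 : E →L[ℝ] E) (X 0 w t - t • w)) (Set.Icc 0 1) t := by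
      intro t ht
      refine (((hgood0.2.2 w).2 t ht).1.sub
        ((hasDerivWithinAt_id t _).smul_const w)).congr_deriv ?_
      simp [hc0]
    have := eq_zero_of_linear_ode continuousOn_const (by simp [(hgood0.2.2 w).1.1]) hd 1 (by simp)
    simpa [sub_eq_zero] using this
  · filter_upwards [hgood] with v hv
    obtain ⟨h1, h2, h3, -, -⟩ := hv.1 1 (by simp)
    exact ⟨(hv.2.1 1).fst, h1, h2, h3⟩
  · intro σ hσu hσ
    have hσ0 : Filter.Tendsto σ (𝓝 0) (𝓝 0) := by simpa using σ.continuous.tendsto 0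
    filter_upwards [hgood, hσ0.eventually hgood] with v hv hσv w
    have hinv0 (u z : E) (hu : good u) : Θ u z 0 = 0 ∧ Om u z 0 = 0 := by
      have := (hu.2.2 z).1
      simp [Θ, Om, this]
    have h8 : Θ (σ v) (σ w) 1 = σ (Θ v w 1) := variation_equivariant
      (hT x₀ hx₀ x₀ hx₀ σ hσu hσ) (hR x₀ hx₀ x₀ hx₀ σ hσu hσ)
      (fun t ht ↦ (hvar v w hv t ht).1) (fun t ht ↦ (hvar v w hv t ht).2)
      (fun t ht ↦ (hvar _ _ hσv t ht).1) (fun t ht ↦ (hvar _ _ hσv t ht).2)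
      (hinv0 v w hv).1 (hinv0 v w hv).2 (hinv0 _ _ hσv).1 (hinv0 _ _ hσv).2
    rw [hX1 _ _ hσv, hX1 _ _ hv]
    have hhk (a : E) : (c (σ v) 1).2 (Ring.inverse (c (σ v) 1).2 a) = a :=
      congrArg (fun A : E →L[ℝ] E ↦ A a) (Ring.mul_inverse_cancel _ (hσv.1 1 (by simp)).2.1)
    change X (σ v) (σ w) 1 = (c (σ v) 1).2 (σ (Θ v w 1))
    rw [← h8, hhk]

end TensorFields

end

/-! ### Local automorphisms from the exponential map -/

noncomputable section

set_option synthInstance.maxHeartbeats 200000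

variable {E : Type*} [NormedAddCommGroup E] [NormedSpace ℝ E]

/-- A function that is smooth on a neighbourhood of a point coincides, near that point, with a
globally smooth function. -/
theorem exists_contDiff_eventuallyEq [FiniteDimensional ℝ E] {F : Type*} [NormedAddCommGroup F]
    [NormedSpace ℝ F] {f : E → F} {U : Set E} (hU : IsOpen U) (hf : ContDiffOn ℝ ∞ f U) {x₀ : E}
    (hx₀ : x₀ ∈ U) : ∃ f' : E → F, ContDiff ℝ ∞ f' ∧ f' =ᶠ[𝓝 x₀] f := by
  obtain ⟨r, hr, hrU⟩ := Metric.isOpen_iff.1 hU x₀ hx₀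
  let χ : ContDiffBump x₀ := ⟨r / 4, r / 2, by positivity, by linarith⟩
  refine ⟨fun x ↦ χ x • f x, contDiff_iff_contDiffAt.2 fun x ↦ ?_, ?_⟩
  · by_cases hx : x ∈ U
    · exact χ.contDiffAt.smul (hf.contDiffAt (hU.mem_nhds hx))
    · have h1 : x ∉ tsupport χ := by
        rw [χ.tsupport_eq]
        intro h
        exact hx (hrU (Metric.closedBall_subset_ball (by simp only [χ]; linarith) h))
      refine contDiffAt_const (c := (0 : F)) |>.congr_of_eventuallyEq ?_
      filter_upwards [(isClosed_tsupport χ).isOpen_compl.mem_nhds h1] with y hy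
      simp [image_eq_zero_of_notMem_tsupport hy]
  · filter_upwards [χ.eventuallyEq_one] with x hx
    simp [hx]

namespace TensorFields

variable {ι : Type*} {S : TensorFields E ι}

set_option maxHeartbeats 400000 in
/-- If the torsion and the curvature of a connection are determined by parallel tensors, then every
linear map of a tangent space that preserves the tensors is the differential of a local
automorphism. -/
theorem exists_local_automorphism [FiniteDimensional ℝ E] {Γ : E → E →L[ℝ] E →L[ℝ] E}
    {U : Set E} (hU : IsOpen U) (hΓ : ContDiffOn ℝ ∞ Γ U) {x₀ : E} (hx₀ : x₀ ∈ U)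
    (hpar : ∀ x ∈ U, S.IsParallelAt Γ x)
    (hT : ∀ x ∈ U, ∀ y ∈ U, ∀ h : E →L[ℝ] E, IsUnit h → S.Intertwines x y h → ∀ a b,
      h (chartTorsion Γ x a b) = chartTorsion Γ y (h a) (h b))
    (hR : ∀ x ∈ U, ∀ y ∈ U, ∀ h : E →L[ℝ] E, IsUnit h → S.Intertwines x y h → ∀ a b c,
      h (chartCurv Γ x a b c) = chartCurv Γ y (h a) (h b) (h c))
    (σ : E ≃L[ℝ] E) (hσ : S.Intertwines x₀ x₀ σ) :
    ∃ ψ : OpenPartialHomeomorph E E, x₀ ∈ ψ.source ∧ ψ.source ⊆ U ∧ ψ.target ⊆ U ∧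
      ContDiffOn ℝ ∞ ψ ψ.source ∧ ContDiffOn ℝ ∞ ψ.symm ψ.target ∧ ψ x₀ = x₀ ∧
      fderiv ℝ ψ x₀ = σ ∧ ∀ x ∈ ψ.source, S.Intertwines x (ψ x) (fderiv ℝ ψ x) := by
  have : CompleteSpace E := FiniteDimensional.complete ℝ E
  have hn : (∞ : WithTop ℕ∞) ≠ 0 := by simp
  -- The solution theory uses globally smooth coefficients. The connection is changed away from
  -- `x₀`, and only points of a neighbourhood `V` where nothing has changed are used.
  obtain ⟨Γ', hΓ', hΓeq⟩ := exists_contDiff_eventuallyEq hU hΓ hx₀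
  obtain ⟨V, hVs, hV, hxV⟩ := eventually_nhds_iff.1 (hΓeq.and (hU.mem_nhds hx₀))
  have hVΓ (x) (hx : x ∈ V) : Γ' x = Γ x := (hVs x hx).1
  have hVΓd (x) (hx : x ∈ V) : fderiv ℝ Γ' x = fderiv ℝ Γ x :=
    Filter.EventuallyEq.fderiv_eq ((hV.mem_nhds hx |> Filter.mem_of_superset) fun y hy ↦ hVΓ y hy)
  have hVT (x) (hx : x ∈ V) : chartTorsion Γ' x = chartTorsion Γ x := by
    ext a b; simp [chartTorsion, hVΓ x hx]
  have hVR (x) (hx : x ∈ V) : chartCurv Γ' x = chartCurv Γ x := by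
    ext a b; simp [chartCurv, hVΓ x hx, hVΓd x hx]
  have hσu : IsUnit (σ : E →L[ℝ] E) := ⟨ContinuousLinearEquiv.toUnit σ, rfl⟩
  obtain ⟨ex, h, hex0, hh0, hexd, hex, heq⟩ := exists_equivariant_exp (S := S) hΓ' hV hxV
    (fun x hx ↦ by
      obtain ⟨h1, h2, h3, h4, h5, h6⟩ := hpar x (hVs x hx).2
      refine ⟨h1, h2, h3, ?_, ?_, ?_⟩ <;> rwa [hVΓ x hx])
    (fun x hx y hy h hu hI a b ↦ by
      rw [hVT x hx, hVT y hy]; exact hT x (hVs x hx).2 y (hVs y hy).2 h hu hI a b)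
    (fun x hx y hy h hu hI a b c ↦ by
      rw [hVR x hx, hVR y hy]; exact hR x (hVs x hx).2 y (hVs y hy).2 h hu hI a b c)
  have hs0 : ContDiffAt ℝ ∞ ex 0 := hex.self_of_nhds.1
  have hunit : ∀ᶠ v in 𝓝 0, IsUnit (fderiv ℝ ex v) := by
    have h1 : ContinuousAt (fderiv ℝ ex) 0 := (hs0.fderiv_right (m := 0) (by simp)).continuousAt
    exact h1.eventually (Units.isOpen.mem_nhds (by rw [hexd]; exact isUnit_one))
  obtain ⟨W, hWs, hW, h0W⟩ := eventually_nhds_iff.1 (hex.and (hunit.and (heq σ hσu hσ)))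
  have hd0 : HasFDerivAt ex ((ContinuousLinearEquiv.refl ℝ E : E ≃L[ℝ] E) : E →L[ℝ] E) 0 := by
    have := (hs0.differentiableAt hn).hasFDerivAt
    rw [hexd] at this
    exact this
  let e := (hs0.toOpenPartialHomeomorph ex hd0 hn).restrOpen W hW
  have he (v : E) : e v = ex v := rfl
  have hes : e.source ⊆ W := by
    intro v hv
    exact hv.2
  have h0e : (0 : E) ∈ e.source :=
    ⟨hs0.mem_toOpenPartialHomeomorph_source hd0 hn, h0W⟩
  have hsymm (y : E) (hy : y ∈ e.target) : ContDiffAt ℝ ∞ e.symm y := by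
    obtain ⟨h1, ⟨u, hu⟩, -⟩ := hWs _ (hes (e.map_target hy))
    refine e.contDiffAt_symm (f₀' := ContinuousLinearEquiv.ofUnit u) hy ?_ h1.1
    have := (h1.1.differentiableAt hn).hasFDerivAt
    rw [← hu] at this
    exact this
  -- The candidate `exp ∘ σ ∘ exp⁻¹`, with `e` a local inverse pair for `exp`.
  let ψ := (e.symm.trans σ.toHomeomorph.toOpenPartialHomeomorph).trans e
  have hψ (x : E) : ψ x = ex (σ (e.symm x)) := rfl
  have hψs (x : E) (hx : x ∈ ψ.source) : x ∈ e.target ∧ σ (e.symm x) ∈ e.source :=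
    ⟨hx.1.1, hx.2⟩
  have hψd (x : E) (hx : x ∈ ψ.source) : ContDiffAt ℝ ∞ ψ x := by
    obtain ⟨h1, h2⟩ := hψs x hx
    have h3 : ContDiffAt ℝ ∞ (fun x ↦ σ (e.symm x)) x := σ.contDiff.contDiffAt.comp x (hsymm x h1)
    have h4 : ContDiffAt ℝ ∞ (fun x ↦ ex (σ (e.symm x))) x :=
      ContDiffAt.comp (g := ex) x (hWs _ (hes h2)).1.1 h3
    exact h4
  have hx0 : e.symm x₀ = 0 := by
    rw [← hex0, ← he 0, e.left_inv h0e]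
  -- By equivariance the differential of `ψ` at `exp v` is `h(σ v) ∘ σ ∘ h(v)⁻¹`, a composite of
  -- maps that intertwine the tensors.
  have hmain (x : E) (hx : x ∈ ψ.source) :
      fderiv ℝ ψ x = h (σ (e.symm x)) ∘L σ ∘L Ring.inverse (h (e.symm x)) := by
    obtain ⟨h1, h2⟩ := hψs x hx
    set v := e.symm x with hv
    have hvs : v ∈ e.source := e.map_target h1
    have hxv : x = ex v := by rw [hv, ← he, e.right_inv h1]
    obtain ⟨hvc, ⟨u, hu⟩, hveq⟩ := hWs v (hes hvs)
    have h3 : HasFDerivAt (fun v ↦ ψ (ex v)) (fderiv ℝ ψ x ∘L fderiv ℝ ex v) v := by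
      have h4 := ((hψd x hx).differentiableAt hn).hasFDerivAt
      rw [hxv] at h4 ⊢
      exact h4.comp v (hvc.1.differentiableAt hn).hasFDerivAt
    have h5 : HasFDerivAt (fun v ↦ ex (σ v)) (fderiv ℝ ex (σ v) ∘L (σ : E →L[ℝ] E)) v :=
      ((hWs _ (hes h2)).1.1.differentiableAt hn).hasFDerivAt.comp v σ.hasFDerivAt
    have h6 : (fun v ↦ ψ (ex v)) =ᶠ[𝓝 v] fun v ↦ ex (σ v) := by
      filter_upwards [e.open_source.mem_nhds hvs] with v' hv'
      rw [hψ, ← he v', e.left_inv hv']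
    have h7 := h3.unique (h5.congr_of_eventuallyEq h6)
    ext a
    have h8 : fderiv ℝ ex v ((↑u⁻¹ : E →L[ℝ] E) a) = a := by
      rw [← hu]
      exact congrArg (fun A : E →L[ℝ] E ↦ A a) u.mul_inv
    have h9 := congrArg (fun A : E →L[ℝ] E ↦ A ((↑u⁻¹ : E →L[ℝ] E) a)) h7
    simp only [ContinuousLinearMap.comp_apply, h8] at h9
    rw [h9]
    have h10 := hveq ((↑u⁻¹ : E →L[ℝ] E) a)
    rw [h8] at h10
    exact h10
  have hψx0 : x₀ ∈ ψ.source := by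
    refine ⟨⟨?_, trivial⟩, ?_⟩
    · rw [← hex0, ← he]; exact e.map_source h0e
    · change σ (e.symm x₀) ∈ e.source
      rw [hx0, map_zero]; exact h0e
  refine ⟨ψ, hψx0, fun x hx ↦ ?_, fun y hy ↦ ?_, fun x hx ↦ (hψd x hx).contDiffWithinAt,
    fun y hy ↦ ContDiffAt.contDiffWithinAt ?_, by rw [hψ, hx0, map_zero, hex0], ?_, fun x hx ↦ ?_⟩
  · obtain ⟨h1, h2⟩ := hψs x hx
    have := (hWs _ (hes (e.map_target h1))).1.2.1
    rw [← he, e.right_inv h1] at this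
    exact (hVs _ this).2
  · have h1 : y ∈ e.target := hy.1
    have := (hWs _ (hes (e.map_target h1))).1.2.1
    rw [← he, e.right_inv h1] at this
    exact (hVs _ this).2
  · have h1 : y ∈ e.target := hy.1
    have h2 : σ.symm (e.symm y) ∈ e.source := hy.2.2
    have h3 : ContDiffAt ℝ ∞ (fun y ↦ σ.symm (e.symm y)) y :=
      σ.symm.contDiff.contDiffAt.comp y (hsymm y h1)
    have h4 : ContDiffAt ℝ ∞ (fun y ↦ ex (σ.symm (e.symm y))) y :=
      ContDiffAt.comp (g := ex) y (hWs _ (hes h2)).1.1 h3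
    exact h4
  · rw [hmain x₀ hψx0, hx0, map_zero, hh0]
    ext a
    have : Ring.inverse (ContinuousLinearMap.id ℝ E) = ContinuousLinearMap.id ℝ E :=
      Ring.inverse_one (E →L[ℝ] E)
    simp [this]
  · obtain ⟨h1, h2⟩ := hψs x hx
    rw [hmain x hx]
    obtain ⟨-, -, hu, hI⟩ := (hWs _ (hes (e.map_target h1))).1
    rw [← he, e.right_inv h1] at hI
    have hI2 := (hWs _ (hes h2)).1.2.2.2
    have hI3 := hI.inverse
      (fun a ↦ congrArg (fun A : E →L[ℝ] E ↦ A a) (Ring.mul_inverse_cancel _ hu))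
      (fun a ↦ congrArg (fun A : E →L[ℝ] E ↦ A a) (Ring.inverse_mul_cancel _ hu))
    exact hI2.comp (hσ.comp hI3)

end TensorFields

end

noncomputable section

set_option synthInstance.maxHeartbeats 200000

/-! ### Algebraic curvature tensors of sub-symmetric type -/

/-- A tensor with the symmetries of the curvature of a Kähler manifold. -/
structure IsKaehlerTensor {W : Type*} [AddCommGroup W] [Module ℝ W] (J : W →ₗ[ℝ] W)
    (K : W → W → W → W → ℝ) : Prop where
  add : ∀ a a' b c d, K (a + a') b c d = K a b c d + K a' b c d
  smul : ∀ (t : ℝ) (a b c d), K (t • a) b c d = t * K a b c d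
  skew : ∀ a b c d, K a b c d = -K b a c d
  skew' : ∀ a b c d, K a b c d = -K a b d c
  inv : ∀ a b c d, K a b (J c) (J d) = K a b c d
  bianchi : ∀ a b c d, K a b c d + K b c a d + K c a b d = 0

namespace IsKaehlerTensor

variable {W : Type*} [AddCommGroup W] [Module ℝ W] {J : W →ₗ[ℝ] W} {K : W → W → W → W → ℝ}

/-- The classical octahedron argument: the four Bianchi identities are combined and the skew
symmetries cancel all other terms. -/
theorem pair (h : IsKaehlerTensor J K) (a b c d : W) : K a b c d = K c d a b := by
  have b1 := h.bianchi a b c d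
  have b2 := h.bianchi b c d a
  have b3 := h.bianchi c d a b
  have b4 := h.bianchi d a b c
  linarith [h.skew' a b d c, h.skew' b c d a, h.skew' b c a d, h.skew' c d a b, h.skew c a b d,
    h.skew' a c b d, h.skew d b c a, h.skew' b d c a, h.skew' d a b c, h.skew' c a b d,
    h.skew' d b c a, h.skew a c d b, h.skew b d a c]

theorem inv_left (h : IsKaehlerTensor J K) (a b c d : W) : K (J a) (J b) c d = K a b c d := by
  rw [h.pair, h.inv, h.pair]

theorem add₂ (h : IsKaehlerTensor J K) (a b b' c d : W) :
    K a (b + b') c d = K a b c d + K a b' c d := by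
  rw [h.skew, h.add, h.skew b, h.skew b']; ring

theorem add₃ (h : IsKaehlerTensor J K) (a b c c' d : W) :
    K a b (c + c') d = K a b c d + K a b c' d := by
  rw [h.pair, h.add, h.pair c, h.pair c']

theorem add₄ (h : IsKaehlerTensor J K) (a b c d d' : W) :
    K a b c (d + d') = K a b c d + K a b c d' := by
  rw [h.pair, h.add₂, h.pair c, h.pair c]

theorem neg (h : IsKaehlerTensor J K) (a b c d : W) : K (-a) b c d = -K a b c d := by
  rw [← neg_one_smul ℝ, h.smul]; ring

theorem smul₃ (h : IsKaehlerTensor J K) (t : ℝ) (a b c d : W) :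
    K a b (t • c) d = t * K a b c d := by
  rw [h.pair, h.smul, h.pair c]

theorem smul₄ (h : IsKaehlerTensor J K) (t : ℝ) (a b c d : W) :
    K a b c (t • d) = t * K a b c d := by
  rw [h.skew', h.smul₃, h.skew' a b c]; ring

theorem J_left (h : IsKaehlerTensor J K) (hJ : ∀ x, J (J x) = -x) (a b c d : W) :
    K (J a) b c d = -K a (J b) c d := by
  rw [← h.inv_left (J a), hJ, h.neg]

theorem J_right (h : IsKaehlerTensor J K) (hJ : ∀ x, J (J x) = -x) (a b c d : W) :
    K a b (J c) d = -K a b c (J d) := by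
  rw [h.pair, h.J_left hJ, h.pair]

end IsKaehlerTensor

/-- The algebraic properties of the horizontal curvature `r` of a Tanaka-Webster connection whose
torsion `τ` satisfies `∇_X τ = 0` for horizontal `X`, and `ν = ∇_ξ τ`. -/
structure IsWebsterCurvature {W : Type*} [AddCommGroup W] [Module ℝ W]
    (g : W →ₗ[ℝ] W →ₗ[ℝ] ℝ) (J τ ν : W →ₗ[ℝ] W) (r : W → W → W → W → ℝ) : Prop where
  g_symm : ∀ x y, g x y = g y x
  g_pos : ∀ x, x ≠ 0 → 0 < g x x
  J_J : ∀ x, J (J x) = -x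
  g_J : ∀ x y, g (J x) y = -g x (J y)
  τ_symm : ∀ x y, g (τ x) y = g x (τ y)
  τ_J : ∀ x, τ (J x) = -J (τ x)
  add : ∀ a a' b c d, r (a + a') b c d = r a b c d + r a' b c d
  smul : ∀ (t : ℝ) (a b c d), r (t • a) b c d = t * r a b c d
  skew : ∀ a b c d, r a b c d = -r b a c d
  skew' : ∀ a b c d, r a b c d = -r a b d c
  inv : ∀ a b c d, r a b (J c) (J d) = r a b c d
  bianchi : ∀ a b c d, r a b c d + r b c a d + r c a b d =
    g (J a) b * g (τ c) d + g (J b) c * g (τ a) d + g (J c) a * g (τ b) d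
  comm : ∀ a b c d, r a b (τ c) d - r a b c (τ d) = -(g (J a) b * g (ν c) d)

open TensorAlg

namespace IsWebsterCurvature

variable {W : Type*} [AddCommGroup W] [Module ℝ W]
    {g : W →ₗ[ℝ] W →ₗ[ℝ] ℝ} {J τ ν : W →ₗ[ℝ] W} {r : W → W → W → W → ℝ}

/-- The part of the curvature that is determined by the torsion. -/
def torsionPart (g : W →ₗ[ℝ] W →ₗ[ℝ] ℝ) (J τ : W →ₗ[ℝ] W) (a b c d : W) : ℝ :=
  -(1 / 2) * (kulkarni (fun x y ↦ g (J x) y) (fun x y ↦ g (τ x) y) a b c d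
    - kulkarni (fun x y ↦ g x y) (fun x y ↦ g (J (τ x)) y) a b c d)

theorem g_J_J (h : IsWebsterCurvature g J τ ν r) (x y : W) : g (J x) (J y) = g x y := by
  rw [h.g_J, h.J_J]; simp

theorem omega_skew (h : IsWebsterCurvature g J τ ν r) (x y : W) : g (J x) y = -g (J y) x := by
  rw [h.g_J, h.g_symm]

theorem B_symm (h : IsWebsterCurvature g J τ ν r) (x y : W) : g (J (τ x)) y = g (J (τ y)) x := by
  rw [h.g_J, h.τ_symm, h.τ_J, map_neg, h.g_symm]; simp

theorem A_symm (h : IsWebsterCurvature g J τ ν r) (x y : W) : g (τ x) y = g (τ y) x := by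
  rw [h.τ_symm, h.g_symm]

/-- `torsionPart` is a particular solution of the inhomogeneous Bianchi identity of the curvature,
so subtracting it leaves the homogeneous identity. -/
theorem torsionPart_bianchi (h : IsWebsterCurvature g J τ ν r) (a b c d : W) :
    torsionPart g J τ a b c d + torsionPart g J τ b c a d + torsionPart g J τ c a b d =
      g (J a) b * g (τ c) d + g (J b) c * g (τ a) d + g (J c) a * g (τ b) d := by
  simp only [torsionPart, kulkarni, symProd]
  rw [h.omega_skew c b, h.omega_skew b a, h.omega_skew a c, h.A_symm c b, h.A_symm b a,
    h.A_symm a c, h.B_symm c b, h.B_symm b a, h.B_symm a c, h.g_symm c b, h.g_symm b a,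
    h.g_symm a c]
  ring

theorem torsionPart_skew (a b c d : W) : torsionPart g J τ a b c d = -torsionPart g J τ b a c d := by
  simp only [torsionPart, kulkarni, symProd]; ring

theorem torsionPart_skew' (a b c d : W) :
    torsionPart g J τ a b c d = -torsionPart g J τ a b d c := by
  simp only [torsionPart, kulkarni, symProd]; ring

/-- Each Kulkarni product goes to minus the other, so their difference is unchanged. -/
theorem torsionPart_inv (h : IsWebsterCurvature g J τ ν r) (a b c d : W) :
    torsionPart g J τ a b (J c) (J d) = torsionPart g J τ a b c d := by
  have h1 (x y : W) : g x (J y) = -g (J x) y := by rw [h.g_J]; ring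
  have h2 (x y : W) : g (τ x) (J y) = -g (J (τ x)) y := by rw [h.g_J]; ring
  simp only [torsionPart, kulkarni, symProd, h.g_J_J, h1]
  ring

/-- As `τ` anticommutes with `J`, replacing `(a, b)` by `(Ja, Jb)` exchanges the two Kulkarni
products. This sign is what separates `torsionPart` from the Kähler part, which is invariant. -/
theorem torsionPart_inv_left (h : IsWebsterCurvature g J τ ν r) (a b c d : W) :
    torsionPart g J τ (J a) (J b) c d = -torsionPart g J τ a b c d := by
  simp only [torsionPart, kulkarni, symProd, h.τ_J, h.J_J]
  simp only [map_neg, LinearMap.neg_apply, h.J_J]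
  ring

/-- The difference of the curvature and its torsion part is a Kähler tensor. -/
theorem isKaehlerTensor (h : IsWebsterCurvature g J τ ν r) :
    IsKaehlerTensor J (fun a b c d ↦ r a b c d - torsionPart g J τ a b c d) where
  add a a' b c d := by
    simp only [h.add, torsionPart, kulkarni, symProd, map_add, LinearMap.add_apply]; ring
  smul t a b c d := by
    simp only [h.smul, torsionPart, kulkarni, symProd, map_smul, LinearMap.smul_apply, smul_eq_mul]
    ring
  skew a b c d := by rw [h.skew, torsionPart_skew]; ring
  skew' a b c d := by rw [h.skew', torsionPart_skew']; ring
  inv a b c d := by rw [h.inv, h.torsionPart_inv]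
  bianchi a b c d := by linarith [h.bianchi a b c d, h.torsionPart_bianchi a b c d]

/-- The `J`-invariant part of the curvature is the Kähler part. -/
theorem half_add (h : IsWebsterCurvature g J τ ν r) (a b c d : W) : 1 / 2 * (r a b c d + r (J a) (J b) c d) =
    r a b c d - torsionPart g J τ a b c d := by
  have h1 := h.isKaehlerTensor.inv_left a b c d
  have h2 := h.torsionPart_inv_left a b c d
  linarith

/-- The commutator identity at `(a, b)` and at `(Ja, Jb)` are added and subtracted: the Kähler part
and `ω` are invariant, the torsion part is anti-invariant. The torsion part yields a condition on
`τ` alone, and `ν` is left to the Kähler part. -/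
theorem comm_both (h : IsWebsterCurvature g J τ ν r) (a b c d : W) :
    torsionPart g J τ a b (τ c) d = torsionPart g J τ a b c (τ d) ∧
    (r a b (τ c) d - torsionPart g J τ a b (τ c) d)
      - (r a b c (τ d) - torsionPart g J τ a b c (τ d)) = -(g (J a) b * g (ν c) d) := by
  have h1 := h.comm a b c d
  have h2 := h.comm (J a) (J b) c d
  have h3 := h.isKaehlerTensor.inv_left a b (τ c) d
  have h4 := h.isKaehlerTensor.inv_left a b c (τ d)
  have h5 := h.torsionPart_inv_left a b (τ c) d
  have h6 := h.torsionPart_inv_left a b c (τ d)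
  rw [h.g_J_J] at h2
  constructor <;> linarith

end IsWebsterCurvature

/-- An orthonormal basis of `W`, for the bilinear form `g`. -/
structure IsOrthonormalFrame {W : Type*} [AddCommGroup W] [Module ℝ W]
    (g : W →ₗ[ℝ] W →ₗ[ℝ] ℝ) {n : ℕ} (e : Fin n → W) : Prop where
  orth : ∀ i j, g (e i) (e j) = if i = j then 1 else 0
  expand : ∀ x, x = ∑ i, g x (e i) • e i

namespace IsOrthonormalFrame

variable {W : Type*} [AddCommGroup W] [Module ℝ W] {g : W →ₗ[ℝ] W →ₗ[ℝ] ℝ} {n : ℕ} {e : Fin n → W}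

theorem sum_mul (he : IsOrthonormalFrame g e) (x y : W) :
    ∑ i, g x (e i) * g (e i) y = g x y := by
  conv_rhs => rw [he.expand x]
  simp [map_sum, LinearMap.sum_apply]

theorem sum_mul_apply (he : IsOrthonormalFrame g e) (x : W) (f : W →ₗ[ℝ] ℝ) :
    ∑ i, g x (e i) * f (e i) = f x := by
  conv_rhs => rw [he.expand x]
  simp [map_sum]

theorem sum_self (he : IsOrthonormalFrame g e) : ∑ i, g (e i) (e i) = n := by
  simp [he.orth]

/-- Cyclicity of the trace, by expanding in the frame. -/
theorem sum_comp_comm (he : IsOrthonormalFrame g e) (P Q : W →ₗ[ℝ] W) :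
    ∑ i, g (P (Q (e i))) (e i) = ∑ i, g (Q (P (e i))) (e i) := by
  have h1 (i) : g (P (Q (e i))) (e i) = ∑ j, g (Q (e i)) (e j) * g (P (e j)) (e i) :=
    (he.sum_mul_apply (Q (e i)) ((g.flip (e i)).comp P)).symm
  have h2 (i) : g (Q (P (e i))) (e i) = ∑ j, g (P (e i)) (e j) * g (Q (e j)) (e i) :=
    (he.sum_mul_apply (P (e i)) ((g.flip (e i)).comp Q)).symm
  simp only [h1, h2]
  rw [Finset.sum_comm]
  exact Finset.sum_congr rfl fun i _ ↦ Finset.sum_congr rfl fun j _ ↦ mul_comm _ _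

end IsOrthonormalFrame

namespace IsWebsterCurvature

variable {W : Type*} [AddCommGroup W] [Module ℝ W]
    {g : W →ₗ[ℝ] W →ₗ[ℝ] ℝ} {J τ ν : W →ₗ[ℝ] W} {r : W → W → W → W → ℝ}

theorem eq_of_forall (h : IsWebsterCurvature g J τ ν r) {x y : W} (hxy : ∀ z, g x z = g y z) :
    x = y := by
  by_contra hne
  have h1 := h.g_pos (x - y) (sub_ne_zero.2 hne)
  have h2 := hxy (x - y)
  rw [map_sub g, LinearMap.sub_apply, h2] at h1
  simp at h1

/-- The square of the torsion is a multiple of the identity. -/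
theorem τ_τ (h : IsWebsterCurvature g J τ ν r) {d : ℕ} (hd : d ≠ 0) {e : Fin (2 * d) → W}
    (he : IsOrthonormalFrame g e) (x : W) :
    τ (τ x) = ((∑ i, g (τ (e i)) (τ (e i))) / (2 * d)) • x := by
  have hJ (X Z : W) : g X (J Z) = -g (J X) Z := by rw [h.g_J]; ring
  -- The vanishing commutator of `torsionPart` with `τ`, written in terms of `τ²` only.
  have key (X Y Z V : W) : g (J Y) V * g (τ (τ X)) Z - g (J X) V * g (τ (τ Y)) Z
      + g Y V * g (J (τ (τ X))) Z - g X V * g (J (τ (τ Y))) Z + g (J Y) Z * g (τ (τ X)) V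
      - g (J X) Z * g (τ (τ Y)) V + g Y Z * g (J (τ (τ X))) V - g X Z * g (J (τ (τ Y))) V = 0 := by
    have h1 := (h.comm_both X Y Z V).1
    simp only [torsionPart, kulkarni, symProd] at h1
    have h2 (X Z) : g X (τ Z) = g (τ X) Z := (h.τ_symm _ _).symm
    simp only [h2, h.τ_J, map_neg, LinearMap.neg_apply] at h1
    linarith
  have hS (X : W) : J (τ (τ X)) = τ (τ (J X)) := by rw [h.τ_J, map_neg, h.τ_J, neg_neg]
  have hSs (X Y : W) : g (τ (τ X)) Y = g X (τ (τ Y)) := by rw [h.τ_symm, h.τ_symm]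
  -- Contraction of `key` in `Y` and `V`. The terms in which the frame meets itself give `2d` and
  -- `|τ|²`; the four others equal to `g(Jτ²X, Z)` cancel in pairs.
  have key2 (X Z : W) :
      2 * d * g (J (τ (τ X))) Z = (∑ i, g (τ (e i)) (τ (e i))) * g (J X) Z := by
    have h1 : ∑ i, (g (J (e i)) (e i) * g (τ (τ X)) Z - g (J X) (e i) * g (τ (τ (e i))) Z
      + g (e i) (e i) * g (J (τ (τ X))) Z - g X (e i) * g (J (τ (τ (e i)))) Z
      + g (J (e i)) Z * g (τ (τ X)) (e i)
      - g (J X) Z * g (τ (τ (e i))) (e i) + g (e i) Z * g (J (τ (τ X))) (e i)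
      - g X Z * g (J (τ (τ (e i)))) (e i)) = 0 := Finset.sum_eq_zero fun i _ ↦ key X (e i) Z (e i)
    have e1 (x : W) : g (J x) x = 0 := by have := h.omega_skew x x; linarith
    have e2 (x : W) : g (J (τ (τ x))) x = 0 := by
      have := h.omega_skew (τ (τ x)) x
      have h3 := hSs (J x) x
      rw [← hS] at h3
      linarith
    have s1 : ∑ i, g (J X) (e i) * g (τ (τ (e i))) Z = g (J (τ (τ X))) Z := by
      rw [hS]; exact he.sum_mul_apply (J X) ((g.flip Z).comp (τ.comp τ))
    have s2 : ∑ i, g X (e i) * g (J (τ (τ (e i)))) Z = g (J (τ (τ X))) Z :=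
      he.sum_mul_apply X ((g.flip Z).comp (J.comp (τ.comp τ)))
    have s3 : ∑ i, g (J (e i)) Z * g (τ (τ X)) (e i) = g (J (τ (τ X))) Z := by
      refine Eq.trans ?_ (he.sum_mul_apply (τ (τ X)) ((g.flip Z).comp J))
      exact Finset.sum_congr rfl fun i _ ↦ mul_comm _ _
    have s4 : ∑ i, g (e i) Z * g (J (τ (τ X))) (e i) = g (J (τ (τ X))) Z := by
      refine Eq.trans ?_ (he.sum_mul_apply (J (τ (τ X))) (g.flip Z))
      exact Finset.sum_congr rfl fun i _ ↦ mul_comm _ _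
    have s5 : ∑ i, g (τ (τ (e i))) (e i) = ∑ i, g (τ (e i)) (τ (e i)) :=
      Finset.sum_congr rfl fun i _ ↦ h.τ_symm _ _
    simp only [Finset.sum_add_distrib, Finset.sum_sub_distrib, e1, e2, s1, s2, s3, s4,
      ← Finset.sum_mul, ← Finset.mul_sum, he.sum_self, s5, mul_zero, zero_mul,
      Finset.sum_const_zero] at h1
    push_cast at h1
    linarith
  have hd' : (d : ℝ) ≠ 0 := Nat.cast_ne_zero.2 hd
  refine h.eq_of_forall fun z ↦ ?_
  have h1 := key2 x (J z)
  rw [h.g_J_J, h.g_J_J] at h1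
  simp only [map_smul, LinearMap.smul_apply, smul_eq_mul]
  field_simp
  linarith

/-- The pseudo-Hermitian curvature is determined by the torsion up to a scalar. -/
theorem exists_curvature_eq (h : IsWebsterCurvature g J τ ν r) {l : ℝ} (hl : 0 < l)
    (hτ : ∀ x, τ (τ x) = l ^ 2 • x) : ∃ c : ℝ, (∀ x, ν x = (-2 * c) • J (τ x)) ∧
      ∀ X Y Z V, r X Y Z V - torsionPart g J τ X Y Z V =
        2 * c * (holoCurv (fun x y ↦ g x y) (fun x y ↦ g (J x) y) X Y Z V
          + 1 / l ^ 2 * (1 / 8 * (kulkarni (fun x y ↦ g (τ x) y) (fun x y ↦ g (τ x) y) X Y Z V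
            + kulkarni (fun x y ↦ g (J (τ x)) y) (fun x y ↦ g (J (τ x)) y) X Y Z V))) := by
  obtain ⟨K, hK⟩ : ∃ K : W → W → W → W → ℝ, K = fun a b c d ↦ r a b c d - torsionPart g J τ a b c d :=
    ⟨_, rfl⟩
  have hKK : IsKaehlerTensor J K := hK ▸ h.isKaehlerTensor
  have hKr (a b c d) : r a b c d - torsionPart g J τ a b c d = K a b c d := by rw [hK]
  have hcomm (a b c d) : K a b (τ c) d - K a b c (τ d) = -(g (J a) b * g (ν c) d) := by
    rw [hK]; exact (h.comm_both a b c d).2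
  -- The projections `½ (1 ± τ / l)` onto the eigenspaces. Since `J` exchanges the eigenvalues `l`
  -- and `-l`, the second eigenspace is written as `J` of the first.
  have hsplit (x : W) : ∃ p q, τ p = l • p ∧ τ q = l • q ∧ x = p + J q := by
    refine ⟨(1 / 2 : ℝ) • (x + l⁻¹ • τ x), (-(1 / 2) : ℝ) • J (x - l⁻¹ • τ x), ?_, ?_, ?_⟩
    · simp only [map_smul, map_add, hτ, smul_smul, smul_add]
      match_scalars <;> field_simp
    · simp only [map_smul, map_sub, hτ, smul_smul, smul_sub, h.τ_J]
      match_scalars <;> field_simp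
    · simp only [map_smul, map_sub, h.J_J, smul_smul, smul_sub, smul_add]
      match_scalars <;> field_simp <;> norm_num
  have hτJ {q : W} (hq : τ q = l • q) : τ (J q) = (-l) • J q := by
    rw [h.τ_J, hq, map_smul, neg_smul]
  -- Eigenvectors of the symmetric map `τ` with eigenvalues `l` and `-l` are orthogonal: the
  -- `l`-eigenspace is Lagrangian.
  have horth {x y : W} (hx : τ x = l • x) (hy : τ y = l • y) : g (J x) y = 0 := by
    have h1 := h.τ_symm (J x) y
    rw [hτJ hx, hy] at h1
    simp only [map_smul, LinearMap.smul_apply, smul_eq_mul] at h1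
    have : l * g (J x) y = 0 := by linarith
    exact (mul_eq_zero.1 this).resolve_left hl.ne'
  have hgJ (x y : W) : g x (J y) = -g (J x) y := by rw [h.g_J]; ring
  -- On `z` and `Jw` the eigenvalues of `τ` differ by `2l`, so the commutator identity gives `K`
  -- itself in terms of `ω` and `ν`. On eigenvectors of equal eigenvalue, below, the left side
  -- cancels and only a condition on `ν` remains.
  have hk1 {x y z w : W} (hz : τ z = l • z) (hw : τ w = l • w) :
      2 * l * K x y z (J w) = -(g (J x) y * g (ν z) (J w)) := by
    have h1 := hcomm x y z (J w)
    rw [hz, hτJ hw, hKK.smul₃, hKK.smul₄] at h1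
    linarith
  have hk2 {x y z w : W} (hz : τ z = l • z) (hw : τ w = l • w) :
      g (J x) y * g (ν z) w = 0 := by
    have h1 := hcomm x y z w
    rw [hz, hw, hKK.smul₃, hKK.smul₄] at h1
    linarith
  have hk3 {x y z w : W} (hz : τ z = l • z) (hw : τ w = l • w) :
      g (J x) y * g (ν (J z)) (J w) = 0 := by
    have h1 := hcomm x y (J z) (J w)
    rw [hτJ hz, hτJ hw, hKK.smul₃, hKK.smul₄] at h1
    linarith
  have hk4 {x y z w : W} (hz : τ z = l • z) (hw : τ w = l • w) :
      g (J x) y * g (ν (J z)) w = g (J x) y * g (ν z) (J w) := by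
    have h1 := hcomm x y (J z) w
    rw [hτJ hz, hw, hKK.smul₃, hKK.smul₄, hKK.J_right h.J_J] at h1
    linarith [hk1 (x := x) (y := y) hz hw]
  have hne {x : W} (hx : x ≠ 0) : g (J x) (J x) ≠ 0 := by
    rw [h.g_J_J]; exact (h.g_pos x hx).ne'
  have hn0 {z w : W} (hz : τ z = l • z) (hw : τ w = l • w) :
      g (ν z) w = 0 ∧ g (ν (J z)) (J w) = 0 ∧ g (ν (J z)) w = g (ν z) (J w) := by
    by_cases hz0 : z = 0
    · simp [hz0]
    · exact ⟨(mul_eq_zero.1 (hk2 (y := J z) hz hw)).resolve_left (hne hz0),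
        (mul_eq_zero.1 (hk3 (y := J z) hz hw)).resolve_left (hne hz0),
        mul_left_cancel₀ (hne hz0) (hk4 hz hw)⟩
  -- Pair symmetry applied to `hk1` in both orders makes `g` and `g(ν ·, J ·)` proportional on the
  -- eigenspace.
  have hpair {x y z w : W} (hx : τ x = l • x) (hy : τ y = l • y) (hz : τ z = l • z)
      (hw : τ w = l • w) : g x y * g (ν z) (J w) = g z w * g (ν x) (J y) := by
    have h1 := hk1 (x := x) (y := J y) hz hw
    have h2 := hk1 (x := z) (y := J w) hx hy
    rw [h.g_J_J] at h1 h2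
    rw [hKK.pair] at h2
    linarith
  -- The factor `-2l` is chosen so that `K(x, Jy, z, Jw) = c g(x, y) g(z, w)` in `k4`.
  obtain ⟨c, hc⟩ : ∃ c : ℝ, ∀ z w : W, τ z = l • z → τ w = l • w →
      g (ν z) (J w) = -2 * l * c * g z w := by
    by_cases hx : ∃ x, τ x = l • x ∧ x ≠ 0
    · obtain ⟨x, hx, hx0⟩ := hx
      have hgx := (h.g_pos x hx0).ne'
      refine ⟨-(g (ν x) (J x)) / (2 * l * g x x), fun z w hz hw ↦ ?_⟩
      have := hpair hx hx hz hw
      field_simp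
      linarith
    · refine ⟨0, fun z w hz hw ↦ ?_⟩
      have : z = 0 := by
        by_contra h0
        exact hx ⟨z, hz, h0⟩
      simp [this]
  have k2 {x y z w : W} (hx : τ x = l • x) (hy : τ y = l • y) (hz : τ z = l • z)
      (hw : τ w = l • w) : K x y z (J w) = 0 := by
    have h1 := hk1 (x := x) (y := y) hz hw
    rw [horth hx hy] at h1
    have : 2 * l * K x y z (J w) = 0 := by linarith
    exact (mul_eq_zero.1 this).resolve_left (by positivity)
  have k3 {x y z w : W} (hx : τ x = l • x) (hy : τ y = l • y) (hz : τ z = l • z)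
      (hw : τ w = l • w) : K x (J y) z w = 0 := by
    rw [hKK.pair, k2 hz hw hx hy]
  have k4 {x y z w : W} (hz : τ z = l • z)
      (hw : τ w = l • w) : K x (J y) z (J w) = c * (g x y * g z w) := by
    have h1 := hk1 (x := x) (y := J y) hz hw
    rw [h.g_J_J, hc z w hz hw] at h1
    have : 2 * l * (K x (J y) z (J w) - c * (g x y * g z w)) = 0 := by linarith
    linarith [(mul_eq_zero.1 this).resolve_left (by positivity)]
  have k1 {x y z w : W} (hx : τ x = l • x) (hy : τ y = l • y)
      (hw : τ w = l • w) : K x y z w = c * (g x z * g y w - g y z * g x w) := by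
    -- Invariance under `J` turns `K(x, y, Jz, Jw)` into `K(x, y, z, w)`, and the two other terms of
    -- the Bianchi identity are mixed components known from `k4`.
    have h1 := hKK.bianchi x y (J z) (J w)
    rw [hKK.inv, k4 hx hw, hKK.skew (J z), k4 hy hw] at h1
    linarith
  refine ⟨c, fun x ↦ h.eq_of_forall fun y ↦ ?_, fun X Y Z V ↦ ?_⟩
  · obtain ⟨p, q, hp, hq, rfl⟩ := hsplit x
    obtain ⟨p', q', hp', hq', rfl⟩ := hsplit y
    obtain ⟨h1, -, h3⟩ := hn0 hp hp'
    obtain ⟨-, h2, -⟩ := hn0 hq hq'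
    obtain ⟨-, -, h4⟩ := hn0 hq hp'
    simp only [map_add, LinearMap.add_apply, h1, h2, h4, hc p q' hp hq', hc q p' hq hp', hp,
      hτJ hq, map_smul, h.J_J, LinearMap.smul_apply, h.g_J_J, horth hp hp', hgJ, horth hq hq',
      map_neg, LinearMap.neg_apply, smul_eq_mul]
    ring
  · rw [hKr]
    obtain ⟨p1, q1, hp1, hq1, rfl⟩ := hsplit X
    obtain ⟨p2, q2, hp2, hq2, rfl⟩ := hsplit Y
    obtain ⟨p3, q3, hp3, hq3, rfl⟩ := hsplit Z
    obtain ⟨p4, q4, hp4, hq4, rfl⟩ := hsplit V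
    have hgg {p q p' q' : W} (hp : τ p = l • p) (hq : τ q = l • q) (hp' : τ p' = l • p')
        (hq' : τ q' = l • q') : g (p + J q) (p' + J q') = g p p' + g q q' := by
      simp only [map_add, LinearMap.add_apply, h.g_J_J, hgJ, horth hp hq', horth hq hp']
      ring
    have hgw {p q p' q' : W} (hp : τ p = l • p) (hq : τ q = l • q) (hp' : τ p' = l • p')
        (hq' : τ q' = l • q') : g (J (p + J q)) (p' + J q') = g p q' - g q p' := by
      simp only [map_add, LinearMap.add_apply, h.g_J_J, hgJ, horth hp hp', h.J_J, map_neg,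
        LinearMap.neg_apply, horth hq hq']
      ring
    have hgA {p q p' q' : W} (hp : τ p = l • p) (hq : τ q = l • q) (hp' : τ p' = l • p')
        (hq' : τ q' = l • q') : g (τ (p + J q)) (p' + J q') = l * (g p p' - g q q') := by
      simp only [map_add, LinearMap.add_apply, h.g_J_J, hgJ, horth hp hq', horth hq hp', hp, hτJ hq,
        map_smul, LinearMap.smul_apply, smul_eq_mul]
      ring
    have hgB {p q p' q' : W} (hp : τ p = l • p) (hq : τ q = l • q) (hp' : τ p' = l • p')
        (hq' : τ q' = l • q') : g (J (τ (p + J q))) (p' + J q') = l * (g p q' + g q p') := by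
      simp only [map_add, LinearMap.add_apply, h.g_J_J, hgJ, horth hp hp', h.J_J, map_neg,
        LinearMap.neg_apply, horth hq hq', hp, hτJ hq, map_smul, LinearMap.smul_apply, smul_eq_mul]
      ring
    -- Invariance under `J` in each pair reduces all sixteen components of `K` to the types `k1`,
    -- `k2`, `k3`, `k4`.
    have hR {a b : W} : K a b (p3 + J q3) (p4 + J q4) =
        K a b p3 p4 + K a b q3 q4 + K a b p3 (J q4) - K a b q3 (J p4) := by
      rw [hKK.add₃, hKK.add₄, hKK.add₄, hKK.inv, hKK.J_right h.J_J]; ring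
    have hL {z w : W} : K (p1 + J q1) (p2 + J q2) z w =
        K p1 p2 z w + K q1 q2 z w + K p1 (J q2) z w - K q1 (J p2) z w := by
      rw [hKK.add, hKK.add₂, hKK.add₂, hKK.inv_left, hKK.J_left h.J_J]; ring
    rw [hR, hL, hL, hL, hL]
    simp only [k1 hp1 hp2 hp4, k1 hp1 hp2 hq4, k1 hq1 hq2 hp4, k1 hq1 hq2 hq4,
      k2 hp1 hp2 hp3 hq4, k2 hp1 hp2 hq3 hp4, k2 hq1 hq2 hp3 hq4, k2 hq1 hq2 hq3 hp4,
      k3 hp1 hq2 hp3 hp4, k3 hp1 hq2 hq3 hq4, k3 hq1 hp2 hp3 hp4, k3 hq1 hp2 hq3 hq4,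
      k4 hp3 hq4, k4 hq3 hp4]
    simp only [holoCurv, kulkarni, symProd, hgg hp1 hq1 hp3 hq3, hgg hp1 hq1 hp4 hq4,
      hgg hp2 hq2 hp3 hq3, hgg hp2 hq2 hp4 hq4, hgw hp1 hq1 hp3 hq3, hgw hp1 hq1 hp4 hq4,
      hgw hp2 hq2 hp3 hq3, hgw hp2 hq2 hp4 hq4, hgA hp1 hq1 hp3 hq3, hgA hp1 hq1 hp4 hq4,
      hgA hp2 hq2 hp3 hq3, hgA hp2 hq2 hp4 hq4, hgB hp1 hq1 hp3 hq3, hgB hp1 hq1 hp4 hq4,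
      hgB hp2 hq2 hp3 hq3, hgB hp2 hq2 hp4 hq4, hgw hp1 hq1 hp2 hq2, hgw hp3 hq3 hp4 hq4]
    field_simp
    ring

end IsWebsterCurvature
end

/-! ### Traces of the model curvature and the Chern-Moser tensor -/

noncomputable section

set_option synthInstance.maxHeartbeats 200000

open TensorAlg

namespace IsWebsterCurvature

variable {W : Type*} [AddCommGroup W] [Module ℝ W]
    {g : W →ₗ[ℝ] W →ₗ[ℝ] ℝ} {J τ ν : W →ₗ[ℝ] W} {r : W → W → W → W → ℝ}

section Traces

variable {n : ℕ} {e : Fin n → W}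

theorem sum_right (h : IsWebsterCurvature g J τ ν r) (he : IsOrthonormalFrame g e) (x y : W) :
    ∑ i, g x (e i) * g y (e i) = g x y := by
  simp only [h.g_symm y, he.sum_mul]

/-- The action of a Kulkarni square on the fundamental form. -/
theorem hatAction_kulkarni (h : IsWebsterCurvature g J τ ν r) (he : IsOrthonormalFrame g e)
    (k : W → W → ℝ) (P : W →ₗ[ℝ] W) (hk : ∀ x y, k x y = g x (P y)) (X Y : W) :
    hatAction e (kulkarni k k) (fun x y ↦ g (J x) y) X Y = 2 * g (J (P X)) (P Y) := by
  have h1 (x y : W) : ∑ i, ∑ j, g (e i) x * g (e j) y * g (J (e i)) (e j) = g (J x) y := by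
    have h2 (i) : ∑ j, g (e i) x * g (e j) y * g (J (e i)) (e j) = g x (e i) * g (J (e i)) y := by
      rw [← he.sum_mul (J (e i)) y, Finset.mul_sum]
      exact Finset.sum_congr rfl fun j _ ↦ by rw [h.g_symm x]; ring
    simp only [h2]
    exact he.sum_mul_apply x ((g.flip y).comp J)
  have h3 : ∑ i, ∑ j, kulkarni k k (e i) (e j) X Y * g (J (e i)) (e j) =
      2 * (∑ i, ∑ j, g (e i) (P X) * g (e j) (P Y) * g (J (e i)) (e j)
        - ∑ i, ∑ j, g (e i) (P Y) * g (e j) (P X) * g (J (e i)) (e j)) := by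
    rw [← Finset.sum_sub_distrib, Finset.mul_sum]
    refine Finset.sum_congr rfl fun i _ ↦ ?_
    rw [← Finset.sum_sub_distrib, Finset.mul_sum]
    refine Finset.sum_congr rfl fun j _ ↦ ?_
    simp only [kulkarni, symProd, hk]
    ring
  rw [hatAction, h3, h1, h1, h.omega_skew (P Y)]
  ring

theorem hatAction_symProd (h : IsWebsterCurvature g J τ ν r) (he : IsOrthonormalFrame g e)
    (X Y : W) :
    hatAction e (symProd (fun x y ↦ g (J x) y) (fun x y ↦ g (J x) y)) (fun x y ↦ g (J x) y) X Y =
      n * g (J X) Y := by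
  have h1 : ∑ i, ∑ j, g (J (e i)) (e j) * g (J (e i)) (e j) = n := by
    simp only [h.sum_right he, h.g_J_J, he.sum_self]
  have h2 : ∑ i, ∑ j, symProd (fun x y ↦ g (J x) y) (fun x y ↦ g (J x) y) (e i) (e j) X Y
      * g (J (e i)) (e j) = 2 * g (J X) Y * ∑ i, ∑ j, g (J (e i)) (e j) * g (J (e i)) (e j) := by
    rw [Finset.mul_sum]
    refine Finset.sum_congr rfl fun i _ ↦ ?_
    rw [Finset.mul_sum]
    refine Finset.sum_congr rfl fun j _ ↦ ?_
    simp only [symProd]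
    ring
  rw [hatAction, h2, h1]
  ring

/-- The Ricci contraction of a Kulkarni square. -/
theorem ricciContraction_kulkarni (h : IsWebsterCurvature g J τ ν r)
    (he : IsOrthonormalFrame g e) (k : W → W → ℝ) (P Q : W →ₗ[ℝ] W) (hk : ∀ x y, k x y = g x (P y))
    (hk' : ∀ x y, k x y = g (Q x) y) (X Y : W) :
    ricciContraction e (kulkarni k k) X Y =
      2 * ((∑ i, k (e i) (e i)) * k X Y - g (Q X) (P Y)) := by
  have h1 : ∑ i, k (e i) Y * k X (e i) = g (Q X) (P Y) := by
    rw [← h.sum_right he]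
    exact Finset.sum_congr rfl fun i _ ↦ by rw [hk, hk', h.g_symm (e i)]; ring
  rw [← h1, Finset.sum_mul, ← Finset.sum_sub_distrib, Finset.mul_sum]
  refine Finset.sum_congr rfl fun i _ ↦ ?_
  simp only [kulkarni, symProd]
  ring

theorem ricciContraction_symProd (h : IsWebsterCurvature g J τ ν r)
    (he : IsOrthonormalFrame g e) (X Y : W) :
    ricciContraction e (symProd (fun x y ↦ g (J x) y) (fun x y ↦ g (J x) y)) X Y =
      2 * g X Y := by
  have h1 : ∑ i, g (J X) (e i) * g (J Y) (e i) = g X Y := by rw [h.sum_right he, h.g_J_J]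
  rw [← h1, Finset.mul_sum]
  refine Finset.sum_congr rfl fun i _ ↦ ?_
  simp only [symProd, h.omega_skew (e i)]
  ring

end Traces

variable {d : ℕ} {e : Fin (2 * d) → W}

/-- Conjugation by `J` changes the sign of `τ`, hence of its trace; likewise for `J ∘ τ`. -/
theorem trace_A (h : IsWebsterCurvature g J τ ν r) {n : ℕ} {e : Fin n → W}
    (he : IsOrthonormalFrame g e) : ∑ i, g (τ (e i)) (e i) = 0 := by
  have h1 := he.sum_comp_comm J (τ.comp J)
  simp only [LinearMap.comp_apply, h.τ_J, h.J_J, map_neg, LinearMap.neg_apply,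
    Finset.sum_neg_distrib, neg_neg] at h1
  linarith

theorem trace_B (h : IsWebsterCurvature g J τ ν r) {n : ℕ} {e : Fin n → W}
    (he : IsOrthonormalFrame g e) : ∑ i, g (J (τ (e i))) (e i) = 0 := by
  have h1 := he.sum_comp_comm J τ
  simp only [h.τ_J, map_neg, LinearMap.neg_apply, Finset.sum_neg_distrib] at h1
  linarith

/-- The curvature tensor `a I^ℂ + (b / l²) T`, where `T = (1/8) (A ∧ A + B ∧ B)`. -/
def model (g : W →ₗ[ℝ] W →ₗ[ℝ] ℝ) (J τ : W →ₗ[ℝ] W) (l : ℝ) (a b : ℝ) (X Y Z V : W) : ℝ :=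
  a * holoCurv (fun x y ↦ g x y) (fun x y ↦ g (J x) y) X Y Z V
    + b / l ^ 2 * (1 / 8 * (kulkarni (fun x y ↦ g (τ x) y) (fun x y ↦ g (τ x) y) X Y Z V
      + kulkarni (fun x y ↦ g (J (τ x)) y) (fun x y ↦ g (J (τ x)) y) X Y Z V))

/-- On `ω`, the tensor `I^ℂ` acts by `(d + 1) / 2`: the squares of `g` and `ω` give `2` each inside
the bracket and `2 ω ⊙ ω` gives `4d`. The squares of `A` and `B` give `-2 l²` each, because `τ`
anticommutes with `J`. -/
theorem hatAction_model (h : IsWebsterCurvature g J τ ν r) (he : IsOrthonormalFrame g e) {l : ℝ}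
    (hl : 0 < l) (hτ : ∀ x, τ (τ x) = l ^ 2 • x) (a b : ℝ) (X Y : W) :
    hatAction e (model g J τ l a b) (fun x y ↦ g (J x) y) X Y =
      (a * (d + 1) - b) / 2 * g (J X) Y := by
  have h1 := h.hatAction_kulkarni he (fun x y ↦ g x y) LinearMap.id (fun _ _ ↦ rfl) X Y
  have h2 := h.hatAction_kulkarni he (fun x y ↦ g (J x) y) (-J)
    (fun x y ↦ by simp [h.g_J]) X Y
  have h3 := h.hatAction_symProd he X Y
  have h4 := h.hatAction_kulkarni he (fun x y ↦ g (τ x) y) τ (fun x y ↦ h.τ_symm x y) X Y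
  have h5 := h.hatAction_kulkarni he (fun x y ↦ g (J (τ x)) y) (J.comp τ)
    (fun x y ↦ by rw [h.B_symm, h.g_symm]; rfl) X Y
  have key : hatAction e (model g J τ l a b) (fun x y ↦ g (J x) y) X Y =
      a / 8 * (hatAction e (kulkarni (fun x y ↦ g x y) (fun x y ↦ g x y)) (fun x y ↦ g (J x) y) X Y
        + hatAction e (kulkarni (fun x y ↦ g (J x) y) (fun x y ↦ g (J x) y))
            (fun x y ↦ g (J x) y) X Y
        + 2 * hatAction e (symProd (fun x y ↦ g (J x) y) (fun x y ↦ g (J x) y))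
            (fun x y ↦ g (J x) y) X Y)
      + b / l ^ 2 / 8 * (hatAction e (kulkarni (fun x y ↦ g (τ x) y) (fun x y ↦ g (τ x) y))
            (fun x y ↦ g (J x) y) X Y
        + hatAction e (kulkarni (fun x y ↦ g (J (τ x)) y) (fun x y ↦ g (J (τ x)) y))
            (fun x y ↦ g (J x) y) X Y) := by
    simp only [hatAction, Finset.mul_sum, ← Finset.sum_add_distrib]
    refine Finset.sum_congr rfl fun i _ ↦ Finset.sum_congr rfl fun j _ ↦ ?_
    simp only [model, holoCurv]
    ring
  have hx : g (J (τ X)) (τ Y) = -(l ^ 2 * g (J X) Y) := by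
    rw [← h.τ_symm, h.τ_J, hτ]; simp
  rw [key, h1, h2, h3, h4, h5]
  simp only [LinearMap.id_apply, LinearMap.comp_apply, LinearMap.neg_apply, map_neg, h.J_J,
    h.g_J X, neg_neg, hx]
  have h6 : g (τ X) (J (τ Y)) = l ^ 2 * g (J X) Y := by
    rw [h.g_symm, h.omega_skew, h.g_symm, h.g_symm (τ Y), hx]; ring
  have h7 : g X (J Y) = - g (J X) Y := by rw [h.g_J]; ring
  rw [h6, h7]
  push_cast
  field_simp
  ring

/-- The tensors `A` and `B` are trace free, so that their squares contribute only `-2 g(τX, τY)`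
each. The eigenvalue is the same as for the action on `ω`. -/
theorem ricciContraction_model (h : IsWebsterCurvature g J τ ν r) (he : IsOrthonormalFrame g e)
    {l : ℝ} (hl : 0 < l) (hτ : ∀ x, τ (τ x) = l ^ 2 • x) (a b : ℝ) (X Y : W) :
    ricciContraction e (model g J τ l a b) X Y = (a * (d + 1) - b) / 2 * g X Y := by
  have h1 := h.ricciContraction_kulkarni he (fun x y ↦ g x y) LinearMap.id LinearMap.id
    (fun _ _ ↦ rfl) (fun _ _ ↦ rfl) X Y
  have h2 := h.ricciContraction_kulkarni he (fun x y ↦ g (J x) y) (-J) J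
    (fun x y ↦ by simp [h.g_J]) (fun _ _ ↦ rfl) X Y
  have h3 := h.ricciContraction_symProd he X Y
  have h4 := h.ricciContraction_kulkarni he (fun x y ↦ g (τ x) y) τ τ (fun x y ↦ h.τ_symm x y)
    (fun _ _ ↦ rfl) X Y
  have h5 := h.ricciContraction_kulkarni he (fun x y ↦ g (J (τ x)) y) (J.comp τ) (J.comp τ)
    (fun x y ↦ by rw [h.B_symm, h.g_symm]; rfl) (fun _ _ ↦ rfl) X Y
  have key : ricciContraction e (model g J τ l a b) X Y =
      a / 8 * (ricciContraction e (kulkarni (fun x y ↦ g x y) (fun x y ↦ g x y)) X Y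
        + ricciContraction e (kulkarni (fun x y ↦ g (J x) y) (fun x y ↦ g (J x) y)) X Y
        + 2 * ricciContraction e (symProd (fun x y ↦ g (J x) y) (fun x y ↦ g (J x) y)) X Y)
      + b / l ^ 2 / 8 * (ricciContraction e (kulkarni (fun x y ↦ g (τ x) y) (fun x y ↦ g (τ x) y)) X Y
        + ricciContraction e (kulkarni (fun x y ↦ g (J (τ x)) y) (fun x y ↦ g (J (τ x)) y)) X Y) := by
    simp only [ricciContraction, Finset.mul_sum, ← Finset.sum_add_distrib]
    refine Finset.sum_congr rfl fun i _ ↦ ?_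
    simp only [model, holoCurv]
    ring
  have e1 (x : W) : g (J x) x = 0 := by have := h.omega_skew x x; linarith
  have hx : g (τ X) (τ Y) = l ^ 2 * g X Y := by
    rw [← h.τ_symm, hτ]; simp
  rw [key, h1, h2, h3, h4, h5]
  simp only [LinearMap.id_apply, LinearMap.comp_apply, LinearMap.neg_apply, map_neg, h.g_J_J,
    hx, h.trace_A he, h.trace_B he, he.sum_self, e1, Finset.sum_const_zero]
  push_cast
  field_simp
  ring

theorem lefschetzAdj_omega (h : IsWebsterCurvature g J τ ν r) (he : IsOrthonormalFrame g e)
    (a : ℝ) : lefschetzAdj e J (fun x y ↦ a * g (J x) y) = a * d := by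
  simp only [lefschetzAdj, h.g_J_J, ← Finset.mul_sum, he.sum_self]
  push_cast
  ring

/-- The action on `ω` is a multiple of `ω`, so the two correction terms combine into one multiple of
`ω ⊙ ω`. -/
theorem primitivePart_model (h : IsWebsterCurvature g J τ ν r) (hd : d ≠ 0)
    (he : IsOrthonormalFrame g e) {l : ℝ}
    (hl : 0 < l) (hτ : ∀ x, τ (τ x) = l ^ 2 • x) (a b : ℝ) (X Y Z V : W) :
    primitivePart e J (fun x y ↦ g (J x) y) (model g J τ l a b) X Y Z V =
      model g J τ l a b X Y Z V - (a * (d + 1) - b) / (4 * d) *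
        symProd (fun x y ↦ g (J x) y) (fun x y ↦ g (J x) y) X Y Z V := by
  have hd' : (d : ℝ) ≠ 0 := Nat.cast_ne_zero.2 hd
  have h1 : hatAction e (model g J τ l a b) (fun x y ↦ g (J x) y) =
      fun X Y ↦ (a * (d + 1) - b) / 2 * g (J X) Y := by
    funext X Y; exact h.hatAction_model he hl hτ a b X Y
  rw [primitivePart, h1, h.lefschetzAdj_omega he]
  simp only [symProd]
  field_simp
  ring

/-- The scalar curvature, the curvature and the Chern-Moser tensor of the model. -/
theorem frame_formulas (h : IsWebsterCurvature g J τ ν r) (hd : d ≠ 0)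
    (he : IsOrthonormalFrame g e) {l : ℝ} (hl : 0 < l) (hτ : ∀ x, τ (τ x) = l ^ 2 • x) (c : ℝ)
    {K : W → W → W → W → ℝ} (hK : ∀ X Y Z V, K X Y Z V = model g J τ l (2 * c) (2 * c) X Y Z V)
    {s t : ℝ} (hs : s = frameTrace e (ricciContraction e K))
    (ht : t = ∑ i, g (τ (e i)) (τ (e i)))
    {G Om : W → W → ℝ} (hG : G = fun x y ↦ g x y) (hOm : Om = fun x y ↦ g (J x) y)
    {T : W → W → W → W → ℝ} (hT : T = fun X Y Z V ↦
      1 / 8 * (kulkarni (fun x y ↦ g (τ x) y) (fun x y ↦ g (τ x) y) X Y Z V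
        + kulkarni (fun x y ↦ g (J (τ x)) y) (fun x y ↦ g (J (τ x)) y) X Y Z V)) (X Y Z V : W) :
    K X Y Z V = s / (d : ℝ) ^ 2 * (holoCurv G Om X Y Z V + 2 * d / t * T X Y Z V) ∧
    K X Y Z V - s / (d * (d + 1)) * holoCurv G Om X Y Z V
      - 1 / (d + 2) * (1 / 2 * (kulkarni (tracelessPart e G (ricciContraction e K)) G X Y Z V
          - kulkarni (primitiveForm e J Om (fun u v ↦ -hatAction e K Om u v)) Om X Y Z V)
        - symProd (primitiveForm e J Om (fun u v ↦ -hatAction e K Om u v)) Om X Y Z V) =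
      s / (d : ℝ) ^ 2 * (1 / (d + 1) * primitivePart e J Om (holoCurv G Om) X Y Z V
        + 2 * d / t * primitivePart e J Om T X Y Z V) := by
  have hd' : (d : ℝ) ≠ 0 := Nat.cast_ne_zero.2 hd
  have hK' : K = model g J τ l (2 * c) (2 * c) := by
    funext X Y Z V; exact hK X Y Z V
  have ht' : t = 2 * d * l ^ 2 := by
    simp only [ht, h.τ_symm, hτ, map_smul, smul_eq_mul, ← Finset.mul_sum, he.sum_self]
    push_cast
    ring
  -- With both coefficients equal to `2c`, the Ricci tensor is `c d g` and the Ricci form `-c d ω`.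
  -- Their traceless and primitive parts vanish, and `2c = s / d²`.
  have hric : ricciContraction e K = fun X Y ↦ c * d * g X Y := by
    funext X Y
    rw [hK', h.ricciContraction_model he hl hτ]
    ring
  have hs' : s = 2 * c * d ^ 2 := by
    rw [hs, hric]
    simp only [frameTrace, ← Finset.mul_sum, he.sum_self]
    push_cast
    ring
  have hhat : (fun u v ↦ -hatAction e K Om u v) = fun X Y ↦ (-(c * d)) * g (J X) Y := by
    funext X Y
    rw [hK', hOm, h.hatAction_model he hl hτ]
    ring
  have hrho (X Y) : primitiveForm e J Om (fun u v ↦ -hatAction e K Om u v) X Y = 0 := by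
    rw [hhat, primitiveForm, h.lefschetzAdj_omega he, hOm]
    field_simp
    ring
  have hric0 (X Y) : tracelessPart e G (ricciContraction e K) X Y = 0 := by
    rw [tracelessPart, ← hs, hric, hs', hG]
    field_simp
    ring
  have hI : holoCurv G Om = model g J τ l 1 0 := by
    funext X Y Z V; rw [model, hG, hOm]; ring
  have hTm : T = model g J τ l 0 (l ^ 2) := by
    funext X Y Z V; rw [model, hT]; field_simp; ring
  have hKe : K X Y Z V = 2 * c * model g J τ l 1 0 X Y Z V
      + 2 * c / l ^ 2 * model g J τ l 0 (l ^ 2) X Y Z V := by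
    rw [hK', model, model, model]; field_simp; ring
  simp only [kulkarni, symProd, hrho, hric0]
  rw [hI, hTm, hKe, hOm, h.primitivePart_model hd he hl hτ, h.primitivePart_model hd he hl hτ, hs',
    ht']
  have hd1 : (d : ℝ) + 1 ≠ 0 := by positivity
  constructor
  · field_simp
  -- The coefficient of `I^ℂ` in `C` comes from `1 - d / (d + 1) = 1 / (d + 1)`. The primitive
  -- corrections of `I^ℂ / (d + 1)` and `T / l²` are opposite, so passing to primitive parts changes
  -- nothing in the sum.
  · field_simp
    ring

end IsWebsterCurvature

end

/-! ### Curvature identities on a full tangent space -/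

noncomputable section

set_option synthInstance.maxHeartbeats 200000

open TensorAlg

variable {E : Type*} [NormedAddCommGroup E] [NormedSpace ℝ E]

/-- The torsion of a Tanaka-Webster connection, in terms of the structure tensors and of
`τ = i(ξ)T`. -/
def websterTorsion (g : E →L[ℝ] E →L[ℝ] ℝ) (ξ : E) (J τ : E →L[ℝ] E) (a b : E) : E :=
  g (J a) b • ξ - g ξ a • τ b + g ξ b • τ a

/-- The algebraic properties, on the whole tangent space, of the curvature `R` of a Tanaka-Webster
connection whose torsion `τ` satisfies `∇_a τ = θ(a) ν`, where `θ = g(ξ, ·)`. -/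
structure IsWebsterPoint (g : E →L[ℝ] E →L[ℝ] ℝ) (ξ : E) (J τ ν : E →L[ℝ] E) (Dν : E → E →L[ℝ] E)
    (R : E → E → E →L[ℝ] E) : Prop where
  g_symm : ∀ x y, g x y = g y x
  g_pos : ∀ x, x ≠ 0 → 0 < g x x
  g_ξ_ξ : g ξ ξ = 1
  J_J : ∀ x, J (J x) = -x + g ξ x • ξ
  g_J : ∀ x y, g (J x) y = -g x (J y)
  τ_ξ : τ ξ = 0
  τ_J : ∀ x, τ (J x) = -J (τ x)
  add : ∀ a a' b, R (a + a') b = R a b + R a' b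
  smul : ∀ (t : ℝ) (a b), R (t • a) b = t • R a b
  skew : ∀ a b, R a b = -R b a
  skew' : ∀ a b c d, g (R a b c) d = -g c (R a b d)
  R_J : ∀ a b c, R a b (J c) = J (R a b c)
  R_ξ : ∀ a b, R a b ξ = 0
  bianchi : ∀ a b c, R a b c + R b c a + R c a b =
    websterTorsion g ξ J τ (websterTorsion g ξ J τ a b) c
      + websterTorsion g ξ J τ (websterTorsion g ξ J τ b c) a
      + websterTorsion g ξ J τ (websterTorsion g ξ J τ c a) b
  ricci : ∀ a b c, R a b (τ c) - τ (R a b c) =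
    g (J a) b • ν c + g ξ b • Dν a c - g ξ a • Dν b c

namespace IsWebsterPoint

variable {g : E →L[ℝ] E →L[ℝ] ℝ} {ξ : E} {J τ ν : E →L[ℝ] E} {Dν : E → E →L[ℝ] E}
    {R : E → E → E →L[ℝ] E}

theorem J_ξ (h : IsWebsterPoint g ξ J τ ν Dν R) : J ξ = 0 := by
  by_contra h0
  have h1 := h.g_pos _ h0
  rw [h.g_J, h.J_J, h.g_ξ_ξ] at h1
  simp at h1

theorem θ_J (h : IsWebsterPoint g ξ J τ ν Dν R) (x : E) : g ξ (J x) = 0 := by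
  have := h.g_J ξ x
  rw [h.J_ξ] at this
  simpa using this.symm

theorem θ_τ (h : IsWebsterPoint g ξ J τ ν Dν R) (x : E) : g ξ (τ x) = 0 := by
  have h1 : x = -J (J x) + g ξ x • ξ := by rw [h.J_J]; simp
  rw [h1, map_add, map_neg, h.τ_J, map_smul, h.τ_ξ]
  simp [h.θ_J]

theorem eq_of_forall (h : IsWebsterPoint g ξ J τ ν Dν R) {x y : E} (hxy : ∀ z, g x z = g y z) :
    x = y := by
  by_contra hne
  have h1 := h.g_pos (x - y) (sub_ne_zero.2 hne)
  rw [map_sub g, sub_apply, hxy] at h1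
  simp at h1

theorem ω_ξ (h : IsWebsterPoint g ξ J τ ν Dν R) (x : E) : g (J x) ξ = 0 := by
  rw [h.g_symm, h.θ_J]

theorem θ_R (h : IsWebsterPoint g ξ J τ ν Dν R) (a b c : E) : g ξ (R a b c) = 0 := by
  rw [h.g_symm, h.skew', h.R_ξ]; simp

theorem torsion_ξ (h : IsWebsterPoint g ξ J τ ν Dν R) {b : E} (hb : g ξ b = 0) :
    websterTorsion g ξ J τ ξ b = -τ b := by
  simp [websterTorsion, h.J_ξ, h.g_ξ_ξ, hb]

theorem torsion_ξ' (h : IsWebsterPoint g ξ J τ ν Dν R) {b : E} (hb : g ξ b = 0) :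
    websterTorsion g ξ J τ b ξ = τ b := by
  simp [websterTorsion, h.ω_ξ, h.g_ξ_ξ, hb]

theorem torsion_H {a b : E} (ha : g ξ a = 0) (hb : g ξ b = 0) :
    websterTorsion g ξ J τ a b = g (J a) b • ξ := by
  simp [websterTorsion, ha, hb]

/-- The left side is horizontal and the right side vertical, so both vanish. The right side gives
the symmetry of `τ`, the left side the vanishing of `R(ξ, ·)`. -/
theorem bianchi_ξ (h : IsWebsterPoint g ξ J τ ν Dν R) {b c : E} (hb : g ξ b = 0)
    (hc : g ξ c = 0) : R ξ b c - R ξ c b = (g (J (τ c)) b - g (J (τ b)) c) • ξ := by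
  have h1 := h.bianchi ξ b c
  have h2 : g ξ (τ b) = 0 := h.θ_τ b
  have h3 : websterTorsion g ξ J τ (-τ b) c = -(g (J (τ b)) c • ξ) := by
    rw [torsion_H (by simp [h2]) hc]; simp
  have h4 : websterTorsion g ξ J τ (g (J b) c • ξ) ξ = 0 := by
    simp [websterTorsion, h.J_ξ, h.τ_ξ]
  rw [h.torsion_ξ hb, h.torsion_ξ' hc, torsion_H hb hc, h3, h4, torsion_H (h.θ_τ c) hb, h.R_ξ,
    h.skew c ξ] at h1
  rw [sub_smul]
  simp only [neg_apply] at h1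
  calc R ξ b c - R ξ c b = R ξ b c + 0 + -R ξ c b := by abel
    _ = _ := h1
    _ = _ := by abel

/-- The vertical part of `bianchi_ξ` is the symmetry of `B` on `H`. Since `τ` anticommutes with `J`,
replacing an argument by its image under `J` turns it into the symmetry of `A`; the direction `ξ` is
trivial because `τ ξ = 0` and `θ ∘ τ = 0`. -/
theorem τ_symm (h : IsWebsterPoint g ξ J τ ν Dν R) (x y : E) : g (τ x) y = g x (τ y) := by
  have key {b c : E} (hb : g ξ b = 0) (hc : g ξ c = 0) : g (J (τ c)) b = g (J (τ b)) c := by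
    have h1 := congrArg (g ξ) (h.bianchi_ξ hb hc)
    simp only [map_sub, h.θ_R, map_smul, h.g_ξ_ξ, smul_eq_mul] at h1
    linarith
  have key2 {b : E} (c : E) (hb : g ξ b = 0) : g (τ (J c)) b = g (J c) (τ b) := by
    have h1 := key hb (h.θ_J c)
    have h2 : g (J (τ (J c))) b = - g (τ (J c)) (J b) := h.g_J _ _
    have h3 := key (h.θ_J b) (h.θ_J c)
    have h4 : J (J b) = -b := by rw [h.J_J, hb]; simp
    have h5 := h.g_J (τ (J c)) (J b)
    rw [h4] at h5
    have h6 : J (τ (J b)) = τ b := by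
      have h7 := h.τ_J (J b)
      rw [h4] at h7
      simpa using h7.symm
    rw [h6] at h3
    rw [h.g_symm (J c)]
    simp only [map_neg] at h5
    linarith
  have hd (x : E) : x = J (-J x) + g ξ x • ξ := by rw [map_neg, h.J_J]; simp
  have hy : g x (τ y) = g (J (-J x)) (τ y) := by
    conv_lhs => rw [hd x]
    simp only [map_add, map_smul, add_apply, smul_apply, h.θ_τ, smul_zero, add_zero]
  have hx : τ x = τ (J (-J x)) := by
    conv_lhs => rw [hd x]
    simp only [map_add, map_smul, h.τ_ξ, smul_zero, add_zero]
  have hθτ (z : E) : g (τ z) ξ = 0 := by rw [h.g_symm, h.θ_τ]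
  rw [hy, hx, hd y]
  have h1 := key2 (-J x) (h.θ_J (-J y))
  simp only [map_add, map_smul, h.τ_ξ, smul_zero, add_zero, hθτ]
  exact h1

/-- On `H`, the form `g(R(ξ, b)c, d)` is symmetric in `b, c` by the Bianchi identity and skew in `c,
d` by metricity; a trilinear form with both properties is zero. -/
theorem R_ξ_left (h : IsWebsterPoint g ξ J τ ν Dν R) (b : E) : R ξ b = 0 := by
  have hs {b c : E} (hb : g ξ b = 0) (hc : g ξ c = 0) : R ξ b c = R ξ c b := by
    have h1 := h.bianchi_ξ hb hc
    have h2 := congrArg (g ξ) h1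
    simp only [map_sub, h.θ_R, map_smul, h.g_ξ_ξ, smul_eq_mul] at h2
    have h3 : g (J (τ c)) b - g (J (τ b)) c = 0 := by linarith
    rw [h3, zero_smul] at h1
    exact sub_eq_zero.1 h1
  have hp (x : E) : g ξ (x - g ξ x • ξ) = 0 := by simp [h.g_ξ_ξ]
  have hξ : R ξ ξ = 0 := by
    have := h.skew ξ ξ
    have h2 : (2 : ℝ) • R ξ ξ = 0 := by rw [two_smul]; nth_rewrite 1 [this]; simp
    exact (smul_eq_zero.1 h2).resolve_left two_ne_zero
  have hH {b c d : E} (hb : g ξ b = 0) (hc : g ξ c = 0) (hd : g ξ d = 0) :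
      g (R ξ b c) d = 0 := by
    have e1 := h.skew' ξ b c d
    have e2 := h.skew' ξ c d b
    have e3 := h.skew' ξ d b c
    rw [hs hb hc] at e1 ⊢
    rw [hs hc hd] at e2
    rw [hs hd hb] at e3
    have e4 := h.g_symm c (R ξ b d)
    have e5 := h.g_symm d (R ξ c b)
    have e6 := h.g_symm b (R ξ d c)
    linarith
  have hR (b : E) : R ξ b = R ξ (b - g ξ b • ξ) := by
    have h1 := h.add (b - g ξ b • ξ) (g ξ b • ξ) ξ
    rw [h.smul, hξ, smul_zero, add_zero, sub_add_cancel] at h1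
    rw [h.skew, h1, ← h.skew]
  ext c
  refine h.eq_of_forall fun d ↦ ?_
  have hc : R ξ b c = R ξ b (c - g ξ c • ξ) := by simp [h.R_ξ]
  rw [hc, hR]
  have hd : g (R ξ (b - g ξ b • ξ) (c - g ξ c • ξ)) d =
      g (R ξ (b - g ξ b • ξ) (c - g ξ c • ξ)) (d - g ξ d • ξ) := by
    rw [map_sub (g _), map_smul (g _), h.g_symm _ ξ, h.θ_R]; simp
  rw [hd, hH (hp b) (hp c) (hp d)]
  simp

theorem ricci_H (h : IsWebsterPoint g ξ J τ ν Dν R) {a b : E} (ha : g ξ a = 0) (hb : g ξ b = 0)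
    (c : E) : R a b (τ c) - τ (R a b c) = g (J a) b • ν c := by
  rw [h.ricci, ha, hb]; simp

theorem bianchi_H (h : IsWebsterPoint g ξ J τ ν Dν R) {a b c : E} (ha : g ξ a = 0)
    (hb : g ξ b = 0) (hc : g ξ c = 0) : R a b c + R b c a + R c a b =
      -(g (J a) b • τ c) - g (J b) c • τ a - g (J c) a • τ b := by
  rw [h.bianchi, torsion_H ha hb, torsion_H hb hc, torsion_H hc ha]
  simp only [websterTorsion, map_smul, smul_apply, h.J_ξ, h.τ_ξ, h.g_ξ_ξ, ha, hb, hc]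
  simp
  module

/-- The contact hyperplane. -/
def hplane (g : E →L[ℝ] E →L[ℝ] ℝ) (ξ : E) : Submodule ℝ E := LinearMap.ker (g ξ).toLinearMap

/-- The metric of the contact hyperplane. -/
def gH (g : E →L[ℝ] E →L[ℝ] ℝ) (ξ : E) : hplane g ξ →ₗ[ℝ] hplane g ξ →ₗ[ℝ] ℝ :=
  LinearMap.mk₂ ℝ (fun a b ↦ g a b) (fun a b c ↦ by simp) (fun a b c ↦ by simp)
    (fun a b c ↦ by simp) (fun a b c ↦ by simp)

/-- The horizontal part of an endomorphism. -/
def restrH (g : E →L[ℝ] E →L[ℝ] ℝ) {ξ : E} (hξ : g ξ ξ = 1) (P : E →L[ℝ] E) :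
    hplane g ξ →ₗ[ℝ] hplane g ξ where
  toFun x := ⟨P x - g ξ (P x) • ξ, by simp [hplane, hξ]⟩
  map_add' x y := by ext; simp only [Submodule.coe_add, map_add]; module
  map_smul' t x := by
    ext; simp only [Submodule.coe_smul, map_smul, smul_eq_mul, RingHom.id_apply]; module

theorem coe_restrH (hξ : g ξ ξ = 1) {P : E →L[ℝ] E} (hP : ∀ x, g ξ (P x) = 0) (x : hplane g ξ) :
    (restrH g hξ P x : E) = P x := by
  simp [restrH, hP]

/-- The minus sign passes from the convention `[∇_a, ∇_b] - ∇_[a,b]` used in charts to the opposite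
convention of the curvature tensor `r`. -/
theorem isWebsterCurvature (h : IsWebsterPoint g ξ J τ ν Dν R) :
    IsWebsterCurvature (gH g ξ) (restrH g h.g_ξ_ξ J) (restrH g h.g_ξ_ξ τ) (restrH g h.g_ξ_ξ ν)
      (fun a b c d ↦ -g (R a b c) d) := by
  have hJ (x) := coe_restrH (g := g) h.g_ξ_ξ h.θ_J x
  have hτ (x) := coe_restrH (g := g) h.g_ξ_ξ h.θ_τ x
  have hg (x y : hplane g ξ) : gH g ξ x y = g x y := rfl
  have hθ (x : hplane g ξ) : g ξ x = 0 := x.2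
  have hθ' (x : hplane g ξ) : g x ξ = 0 := by rw [h.g_symm, hθ]
  refine ⟨fun x y ↦ ?_, fun x hx ↦ ?_, fun x ↦ ?_, fun x y ↦ ?_, fun x y ↦ ?_, fun x ↦ ?_,
    fun a a' b c d ↦ ?_, fun t a b c d ↦ ?_, fun a b c d ↦ ?_, fun a b c d ↦ ?_, fun a b c d ↦ ?_,
    fun a b c d ↦ ?_, fun a b c d ↦ ?_⟩
  · exact h.g_symm x y
  · exact h.g_pos x fun h0 ↦ hx (Subtype.ext h0)
  · ext; rw [hJ, hJ, h.J_J, hθ]; simp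
  · rw [hg, hg, hJ, hJ, h.g_J]
  · rw [hg, hg, hτ, hτ, h.τ_symm]
  · ext; rw [hτ, hJ, h.τ_J, Submodule.coe_neg, hJ, hτ]
  · simp only [Submodule.coe_add, h.add, add_apply, map_add]; ring
  · simp only [Submodule.coe_smul, h.smul, smul_apply, map_smul, smul_eq_mul]; ring
  · rw [h.skew]; simp
  · rw [h.skew', h.g_symm]
  · rw [hJ, hJ, h.R_J, h.g_J, h.J_J, hθ]; simp
  · have h1 := congrArg (fun v ↦ g v d) (h.bianchi_H (hθ a) (hθ b) (hθ c))
    simp only [map_add, map_sub, map_neg, map_smul, add_apply, sub_apply, neg_apply, smul_apply,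
      smul_eq_mul] at h1
    simp only [hg, hJ, hτ]
    linarith
  · have h1 := congrArg (fun v ↦ g v d) (h.ricci_H (hθ a) (hθ b) c)
    simp only [map_sub, map_smul, sub_apply, smul_apply, smul_eq_mul, h.τ_symm] at h1
    have h2 : (restrH g h.g_ξ_ξ ν c : E) = ν c - g ξ (ν c) • ξ := rfl
    simp only [hg, hJ, hτ, h2, map_sub, map_smul, sub_apply, smul_apply, hθ, smul_zero, sub_zero]
    linarith

theorem isOrthonormalFrame (h : IsWebsterPoint g ξ J τ ν Dν R) {d : ℕ}
    (hfin : Module.finrank ℝ E = 2 * d + 1) {e : Fin (2 * d) → hplane g ξ}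
    (he : ∀ i j, g (e i) (e j) = if i = j then 1 else 0) : IsOrthonormalFrame (gH g ξ) e := by
  have : FiniteDimensional ℝ E := Module.finite_of_finrank_pos (by omega)
  have hg (x y : hplane g ξ) : gH g ξ x y = g x y := rfl
  have hsurj : Function.Surjective (g ξ).toLinearMap := fun c ↦
    ⟨c • ξ, by simp [h.g_ξ_ξ]⟩
  have hK : Module.finrank ℝ (hplane g ξ) = 2 * d := by
    have h1 := LinearMap.finrank_range_add_finrank_ker (g ξ).toLinearMap
    rw [LinearMap.range_eq_top.2 hsurj, finrank_top, Module.finrank_self, hfin] at h1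
    change 1 + Module.finrank ℝ (hplane g ξ) = _ at h1
    omega
  have hcoef (c : Fin (2 * d) → ℝ) (i) : gH g ξ (∑ j, c j • e j) (e i) = c i := by
    simp [map_sum, LinearMap.sum_apply, hg, he]
  have hli : LinearIndependent ℝ e := by
    rw [Fintype.linearIndependent_iff]
    intro c hc i
    rw [← hcoef c i, hc]; simp
  refine ⟨he, fun x ↦ ?_⟩
  rcases Nat.eq_zero_or_pos d with rfl | hd
  · have := Module.finrank_zero_iff.1 hK
    exact Subsingleton.elim _ _
  have : Nonempty (Fin (2 * d)) := ⟨⟨0, by omega⟩⟩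
  let b := basisOfLinearIndependentOfCardEqFinrank hli (by rw [hK]; simp)
  have hb (i) : b i = e i := by simp [b]
  have hx : x = ∑ j, b.repr x j • e j := by
    conv_lhs => rw [← b.sum_repr x]
    simp [hb]
  have hc (i) : gH g ξ x (e i) = b.repr x i := by
    conv_lhs => rw [hx]
    exact hcoef _ i
  simp only [hc]
  exact hx

/-- The curvature form of a sub-symmetric structure, in terms of the structure tensors and of two
scalars. -/
def curvatureForm (g : E →L[ℝ] E →L[ℝ] ℝ) (ξ : E) (J τ : E →L[ℝ] E) (l c : ℝ) (X Y Z V : E) : ℝ :=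
  IsWebsterCurvature.model g.toLinearMap₁₂ J.toLinearMap τ.toLinearMap l (2 * c) (2 * c)
    (X - g ξ X • ξ) (Y - g ξ Y • ξ) (Z - g ξ Z • ξ) (V - g ξ V • ξ)
  + IsWebsterCurvature.torsionPart g.toLinearMap₁₂ J.toLinearMap τ.toLinearMap
    (X - g ξ X • ξ) (Y - g ξ Y • ξ) (Z - g ξ Z • ξ) (V - g ξ V • ξ)

/-- The curvature of a Tanaka-Webster connection with horizontally parallel non-zero torsion is
determined by the structure tensors and two scalars. -/
theorem exists_model (h : IsWebsterPoint g ξ J τ ν Dν R) {d : ℕ}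
    (hfin : Module.finrank ℝ E = 2 * d + 1) {e : Fin (2 * d) → E} (heH : ∀ i, g ξ (e i) = 0)
    (he : ∀ i j, g (e i) (e j) = if i = j then 1 else 0) (hτ : τ ≠ 0) :
    d ≠ 0 ∧ ∃ l c : ℝ, 0 < l ∧ (∀ x, g ξ x = 0 → τ (τ x) = l ^ 2 • x) ∧
      (∀ x, ν x = (-2 * c) • J (τ x)) ∧
      (∀ X Y Z V : hplane g ξ, -g (R X Y Z) V = IsWebsterCurvature.model (gH g ξ)
          (restrH g h.g_ξ_ξ J) (restrH g h.g_ξ_ξ τ) l (2 * c) (2 * c) X Y Z V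
        + IsWebsterCurvature.torsionPart (gH g ξ) (restrH g h.g_ξ_ξ J) (restrH g h.g_ξ_ξ τ) X Y Z V) ∧
      ∀ X Y Z V, -g (R X Y Z) V = curvatureForm g ξ J τ l c X Y Z V := by
  have hJ (x) := coe_restrH (g := g) h.g_ξ_ξ h.θ_J x
  have hτ' (x) := coe_restrH (g := g) h.g_ξ_ξ h.θ_τ x
  have hg (x y : hplane g ξ) : gH g ξ x y = g x y := rfl
  have hθ (x : hplane g ξ) : g ξ x = 0 := x.2
  have hp (x : E) : g ξ (x - g ξ x • ξ) = 0 := by simp [h.g_ξ_ξ]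
  have hτp (x : E) : τ x = τ (x - g ξ x • ξ) := by simp [h.τ_ξ]
  have hW := h.isWebsterCurvature
  have hF : IsOrthonormalFrame (gH g ξ) (fun i ↦ (⟨e i, heH i⟩ : hplane g ξ)) :=
    h.isOrthonormalFrame hfin he
  obtain ⟨x₀, hx₀, hx₀'⟩ : ∃ x, g ξ x = 0 ∧ τ x ≠ 0 := by
    by_contra! h0
    exact hτ (by ext x; rw [hτp]; simpa using h0 _ (hp x))
  -- For `d = 0` the contact hyperplane is zero and carries no torsion.
  have hd : d ≠ 0 := by
    rintro rfl
    have : IsEmpty (Fin (2 * 0)) := inferInstanceAs (IsEmpty (Fin 0))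
    have h1 := hF.expand ⟨x₀, hx₀⟩
    rw [Finset.univ_eq_empty, Finset.sum_empty] at h1
    have h2 : x₀ = 0 := congrArg Subtype.val h1
    simp [h2] at hx₀'
  refine ⟨hd, ?_⟩
  have hsq := hW.τ_τ hd hF
  set t := ∑ i, gH g ξ (restrH g h.g_ξ_ξ τ (⟨e i, heH i⟩ : hplane g ξ))
    (restrH g h.g_ξ_ξ τ (⟨e i, heH i⟩ : hplane g ξ)) with ht
  have hd' : (0 : ℝ) < d := Nat.cast_pos.2 (Nat.pos_of_ne_zero hd)
  have htn : 0 < t / (2 * d) := by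
    have h1 := h.g_pos _ hx₀'
    -- By symmetry of `τ`, `|τ x₀|²` is `t / 2d` times `|x₀|²`, which shows that the scalar has a
    -- positive square root `l`.
    have h2 : t / (2 * d) * g x₀ x₀ = g (τ x₀) (τ x₀) := by
      have h3 := congrArg Subtype.val (hsq ⟨x₀, hx₀⟩)
      rw [hτ', hτ'] at h3
      rw [h.g_symm, ← h.τ_symm, h3]; simp
    rw [← h2] at h1
    have h4 : 0 < g x₀ x₀ := h.g_pos _ fun h0 ↦ hx₀' (by simp [h0])
    exact pos_of_mul_pos_left h1 h4.le
  have hl : 0 < √(t / (2 * d)) := Real.sqrt_pos.2 htn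
  have hl2 : √(t / (2 * d)) ^ 2 = t / (2 * d) := Real.sq_sqrt htn.le
  set l := √(t / (2 * d))
  have hsq' (x) : restrH g h.g_ξ_ξ τ (restrH g h.g_ξ_ξ τ x) = l ^ 2 • x := by rw [hl2, hsq]
  obtain ⟨c, hc1, hc2⟩ := hW.exists_curvature_eq hl hsq'
  have hmod (X Y Z V : hplane g ξ) : -g (R X Y Z) V = IsWebsterCurvature.model (gH g ξ)
          (restrH g h.g_ξ_ξ J) (restrH g h.g_ξ_ξ τ) l (2 * c) (2 * c) X Y Z V
        + IsWebsterCurvature.torsionPart (gH g ξ) (restrH g h.g_ξ_ξ J) (restrH g h.g_ξ_ξ τ)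
          X Y Z V := by
    have h1 := hc2 X Y Z V
    rw [IsWebsterCurvature.model]
    linear_combination h1
  refine ⟨l, c, hl, fun x hx ↦ ?_, fun x ↦ ?_, hmod, fun X Y Z V ↦ ?_⟩
  · have h3 := congrArg Subtype.val (hsq' ⟨x, hx⟩)
    rwa [hτ', hτ'] at h3
  · have hx0 : x₀ ≠ 0 := fun h0 ↦ hx₀' (by simp [h0])
    have hne : g (J x₀) (J x₀) ≠ 0 := by
      rw [h.g_J, h.J_J, hx₀]; simpa using (h.g_pos _ hx0).ne'
    -- The algebra on `H` only sees the horizontal part of `ν` on `H`. The Ricci identity at `(x₀, J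
    -- x₀)`, where `ω` does not vanish, expresses `ν` by `R` and `τ`; hence `ν` has horizontal
    -- values and kills `ξ`.
    have hν (z) : g (J x₀) (J x₀) • ν z = R x₀ (J x₀) (τ z) - τ (R x₀ (J x₀) z) :=
      (h.ricci_H hx₀ (h.θ_J _) z).symm
    have hνθ (z) : g ξ (ν z) = 0 := by
      have h1 := congrArg (g ξ) (hν z)
      simp only [map_sub, h.θ_R, h.θ_τ, map_smul, smul_eq_mul, sub_zero] at h1
      exact (mul_eq_zero.1 h1).resolve_left hne
    have hνξ : ν ξ = 0 := by
      have h1 := hν ξ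
      rw [h.τ_ξ, h.R_ξ, map_zero, map_zero, sub_zero] at h1
      exact (smul_eq_zero.1 h1).resolve_left hne
    have h1 := congrArg Subtype.val (hc1 ⟨_, hp x⟩)
    rw [coe_restrH h.g_ξ_ξ hνθ, Submodule.coe_smul, hJ, hτ'] at h1
    simpa [hνξ, h.τ_ξ] using h1
  · have hR : R X Y = R (X - g ξ X • ξ) (Y - g ξ Y • ξ) := by
      have hl (a b : E) : R (a - g ξ a • ξ) b = R a b := by
        have h1 := h.add (a - g ξ a • ξ) (g ξ a • ξ) b
        rw [h.smul, h.R_ξ_left, smul_zero, add_zero, sub_add_cancel] at h1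
        exact h1.symm
      rw [hl, h.skew X, h.skew X, hl]
    have hc : R X Y Z = R X Y (Z - g ξ Z • ξ) := by simp [h.R_ξ]
    have hV (v) (hv : g ξ v = 0) : g v V = g v (V - g ξ V • ξ) := by
      rw [map_sub, map_smul, h.g_symm v ξ, hv]; simp
    rw [hV _ (h.θ_R _ _ _), hc, hR, hmod ⟨_, hp X⟩ ⟨_, hp Y⟩ ⟨_, hp Z⟩ ⟨_, hp V⟩, curvatureForm]
    simp only [IsWebsterCurvature.model, IsWebsterCurvature.torsionPart, holoCurv, kulkarni,
      symProd, hg, hJ, hτ', ContinuousLinearMap.toLinearMap₁₂_apply_apply_apply,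
      ContinuousLinearMap.coe_coe]

/-- `τ²` is `l²` times the projection onto `H` along `ξ`, whose rank is `2d`. The trace recovers `l`
without a choice of frame. -/
theorem trace_sq (h : IsWebsterPoint g ξ J τ ν Dν R) {d : ℕ}
    (hfin : Module.finrank ℝ E = 2 * d + 1) {l : ℝ}
    (hl : ∀ x, g ξ x = 0 → τ (τ x) = l ^ 2 • x) :
    LinearMap.trace ℝ E (τ ∘L τ).toLinearMap = 2 * d * l ^ 2 := by
  have : FiniteDimensional ℝ E := Module.finite_of_finrank_pos (by omega)
  have h1 : (τ ∘L τ).toLinearMap =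
      l ^ 2 • (LinearMap.id - (g ξ).toLinearMap.smulRight ξ) := by
    ext x
    have h2 : τ x = τ (x - g ξ x • ξ) := by simp [h.τ_ξ]
    have h3 := hl (x - g ξ x • ξ) (by simp [h.g_ξ_ξ])
    rw [← h2] at h3
    simpa using h3
  rw [h1, map_smul, map_sub, LinearMap.trace_id, LinearMap.trace_smulRight, hfin]
  simp [h.g_ξ_ξ]
  ring

/-- In the Ricci identity at `(ξ, b)` the left side vanishes because `R(ξ, ·) = 0`, and only `Dν b`
survives on the right. -/
theorem Dν_H (h : IsWebsterPoint g ξ J τ ν Dν R) {b : E} (hb : g ξ b = 0) : Dν b = 0 := by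
  ext c
  have h1 := h.ricci ξ b c
  rw [h.R_ξ_left, h.J_ξ, hb, h.g_ξ_ξ] at h1
  simpa using h1.symm

/-- From `ν = -2c Jτ` and `JτJτ = τ²`. The scalar `c` becomes a quotient of two traces, which is how
its constancy is proved. -/
theorem trace_deriv (h : IsWebsterPoint g ξ J τ ν Dν R) {c : ℝ}
    (hc : ∀ x, ν x = (-2 * c) • J (τ x)) :
    LinearMap.trace ℝ E (ν ∘L J ∘L τ).toLinearMap =
      (-2 * c) * LinearMap.trace ℝ E (τ ∘L τ).toLinearMap := by
  rw [← smul_eq_mul, ← map_smul]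
  congr 1
  ext x
  simp [hc, h.τ_J, h.J_J, h.θ_τ]

/-- The form is built from `g`, `ξ`, `J`, `τ` alone, hence natural; the scalars `l` and `c` must be
the same at both points. -/
theorem curvatureForm_map {g' : E →L[ℝ] E →L[ℝ] ℝ} {ξ' : E} {J' τ' f : E →L[ℝ] E}
    (hg : ∀ a b, g' (f a) (f b) = g a b) (hξ : f ξ = ξ') (hJ : ∀ a, f (J a) = J' (f a))
    (hτ : ∀ a, f (τ a) = τ' (f a)) (l c : ℝ) (X Y Z V : E) :
    curvatureForm g' ξ' J' τ' l c (f X) (f Y) (f Z) (f V) = curvatureForm g ξ J τ l c X Y Z V := by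
  have hP (x : E) : f x - g' ξ' (f x) • ξ' = f (x - g ξ x • ξ) := by
    rw [← hξ, hg]; simp
  simp only [curvatureForm, hP, IsWebsterCurvature.model, IsWebsterCurvature.torsionPart, holoCurv,
    kulkarni, symProd, ContinuousLinearMap.toLinearMap₁₂_apply_apply_apply,
    ContinuousLinearMap.coe_coe, ← hJ, ← hτ, hg]

end IsWebsterPoint

end

/-! ### Bianchi and Ricci identities in a chart -/

noncomputable section

set_option synthInstance.maxHeartbeats 200000

variable {E : Type*} [NormedAddCommGroup E] [NormedSpace ℝ E]

section Calculus

variable {F G : Type*} [NormedAddCommGroup F] [NormedSpace ℝ F] [NormedAddCommGroup G]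
  [NormedSpace ℝ G]

theorem fderiv_apply_apply {c : E → F →L[ℝ] G} {w : E → F} {y : E} (hc : DifferentiableAt ℝ c y)
    (hw : DifferentiableAt ℝ w y) (v : E) :
    fderiv ℝ (fun y ↦ c y (w y)) y v = fderiv ℝ c y v (w y) + c y (fderiv ℝ w y v) := by
  rw [fderiv_clm_apply hc hw]
  simp [add_comm]

theorem fderiv_apply_const {c : E → F →L[ℝ] G} {y : E} (hc : DifferentiableAt ℝ c y) (w : F)
    (v : E) : fderiv ℝ (fun y ↦ c y w) y v = fderiv ℝ c y v w := by
  rw [fderiv_apply_apply hc (differentiableAt_const w)]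
  simp

theorem two_le_infty : (2 : WithTop ℕ∞) ≤ ∞ := by
  exact WithTop.coe_le_coe.2 (le_top : (2 : ℕ∞) ≤ ⊤)

/-- The symmetry of the second derivative, in terms of directional derivatives. -/
theorem fderiv_directional_comm {f : E → F} {y : E} (hf : ContDiffAt ℝ 2 f y) {p q : E → F}
    {u v : E} (hp : p =ᶠ[𝓝 y] fun z ↦ fderiv ℝ f z u) (hq : q =ᶠ[𝓝 y] fun z ↦ fderiv ℝ f z v) :
    fderiv ℝ p y v = fderiv ℝ q y u := by
  have h1 : DifferentiableAt ℝ (fderiv ℝ f) y :=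
    (hf.fderiv_right (m := 1) (by norm_num)).differentiableAt (by simp)
  rw [hp.fderiv_eq, hq.fderiv_eq, fderiv_apply_const h1, fderiv_apply_const h1]
  have := hf.isSymmSndFDerivAt (by simp)
  exact this v u

end Calculus

/-- The structure tensors of a contact metric manifold, its Tanaka-Webster connection `Γ` and the
torsion `τ` in a chart, where `∇_u τ = 0` for horizontal `u`. -/
structure IsWebsterChart (U : Set E) (Γ : E → E →L[ℝ] E →L[ℝ] E) (g : E → E →L[ℝ] E →L[ℝ] ℝ)
    (ξ : E → E) (J τ : E → E →L[ℝ] E) : Prop where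
  isOpen : IsOpen U
  smooth_Γ : ContDiffOn ℝ ∞ Γ U
  smooth_g : ContDiffOn ℝ ∞ g U
  smooth_ξ : ContDiffOn ℝ ∞ ξ U
  smooth_J : ContDiffOn ℝ ∞ J U
  smooth_τ : ContDiffOn ℝ ∞ τ U
  g_symm : ∀ y ∈ U, ∀ a b, g y a b = g y b a
  g_pos : ∀ y ∈ U, ∀ a, a ≠ 0 → 0 < g y a a
  g_ξ_ξ : ∀ y ∈ U, g y (ξ y) (ξ y) = 1
  J_J : ∀ y ∈ U, ∀ a, J y (J y a) = -a + g y (ξ y) a • ξ y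
  g_J : ∀ y ∈ U, ∀ a b, g y (J y a) b = -g y a (J y b)
  τ_ξ : ∀ y ∈ U, τ y (ξ y) = 0
  τ_J : ∀ y ∈ U, ∀ a, τ y (J y a) = -J y (τ y a)
  diff_g : ∀ y ∈ U, ∀ u a b, fderiv ℝ g y u a b = g y (Γ y u a) b + g y a (Γ y u b)
  diff_ξ : ∀ y ∈ U, ∀ u, fderiv ℝ ξ y u = -Γ y u (ξ y)
  diff_J : ∀ y ∈ U, ∀ u a, fderiv ℝ J y u a = J y (Γ y u a) - Γ y u (J y a)
  diff_τ_H : ∀ y ∈ U, ∀ u, g y (ξ y) u = 0 → ∀ a,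
    fderiv ℝ τ y u a = τ y (Γ y u a) - Γ y u (τ y a)
  torsion : ∀ y ∈ U, ∀ a b, Γ y a b - Γ y b a = websterTorsion (g y) (ξ y) (J y) (τ y) a b

/-- The covariant derivative of a field of endomorphisms. -/
def chartCovEnd (Γ : E → E →L[ℝ] E →L[ℝ] E) (P : E → E →L[ℝ] E) (y u : E) : E →L[ℝ] E :=
  fderiv ℝ P y u + Γ y u ∘L P y - P y ∘L Γ y u

theorem contDiffOn_chartCovEnd {U : Set E} (hU : IsOpen U) {Γ : E → E →L[ℝ] E →L[ℝ] E}
    (hΓ : ContDiffOn ℝ ∞ Γ U) {P : E → E →L[ℝ] E} (hP : ContDiffOn ℝ ∞ P U) {u : E → E}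
    (hu : ContDiffOn ℝ ∞ u U) : ContDiffOn ℝ ∞ (fun y ↦ chartCovEnd Γ P y (u y)) U := by
  have h1 : ContDiffOn ℝ ∞ (fderiv ℝ P) U := hP.fderiv_of_isOpen hU (by simp)
  have h2 : ContDiffOn ℝ ∞ (fun y ↦ fderiv ℝ P y (u y)) U := h1.clm_apply hu
  have h3 : ContDiffOn ℝ ∞ (fun y ↦ Γ y (u y)) U := hΓ.clm_apply hu
  exact (h2.add (h3.clm_comp hP)).sub (hP.clm_comp h3)

theorem chartCurv_add (Γ : E → E →L[ℝ] E →L[ℝ] E) (y a a' b : E) :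
    chartCurv Γ y (a + a') b = chartCurv Γ y a b + chartCurv Γ y a' b := by
  have h1 : fderiv ℝ Γ y (a + a') = fderiv ℝ Γ y a + fderiv ℝ Γ y a' := map_add _ _ _
  have h2 : Γ y (a + a') = Γ y a + Γ y a' := map_add _ _ _
  have h3 : fderiv ℝ Γ y b (a + a') = fderiv ℝ Γ y b a + fderiv ℝ Γ y b a' := map_add _ _ _
  ext c
  simp only [chartCurv, h1, h2, h3, add_apply, sub_apply, ContinuousLinearMap.comp_apply]
  have h4 : Γ y b (Γ y a c + Γ y a' c) = Γ y b (Γ y a c) + Γ y b (Γ y a' c) := map_add _ _ _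
  rw [h4]
  abel

theorem chartCurv_smul (Γ : E → E →L[ℝ] E →L[ℝ] E) (y : E) (t : ℝ) (a b : E) :
    chartCurv Γ y (t • a) b = t • chartCurv Γ y a b := by
  have h1 : fderiv ℝ Γ y (t • a) = t • fderiv ℝ Γ y a := map_smul _ _ _
  have h2 : Γ y (t • a) = t • Γ y a := map_smul _ _ _
  have h3 : fderiv ℝ Γ y b (t • a) = t • fderiv ℝ Γ y b a := map_smul _ _ _
  ext c
  simp only [chartCurv, h1, h2, h3, add_apply, sub_apply, smul_apply,
    ContinuousLinearMap.comp_apply]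
  have h4 : Γ y b (t • Γ y a c) = t • Γ y b (Γ y a c) := map_smul _ _ _
  rw [h4]
  module

theorem chartCurv_skew (Γ : E → E →L[ℝ] E →L[ℝ] E) (y a b : E) :
    chartCurv Γ y a b = -chartCurv Γ y b a := by
  simp only [chartCurv]
  abel

namespace IsWebsterChart

variable {U : Set E} {Γ : E → E →L[ℝ] E →L[ℝ] E} {g : E → E →L[ℝ] E →L[ℝ] ℝ}
    {ξ : E → E} {J τ : E → E →L[ℝ] E}

theorem differentiableAt_of_mem (h : IsWebsterChart U Γ g ξ J τ) {F : Type*} [NormedAddCommGroup F]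
    [NormedSpace ℝ F] {f : E → F} (hf : ContDiffOn ℝ ∞ f U) {y : E} (hy : y ∈ U) :
    DifferentiableAt ℝ f y :=
  ((hf.contDiffAt (h.isOpen.mem_nhds hy)).differentiableAt (by simp))

/-- The covariant derivative `∇_ξ τ`. -/
def nu (Γ : E → E →L[ℝ] E →L[ℝ] E) (ξ : E → E) (τ : E → E →L[ℝ] E) (y : E) : E →L[ℝ] E :=
  chartCovEnd Γ τ y (ξ y)

theorem smooth_nu (h : IsWebsterChart U Γ g ξ J τ) : ContDiffOn ℝ ∞ (nu Γ ξ τ) U :=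
  contDiffOn_chartCovEnd h.isOpen h.smooth_Γ h.smooth_τ h.smooth_ξ

/-- The horizontal part `u - θ(u) ξ` of the direction contributes nothing, by hypothesis. -/
theorem covEnd_τ (h : IsWebsterChart U Γ g ξ J τ) {y : E} (hy : y ∈ U) (u : E) :
    chartCovEnd Γ τ y u = g y (ξ y) u • nu Γ ξ τ y := by
  have h1 : g y (ξ y) (u - g y (ξ y) u • ξ y) = 0 := by simp [h.g_ξ_ξ y hy]
  ext a
  have h2 := h.diff_τ_H y hy _ h1 a
  simp only [map_sub, map_smul, sub_apply, smul_apply] at h2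
  simp only [nu, chartCovEnd, add_apply, sub_apply, smul_apply, ContinuousLinearMap.comp_apply]
  have h3 : fderiv ℝ τ y u a = g y (ξ y) u • fderiv ℝ τ y (ξ y) a +
    (τ y (Γ y u a) - g y (ξ y) u • τ y (Γ y (ξ y) a) -
      (Γ y u (τ y a) - g y (ξ y) u • Γ y (ξ y) (τ y a))) := by rw [← h2]; abel
  rw [h3]
  module

theorem diff_τ (h : IsWebsterChart U Γ g ξ J τ) {y : E} (hy : y ∈ U) (u a : E) :
    fderiv ℝ τ y u a = g y (ξ y) u • nu Γ ξ τ y a + τ y (Γ y u a) - Γ y u (τ y a) := by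
  have h1 := congrArg (fun P : E →L[ℝ] E ↦ P a) (h.covEnd_τ hy u)
  simp only [chartCovEnd, add_apply, sub_apply, smul_apply, ContinuousLinearMap.comp_apply] at h1
  rw [← h1]; abel

theorem fderiv_θ (h : IsWebsterChart U Γ g ξ J τ) {y : E} (hy : y ∈ U) (u v : E) :
    fderiv ℝ (fun z ↦ g z (ξ z) u) y v = g y (ξ y) (Γ y v u) := by
  have hg := h.differentiableAt_of_mem h.smooth_g hy
  have hξ := h.differentiableAt_of_mem h.smooth_ξ hy
  rw [fderiv_apply_const (hg.clm_apply hξ), fderiv_apply_apply hg hξ, add_apply, h.diff_g y hy,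
    h.diff_ξ y hy]
  simp

theorem fderiv_ω (h : IsWebsterChart U Γ g ξ J τ) {y : E} (hy : y ∈ U) (a b v : E) :
    fderiv ℝ (fun z ↦ g z (J z a) b) y v = g y (J y (Γ y v a)) b + g y (J y a) (Γ y v b) := by
  have hg := h.differentiableAt_of_mem h.smooth_g hy
  have hJ := (h.differentiableAt_of_mem h.smooth_J hy).clm_apply (differentiableAt_const a)
  rw [fderiv_apply_const (hg.clm_apply hJ), fderiv_apply_apply hg hJ, add_apply, h.diff_g y hy,
    fderiv_apply_const (h.differentiableAt_of_mem h.smooth_J hy), h.diff_J y hy]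
  simp only [map_sub, sub_apply]
  ring

/-- The equation `∇ξ = 0` expresses the derivative of `ξ` by `Γ`; symmetry of second derivatives is
its integrability condition, which says that the curvature kills `ξ`. The same argument for `J`, `τ`
and `g` follows. -/
theorem curv_ξ (h : IsWebsterChart U Γ g ξ J τ) {y : E} (hy : y ∈ U) (u v : E) :
    chartCurv Γ y u v (ξ y) = 0 := by
  have hΓ := h.differentiableAt_of_mem h.smooth_Γ hy
  have hξ := h.differentiableAt_of_mem h.smooth_ξ hy
  have key (u v : E) : fderiv ℝ (fun z ↦ -Γ z u (ξ z)) y v =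
      -(fderiv ℝ Γ y v u (ξ y)) + Γ y u (Γ y v (ξ y)) := by
    rw [fderiv_fun_neg, neg_apply, fderiv_apply_apply (hΓ.clm_apply (differentiableAt_const u)) hξ,
      fderiv_apply_const hΓ, h.diff_ξ y hy]
    simp [add_comm]
  have h1 := fderiv_directional_comm (u := u) (v := v)
    ((h.smooth_ξ.contDiffAt (h.isOpen.mem_nhds hy)).of_le two_le_infty)
    (p := fun z ↦ -Γ z u (ξ z)) (q := fun z ↦ -Γ z v (ξ z))
    (by filter_upwards [h.isOpen.mem_nhds hy] with z hz using (h.diff_ξ z hz u).symm)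
    (by filter_upwards [h.isOpen.mem_nhds hy] with z hz using (h.diff_ξ z hz v).symm)
  rw [key, key] at h1
  simp only [chartCurv, add_apply, sub_apply, ContinuousLinearMap.comp_apply]
  rw [← sub_eq_zero] at h1
  rw [← h1]
  abel

theorem curv_J (h : IsWebsterChart U Γ g ξ J τ) {y : E} (hy : y ∈ U) (u v a : E) :
    chartCurv Γ y u v (J y a) = J y (chartCurv Γ y u v a) := by
  have hΓ := h.differentiableAt_of_mem h.smooth_Γ hy
  have hJ := h.differentiableAt_of_mem h.smooth_J hy
  have hΓu (u : E) := hΓ.clm_apply (differentiableAt_const u)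
  have key (u v : E) : fderiv ℝ (fun z ↦ J z (Γ z u a) - Γ z u (J z a)) y v =
      (J y (Γ y v (Γ y u a)) - Γ y v (J y (Γ y u a)) + J y (fderiv ℝ Γ y v u a))
      - (fderiv ℝ Γ y v u (J y a) + Γ y u (J y (Γ y v a) - Γ y v (J y a))) := by
    have e1 := (hΓu u).clm_apply (differentiableAt_const a)
    have e2 := hJ.clm_apply (differentiableAt_const a)
    rw [fderiv_fun_sub (hJ.clm_apply e1) ((hΓu u).clm_apply e2), sub_apply,
      fderiv_apply_apply hJ e1, fderiv_apply_apply (hΓu u) e2,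
      fderiv_apply_const (hΓu u), fderiv_apply_const hΓ, fderiv_apply_const hJ, h.diff_J y hy,
      h.diff_J y hy]
  have hJa : ContDiffOn ℝ ∞ (fun z ↦ J z a) U := h.smooth_J.clm_apply contDiffOn_const
  have hd (u z) (hz : z ∈ U) : J z (Γ z u a) - Γ z u (J z a) = fderiv ℝ (fun z ↦ J z a) z u := by
    rw [fderiv_apply_const (h.differentiableAt_of_mem h.smooth_J hz), h.diff_J z hz]
  have h1 := fderiv_directional_comm (u := u) (v := v)
    ((hJa.contDiffAt (h.isOpen.mem_nhds hy)).of_le two_le_infty)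
    (by filter_upwards [h.isOpen.mem_nhds hy] with z hz using hd u z hz)
    (by filter_upwards [h.isOpen.mem_nhds hy] with z hz using hd v z hz)
  rw [key, key] at h1
  simp only [chartCurv, add_apply, sub_apply, ContinuousLinearMap.comp_apply, map_add, map_sub]
    at h1 ⊢
  rw [← sub_eq_zero] at h1 ⊢
  rw [← h1]
  abel

/-- Here the first derivative is `θ ⊗ ν` and not zero. Its antisymmetrized derivative leaves `dθ ⊗
ν`, where `dθ` appears as the `θ`-component of the torsion, and the terms of `θ ∧ ∇ν`. -/
theorem curv_τ (h : IsWebsterChart U Γ g ξ J τ) {y : E} (hy : y ∈ U) (u v a : E) :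
    chartCurv Γ y u v (τ y a) - τ y (chartCurv Γ y u v a) =
      g y (ξ y) (Γ y u v - Γ y v u) • nu Γ ξ τ y a
        + g y (ξ y) v • chartCovEnd Γ (nu Γ ξ τ) y u a
        - g y (ξ y) u • chartCovEnd Γ (nu Γ ξ τ) y v a := by
  have hΓ := h.differentiableAt_of_mem h.smooth_Γ hy
  have hτ := h.differentiableAt_of_mem h.smooth_τ hy
  have hν := h.differentiableAt_of_mem h.smooth_nu hy
  have hθ (u : E) : DifferentiableAt ℝ (fun z ↦ g z (ξ z) u) y :=
    ((h.differentiableAt_of_mem h.smooth_g hy).clm_apply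
      (h.differentiableAt_of_mem h.smooth_ξ hy)).clm_apply (differentiableAt_const u)
  have hΓu (u : E) := hΓ.clm_apply (differentiableAt_const u)
  have key (u v : E) : fderiv ℝ (fun z ↦ g z (ξ z) u • nu Γ ξ τ z a + τ z (Γ z u a)
        - Γ z u (τ z a)) y v =
      (g y (ξ y) u • fderiv ℝ (nu Γ ξ τ) y v a + g y (ξ y) (Γ y v u) • nu Γ ξ τ y a)
      + ((g y (ξ y) v • nu Γ ξ τ y (Γ y u a) + τ y (Γ y v (Γ y u a)) - Γ y v (τ y (Γ y u a)))
        + τ y (fderiv ℝ Γ y v u a))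
      - (fderiv ℝ Γ y v u (τ y a)
        + Γ y u (g y (ξ y) v • nu Γ ξ τ y a + τ y (Γ y v a) - Γ y v (τ y a))) := by
    have e1 := (hΓu u).clm_apply (differentiableAt_const a)
    have e2 := hτ.clm_apply (differentiableAt_const a)
    have e3 := hν.clm_apply (differentiableAt_const a)
    rw [fderiv_fun_sub (((hθ u).fun_smul e3).fun_add (hτ.clm_apply e1)) ((hΓu u).clm_apply e2),
      sub_apply, fderiv_fun_add ((hθ u).fun_smul e3) (hτ.clm_apply e1), add_apply,
      fderiv_fun_smul (hθ u) e3, fderiv_apply_apply hτ e1, fderiv_apply_apply (hΓu u) e2,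
      fderiv_apply_const (hΓu u), fderiv_apply_const hΓ, fderiv_apply_const hτ, h.diff_τ hy,
      h.diff_τ hy]
    simp only [add_apply, smul_apply, ContinuousLinearMap.smulRight_apply, h.fderiv_θ hy,
      fderiv_apply_const hν]
  have hτa : ContDiffOn ℝ ∞ (fun z ↦ τ z a) U := h.smooth_τ.clm_apply contDiffOn_const
  have hd (u z) (hz : z ∈ U) : g z (ξ z) u • nu Γ ξ τ z a + τ z (Γ z u a)
        - Γ z u (τ z a) = fderiv ℝ (fun z ↦ τ z a) z u := by
    rw [fderiv_apply_const (h.differentiableAt_of_mem h.smooth_τ hz), h.diff_τ hz]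
  have h1 := fderiv_directional_comm (u := u) (v := v)
    ((hτa.contDiffAt (h.isOpen.mem_nhds hy)).of_le two_le_infty)
    (by filter_upwards [h.isOpen.mem_nhds hy] with z hz using hd u z hz)
    (by filter_upwards [h.isOpen.mem_nhds hy] with z hz using hd v z hz)
  rw [key, key] at h1
  simp only [chartCurv, chartCovEnd, add_apply, sub_apply, ContinuousLinearMap.comp_apply, map_add,
    map_sub, map_smul, sub_smul, smul_add, smul_sub] at h1 ⊢
  rw [← sub_eq_zero] at h1 ⊢
  rw [← h1]
  abel

theorem curv_g (h : IsWebsterChart U Γ g ξ J τ) {y : E} (hy : y ∈ U) (u v a b : E) :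
    g y (chartCurv Γ y u v a) b = -g y a (chartCurv Γ y u v b) := by
  have hΓ := h.differentiableAt_of_mem h.smooth_Γ hy
  have hg := h.differentiableAt_of_mem h.smooth_g hy
  have hΓu (u a : E) := (hΓ.clm_apply (differentiableAt_const u)).clm_apply
    (differentiableAt_const a)
  have key (u v a b : E) : fderiv ℝ (fun z ↦ g z (Γ z u a) b) y v =
      g y (Γ y v (Γ y u a)) b + g y (Γ y u a) (Γ y v b) + g y (fderiv ℝ Γ y v u a) b := by
    rw [fderiv_apply_const (hg.clm_apply (hΓu u a)), fderiv_apply_apply hg (hΓu u a), add_apply,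
      h.diff_g y hy, fderiv_apply_const (hΓ.clm_apply (differentiableAt_const u)),
      fderiv_apply_const hΓ]
  have hd (u z) (hz : z ∈ U) : g z (Γ z u a) b + g z (Γ z u b) a =
      fderiv ℝ (fun z ↦ g z a b) z u := by
    have hgz := h.differentiableAt_of_mem h.smooth_g hz
    rw [fderiv_apply_const (hgz.clm_apply (differentiableAt_const a)), fderiv_apply_const hgz,
      h.diff_g z hz, h.g_symm z hz a]
  have hgab : ContDiffOn ℝ ∞ (fun z ↦ g z a b) U :=
    (h.smooth_g.clm_apply contDiffOn_const).clm_apply contDiffOn_const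
  have h1 := fderiv_directional_comm (u := u) (v := v)
    ((hgab.contDiffAt (h.isOpen.mem_nhds hy)).of_le two_le_infty)
    (by filter_upwards [h.isOpen.mem_nhds hy] with z hz using hd u z hz)
    (by filter_upwards [h.isOpen.mem_nhds hy] with z hz using hd v z hz)
  have hgd (u a b : E) := (hg.clm_apply (hΓu u a)).clm_apply (differentiableAt_const b)
  rw [fderiv_fun_add (hgd u a b) (hgd u b a), fderiv_fun_add (hgd v a b) (hgd v b a), add_apply,
    add_apply, key, key, key, key] at h1
  rw [h.g_symm y hy a]
  simp only [chartCurv, add_apply, sub_apply, ContinuousLinearMap.comp_apply, map_add, map_sub]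
  linarith [h.g_symm y hy (Γ y u a) (Γ y v b), h.g_symm y hy (Γ y v a) (Γ y u b)]

/-- All ingredients of the torsion are parallel except `τ`; its derivative `θ ⊗ ν` gives the two
terms with `ν`. -/
theorem fderiv_torsion (h : IsWebsterChart U Γ g ξ J τ) {y : E} (hy : y ∈ U) (v a b : E) :
    fderiv ℝ (fun z ↦ websterTorsion (g z) (ξ z) (J z) (τ z) a b) y v =
      (g y (ξ y) v * g y (ξ y) b) • nu Γ ξ τ y a - (g y (ξ y) v * g y (ξ y) a) • nu Γ ξ τ y b
      + websterTorsion (g y) (ξ y) (J y) (τ y) (Γ y v a) b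
      + websterTorsion (g y) (ξ y) (J y) (τ y) a (Γ y v b)
      - Γ y v (websterTorsion (g y) (ξ y) (J y) (τ y) a b) := by
  have hg := h.differentiableAt_of_mem h.smooth_g hy
  have hξ := h.differentiableAt_of_mem h.smooth_ξ hy
  have hτ := h.differentiableAt_of_mem h.smooth_τ hy
  have hJ := h.differentiableAt_of_mem h.smooth_J hy
  have hθ (u : E) : DifferentiableAt ℝ (fun z ↦ g z (ξ z) u) y :=
    (hg.clm_apply hξ).clm_apply (differentiableAt_const u)
  have hω : DifferentiableAt ℝ (fun z ↦ g z (J z a) b) y :=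
    (hg.clm_apply (hJ.clm_apply (differentiableAt_const a))).clm_apply (differentiableAt_const b)
  have hτu (u : E) := hτ.clm_apply (differentiableAt_const u)
  simp only [websterTorsion]
  rw [fderiv_fun_add ((hω.fun_smul hξ).fun_sub ((hθ a).fun_smul (hτu b)))
      ((hθ b).fun_smul (hτu a)), add_apply,
    fderiv_fun_sub (hω.fun_smul hξ) ((hθ a).fun_smul (hτu b)), sub_apply,
    fderiv_fun_smul hω hξ, fderiv_fun_smul (hθ a) (hτu b), fderiv_fun_smul (hθ b) (hτu a)]
  simp only [add_apply, smul_apply, ContinuousLinearMap.smulRight_apply, h.fderiv_θ hy,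
    h.fderiv_ω hy, fderiv_apply_const hτ, h.diff_τ hy, h.diff_ξ y hy, map_add, map_sub, map_smul]
  module

/-- The cyclic sum of the curvature is the cyclic sum of the derivative of the torsion equation,
plus terms quadratic in `Γ`. The terms with `ν` cancel in the cyclic sum, and the quadratic ones
reassemble into the torsion of the torsion. -/
theorem bianchi (h : IsWebsterChart U Γ g ξ J τ) {y : E} (hy : y ∈ U) (a b c : E) :
    chartCurv Γ y a b c + chartCurv Γ y b c a + chartCurv Γ y c a b =
      websterTorsion (g y) (ξ y) (J y) (τ y) (websterTorsion (g y) (ξ y) (J y) (τ y) a b) c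
      + websterTorsion (g y) (ξ y) (J y) (τ y) (websterTorsion (g y) (ξ y) (J y) (τ y) b c) a
      + websterTorsion (g y) (ξ y) (J y) (τ y) (websterTorsion (g y) (ξ y) (J y) (τ y) c a) b := by
  have hΓ := h.differentiableAt_of_mem h.smooth_Γ hy
  have hΓu (u : E) := hΓ.clm_apply (differentiableAt_const u)
  have hd (v a b : E) : fderiv ℝ Γ y v a b - fderiv ℝ Γ y v b a =
      fderiv ℝ (fun z ↦ websterTorsion (g z) (ξ z) (J z) (τ z) a b) y v := by
    have h1 : (fun z ↦ Γ z a b - Γ z b a) =ᶠ[𝓝 y]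
        fun z ↦ websterTorsion (g z) (ξ z) (J z) (τ z) a b := by
      filter_upwards [h.isOpen.mem_nhds hy] with z hz using h.torsion z hz a b
    rw [← h1.fderiv_eq, fderiv_fun_sub ((hΓu a).clm_apply (differentiableAt_const b))
      ((hΓu b).clm_apply (differentiableAt_const a)), sub_apply, fderiv_apply_const (hΓu a),
      fderiv_apply_const (hΓu b), fderiv_apply_const hΓ, fderiv_apply_const hΓ]
  have e1 := hd a b c
  have e2 := hd b c a
  have e3 := hd c a b
  rw [h.fderiv_torsion hy, ← h.torsion y hy b c] at e1
  rw [h.fderiv_torsion hy, ← h.torsion y hy c a] at e2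
  rw [h.fderiv_torsion hy, ← h.torsion y hy a b] at e3
  have hW (p q r : E) : websterTorsion (g y) (ξ y) (J y) (τ y) (p - q) r =
      websterTorsion (g y) (ξ y) (J y) (τ y) p r
        + websterTorsion (g y) (ξ y) (J y) (τ y) r q := by
    have hω : g y (J y q) r = -g y (J y r) q := by
      rw [h.g_J y hy, h.g_symm y hy]
    simp only [websterTorsion, map_sub, sub_apply, hω]
    module
  rw [← h.torsion y hy a b, ← h.torsion y hy b c, ← h.torsion y hy c a, hW, hW, hW]
  simp only [chartCurv, add_apply, sub_apply, ContinuousLinearMap.comp_apply]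
  have hsum : (fderiv ℝ Γ y a b c - fderiv ℝ Γ y a c b) + (fderiv ℝ Γ y b c a - fderiv ℝ Γ y b a c)
      + (fderiv ℝ Γ y c a b - fderiv ℝ Γ y c b a) = _ := congrArg₂ (· + ·)
        (congrArg₂ (· + ·) e1 e2) e3
  simp only [map_sub] at hsum
  rw [← sub_eq_zero] at hsum ⊢
  rw [← hsum]
  module

theorem θ_τ (h : IsWebsterChart U Γ g ξ J τ) {y : E} (hy : y ∈ U) (x : E) :
    g y (ξ y) (τ y x) = 0 := by
  have hJξ : J y (ξ y) = 0 := by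
    by_contra h0
    have h5 := h.g_pos y hy _ h0
    rw [h.g_J y hy, h.J_J y hy, h.g_ξ_ξ y hy, one_smul, neg_add_cancel, map_zero, neg_zero] at h5
    exact lt_irrefl _ h5
  have hθJ (z) : g y (ξ y) (J y z) = 0 := by
    have e3 := h.g_J y hy (ξ y) z
    rw [hJξ, map_zero, zero_apply] at e3
    linarith
  have hx : x = -J y (J y x) + g y (ξ y) x • ξ y := by rw [h.J_J y hy]; abel
  rw [hx, map_add, map_neg, h.τ_J y hy, map_smul, h.τ_ξ y hy, neg_neg, smul_zero, add_zero, hθJ]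

theorem θ_torsion (h : IsWebsterChart U Γ g ξ J τ) {y : E} (hy : y ∈ U) (a b : E) :
    g y (ξ y) (Γ y a b - Γ y b a) = g y (J y a) b := by
  rw [h.torsion y hy, websterTorsion, map_add, map_sub, map_smul, map_smul, map_smul, h.θ_τ hy,
    h.θ_τ hy, h.g_ξ_ξ y hy]
  simp only [smul_eq_mul]
  ring

theorem isWebsterPoint (h : IsWebsterChart U Γ g ξ J τ) {y : E} (hy : y ∈ U) :
    IsWebsterPoint (g y) (ξ y) (J y) (τ y) (nu Γ ξ τ y) (chartCovEnd Γ (nu Γ ξ τ) y)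
      (chartCurv Γ y) where
  g_symm := h.g_symm y hy
  g_pos := h.g_pos y hy
  g_ξ_ξ := h.g_ξ_ξ y hy
  J_J := h.J_J y hy
  g_J := h.g_J y hy
  τ_ξ := h.τ_ξ y hy
  τ_J := h.τ_J y hy
  add := chartCurv_add Γ y
  smul := chartCurv_smul Γ y
  skew := chartCurv_skew Γ y
  skew' a b c d := h.curv_g hy a b c d
  R_J a b c := h.curv_J hy a b c
  R_ξ a b := h.curv_ξ hy a b
  bianchi a b c := h.bianchi hy a b c
  ricci a b c := by rw [h.curv_τ hy a b c, h.θ_torsion hy]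

end IsWebsterChart

end

/-! ### Local constancy of traces -/

noncomputable section

set_option synthInstance.maxHeartbeats 200000

variable {E : Type*} [NormedAddCommGroup E] [NormedSpace ℝ E]

/-- The trace of an endomorphism of a finite-dimensional normed space, as a continuous linear map. -/
def traceL (E : Type*) [NormedAddCommGroup E] [NormedSpace ℝ E] [FiniteDimensional ℝ E] :
    (E →L[ℝ] E) →L[ℝ] ℝ :=
  LinearMap.toContinuousLinearMap (LinearMap.trace ℝ E ∘ₗ ContinuousLinearMap.coeLM ℝ)

theorem traceL_apply [FiniteDimensional ℝ E] (P : E →L[ℝ] E) :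
    traceL E P = LinearMap.trace ℝ E P.toLinearMap := rfl

theorem traceL_comp_comm [FiniteDimensional ℝ E] (P Q : E →L[ℝ] E) :
    traceL E (P ∘L Q) = traceL E (Q ∘L P) := by
  rw [traceL_apply, traceL_apply]
  exact LinearMap.trace_mul_comm ℝ P.toLinearMap Q.toLinearMap

theorem chartCovEnd_comp {Γ : E → E →L[ℝ] E →L[ℝ] E} {P Q : E → E →L[ℝ] E} {y : E}
    (hP : DifferentiableAt ℝ P y) (hQ : DifferentiableAt ℝ Q y) (u : E) :
    chartCovEnd Γ (fun z ↦ P z ∘L Q z) y u =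
      chartCovEnd Γ P y u ∘L Q y + P y ∘L chartCovEnd Γ Q y u := by
  have h1 : fderiv ℝ (fun z ↦ P z ∘L Q z) y u = P y ∘L fderiv ℝ Q y u + fderiv ℝ P y u ∘L Q y := by
    rw [(hP.hasFDerivAt.clm_comp hQ.hasFDerivAt).fderiv]
    simp
  ext a
  simp only [chartCovEnd, h1, add_apply, sub_apply, ContinuousLinearMap.comp_apply, map_add, map_sub]
  abel

namespace IsWebsterChart

variable {U : Set E} {Γ : E → E →L[ℝ] E →L[ℝ] E} {g : E → E →L[ℝ] E →L[ℝ] ℝ}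
    {ξ : E → E} {J τ : E → E →L[ℝ] E}

theorem covEnd_J (h : IsWebsterChart U Γ g ξ J τ) {y : E} (hy : y ∈ U) (u : E) :
    chartCovEnd Γ J y u = 0 := by
  ext a
  simp only [chartCovEnd, add_apply, sub_apply, ContinuousLinearMap.comp_apply, h.diff_J y hy]
  simp

/-- The trace of a field of endomorphisms that is parallel in the horizontal directions is locally
constant. -/
theorem fderiv_trace_eq_zero [FiniteDimensional ℝ E] (h : IsWebsterChart U Γ g ξ J τ)
    (hH : ∀ y ∈ U, ∃ v, v ≠ 0 ∧ g y (ξ y) v = 0) {P M : E → E →L[ℝ] E} (hP : ContDiffOn ℝ ∞ P U)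
    (hM : ContDiffOn ℝ ∞ M U)
    (hPM : ∀ y ∈ U, ∀ u, chartCovEnd Γ P y u = g y (ξ y) u • M y) {y : E} (hy : y ∈ U) :
    fderiv ℝ (fun z ↦ traceL E (P z)) y = 0 := by
  -- The terms with `Γ` form a commutator and have trace zero, so the differential of the trace is
  -- `tr M` times `θ`.
  have hd (u : E) {z : E} (hz : z ∈ U) :
      g z (ξ z) u * traceL E (M z) = fderiv ℝ (fun z ↦ traceL E (P z)) z u := by
    have h1 : fderiv ℝ (fun z ↦ traceL E (P z)) z u = traceL E (fderiv ℝ P z u) := by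
      have e : HasFDerivAt (fun z ↦ traceL E (P z)) (traceL E ∘L fderiv ℝ P z) z :=
        (traceL E).hasFDerivAt.comp z (h.differentiableAt_of_mem hP hz).hasFDerivAt
      rw [e.fderiv]
      rfl
    have h2 := congrArg (traceL E) (hPM z hz u)
    rw [chartCovEnd, map_sub, map_add, traceL_comp_comm (Γ z u), map_smul, smul_eq_mul] at h2
    rw [h1, ← h2]
    ring
  have hq : DifferentiableAt ℝ (fun z ↦ traceL E (M z)) y :=
    (traceL E).differentiableAt.comp y (h.differentiableAt_of_mem hM hy)
  have hθ (u : E) : DifferentiableAt ℝ (fun z ↦ g z (ξ z) u) y :=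
    ((h.differentiableAt_of_mem h.smooth_g hy).clm_apply
      (h.differentiableAt_of_mem h.smooth_ξ hy)).clm_apply (differentiableAt_const u)
  obtain ⟨v, hv, hv'⟩ := hH y hy
  have hJv : g y (ξ y) (J y v) = 0 := (h.isWebsterPoint hy).θ_J v
  have hs : ContDiffOn ℝ ∞ (fun z ↦ traceL E (P z)) U := (traceL E).contDiff.comp_contDiffOn hP
  -- Closedness of `tr M · θ` on `(v, Jv)`: since `θ` kills both vectors, only `tr M · ω(v, Jv)`
  -- remains, and `ω(v, Jv) = |v|² > 0`.
  have h1 := fderiv_directional_comm (u := v) (v := J y v)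
    ((hs.contDiffAt (h.isOpen.mem_nhds hy)).of_le two_le_infty)
    (by filter_upwards [h.isOpen.mem_nhds hy] with z hz using hd v hz)
    (by filter_upwards [h.isOpen.mem_nhds hy] with z hz using hd (J y v) hz)
  rw [fderiv_fun_mul (hθ _) hq, fderiv_fun_mul (hθ _) hq] at h1
  simp only [add_apply, smul_apply, h.fderiv_θ hy, hv', hJv, smul_eq_mul, zero_mul, zero_add] at h1
  have h2 := h.θ_torsion hy v (J y v)
  rw [map_sub] at h2
  have h3 : 0 < g y (J y v) (J y v) := by
    rw [h.g_J y hy, h.J_J y hy, hv']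
    simpa using h.g_pos y hy v hv
  have h4 : traceL E (M y) = 0 := by
    have h5 : traceL E (M y) * g y (J y v) (J y v) = 0 := by rw [← h2]; linarith
    exact (mul_eq_zero.1 h5).resolve_right h3.ne'
  ext u
  rw [← hd u hy, h4]
  simp

/-- By the Leibniz rule, `∇(τ²) = θ ⊗ (ντ + τν)`. -/
theorem fderiv_trace_sq [FiniteDimensional ℝ E] (h : IsWebsterChart U Γ g ξ J τ)
    (hH : ∀ y ∈ U, ∃ v, v ≠ 0 ∧ g y (ξ y) v = 0) {y : E} (hy : y ∈ U) :
    fderiv ℝ (fun z ↦ traceL E (τ z ∘L τ z)) y = 0 := by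
  refine h.fderiv_trace_eq_zero hH (M := fun z ↦ nu Γ ξ τ z ∘L τ z + τ z ∘L nu Γ ξ τ z)
    (h.smooth_τ.clm_comp h.smooth_τ)
    ((h.smooth_nu.clm_comp h.smooth_τ).add (h.smooth_τ.clm_comp h.smooth_nu)) (fun z hz u ↦ ?_) hy
  have hτ := h.differentiableAt_of_mem h.smooth_τ hz
  rw [chartCovEnd_comp hτ hτ, h.covEnd_τ hz]
  ext a
  simp

/-- Besides `∇J = 0` and `∇τ = θ ⊗ ν`, this uses `∇ν = θ ⊗ ∇_ξ ν`, which comes from `Dν_H`; so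
`∇(νJτ)` is again `θ` times an endomorphism. -/
theorem fderiv_trace_deriv [FiniteDimensional ℝ E] (h : IsWebsterChart U Γ g ξ J τ)
    (hH : ∀ y ∈ U, ∃ v, v ≠ 0 ∧ g y (ξ y) v = 0) {y : E} (hy : y ∈ U) :
    fderiv ℝ (fun z ↦ traceL E (nu Γ ξ τ z ∘L J z ∘L τ z)) y = 0 := by
  have hμ : ContDiffOn ℝ ∞ (fun z ↦ chartCovEnd Γ (nu Γ ξ τ) z (ξ z)) U :=
    contDiffOn_chartCovEnd h.isOpen h.smooth_Γ h.smooth_nu h.smooth_ξ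
  refine h.fderiv_trace_eq_zero hH (M := fun z ↦ chartCovEnd Γ (nu Γ ξ τ) z (ξ z) ∘L (J z ∘L τ z)
      + nu Γ ξ τ z ∘L (J z ∘L nu Γ ξ τ z))
    (h.smooth_nu.clm_comp (h.smooth_J.clm_comp h.smooth_τ))
    ((hμ.clm_comp (h.smooth_J.clm_comp h.smooth_τ)).add
      (h.smooth_nu.clm_comp (h.smooth_J.clm_comp h.smooth_nu))) (fun z hz u ↦ ?_) hy
  have hτ := h.differentiableAt_of_mem h.smooth_τ hz
  have hJ := h.differentiableAt_of_mem h.smooth_J hz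
  have hν := h.differentiableAt_of_mem h.smooth_nu hz
  have h1 : chartCovEnd Γ (nu Γ ξ τ) z u =
      g z (ξ z) u • chartCovEnd Γ (nu Γ ξ τ) z (ξ z) := by
    have h2 := (h.isWebsterPoint hz).Dν_H (b := u - g z (ξ z) u • ξ z) (by simp [h.g_ξ_ξ z hz])
    have h3 : chartCovEnd Γ (nu Γ ξ τ) z (u - g z (ξ z) u • ξ z) =
        chartCovEnd Γ (nu Γ ξ τ) z u - g z (ξ z) u • chartCovEnd Γ (nu Γ ξ τ) z (ξ z) := by
      ext a
      simp only [chartCovEnd, map_sub, map_smul, add_apply, sub_apply, smul_apply,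
        ContinuousLinearMap.comp_apply]
      module
    rw [h3] at h2
    exact sub_eq_zero.1 h2
  rw [chartCovEnd_comp hν (hJ.clm_comp hτ), chartCovEnd_comp hJ hτ, h.covEnd_τ hz, h.covEnd_J hz,
    h1]
  ext a
  simp

end IsWebsterChart

end

/-! ### The modified connection and the local symmetry in a chart -/

noncomputable section

set_option synthInstance.maxHeartbeats 200000

variable {E : Type*} [NormedAddCommGroup E] [NormedSpace ℝ E]

namespace IsWebsterChart

variable {U : Set E} {Γ : E → E →L[ℝ] E →L[ℝ] E} {g : E → E →L[ℝ] E →L[ℝ] ℝ}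
    {ξ : E → E} {J τ : E → E →L[ℝ] E}

theorem mono (h : IsWebsterChart U Γ g ξ J τ) {V : Set E} (hV : IsOpen V) (hVU : V ⊆ U) :
    IsWebsterChart V Γ g ξ J τ where
  isOpen := hV
  smooth_Γ := h.smooth_Γ.mono hVU
  smooth_g := h.smooth_g.mono hVU
  smooth_ξ := h.smooth_ξ.mono hVU
  smooth_J := h.smooth_J.mono hVU
  smooth_τ := h.smooth_τ.mono hVU
  g_symm y hy := h.g_symm y (hVU hy)
  g_pos y hy := h.g_pos y (hVU hy)
  g_ξ_ξ y hy := h.g_ξ_ξ y (hVU hy)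
  J_J y hy := h.J_J y (hVU hy)
  g_J y hy := h.g_J y (hVU hy)
  τ_ξ y hy := h.τ_ξ y (hVU hy)
  τ_J y hy := h.τ_J y (hVU hy)
  diff_g y hy := h.diff_g y (hVU hy)
  diff_ξ y hy := h.diff_ξ y (hVU hy)
  diff_J y hy := h.diff_J y (hVU hy)
  diff_τ_H y hy := h.diff_τ_H y (hVU hy)
  torsion y hy := h.torsion y (hVU hy)

/-- The structure tensors together with the torsion. -/
def tensors (g : E → E →L[ℝ] E →L[ℝ] ℝ) (ξ : E → E) (J τ : E → E →L[ℝ] E) : TensorFields E Bool where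
  g := g
  P i := if i then J else τ
  ξ := ξ

/-- The connection `Γ + c θ ⊗ J`. -/
def gauge (Γ : E → E →L[ℝ] E →L[ℝ] E) (g : E → E →L[ℝ] E →L[ℝ] ℝ) (ξ : E → E) (J : E → E →L[ℝ] E)
    (c : ℝ) (y : E) : E →L[ℝ] E →L[ℝ] E :=
  Γ y + c • (g y (ξ y)).smulRight (J y)

theorem gauge_apply (c : ℝ) (y u a : E) :
    gauge Γ g ξ J c y u a = Γ y u a + (c * g y (ξ y) u) • J y a := by
  simp [gauge, smul_smul]

theorem smooth_gauge (h : IsWebsterChart U Γ g ξ J τ) (c : ℝ) :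
    ContDiffOn ℝ ∞ (gauge Γ g ξ J c) U :=
  h.smooth_Γ.add (((h.smooth_g.clm_apply h.smooth_ξ).smulRight h.smooth_J).const_smul c)

/-- `J` is skew for `g`, commutes with itself and kills `ξ`, so these tensors stay parallel. For
`τ`, the commutator `[J, τ] = 2Jτ` gives `2c θ ⊗ Jτ`, which cancels `∇τ = -2c θ ⊗ Jτ`. -/
theorem isParallelAt_gauge (h : IsWebsterChart U Γ g ξ J τ) {c : ℝ} {y : E} (hy : y ∈ U)
    (hc : ∀ x, nu Γ ξ τ y x = (-2 * c) • J y (τ y x)) :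
    (tensors g ξ J τ).IsParallelAt (gauge Γ g ξ J c) y where
  diff_g := h.differentiableAt_of_mem h.smooth_g hy
  diff_P i := by
    cases i
    · exact h.differentiableAt_of_mem h.smooth_τ hy
    · exact h.differentiableAt_of_mem h.smooth_J hy
  diff_ξ := h.differentiableAt_of_mem h.smooth_ξ hy
  g u a b := by
    change fderiv ℝ g y u a b = g y _ b + g y a _
    rw [h.diff_g y hy, gauge_apply, gauge_apply]
    simp only [map_add, map_smul, add_apply, smul_apply, h.g_J y hy, smul_eq_mul]
    ring
  P i u a := by
    cases i
    · change fderiv ℝ τ y u a = τ y _ - gauge Γ g ξ J c y u (τ y a)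
      rw [h.diff_τ hy, gauge_apply, gauge_apply, hc]
      simp only [map_add, map_smul, h.τ_J y hy]
      module
    · change fderiv ℝ J y u a = J y _ - gauge Γ g ξ J c y u (J y a)
      rw [h.diff_J y hy, gauge_apply, gauge_apply]
      simp only [map_add, map_smul]
      abel
  ξ u := by
    change fderiv ℝ ξ y u = -gauge Γ g ξ J c y u (ξ y)
    rw [h.diff_ξ y hy, gauge_apply, (h.isWebsterPoint hy).J_ξ]
    simp

theorem chartTorsion_gauge (h : IsWebsterChart U Γ g ξ J τ) (c : ℝ) {y : E} (hy : y ∈ U) (a b : E) :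
    chartTorsion (gauge Γ g ξ J c) y a b = websterTorsion (g y) (ξ y) (J y) (τ y) a b
      + (c * g y (ξ y) a) • J y b - (c * g y (ξ y) b) • J y a := by
  rw [← h.torsion y hy, chartTorsion, gauge_apply, gauge_apply]
  abel

/-- As `∇J = 0` and `J` commutes with itself, the added term `c θ ⊗ J` changes the curvature by `c
dθ ⊗ J` and nothing quadratic. -/
theorem chartCurv_gauge (h : IsWebsterChart U Γ g ξ J τ) (c : ℝ) {y : E} (hy : y ∈ U)
    (a b z : E) :
    chartCurv (gauge Γ g ξ J c) y a b z =
      chartCurv Γ y a b z + (c * g y (J y a) b) • J y z := by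
  have hΓ := h.differentiableAt_of_mem h.smooth_Γ hy
  have hJ := h.differentiableAt_of_mem h.smooth_J hy
  have hΓ' := h.differentiableAt_of_mem (h.smooth_gauge c) hy
  have hθ (u : E) : DifferentiableAt ℝ (fun z ↦ g z (ξ z) u) y :=
    ((h.differentiableAt_of_mem h.smooth_g hy).clm_apply
      (h.differentiableAt_of_mem h.smooth_ξ hy)).clm_apply (differentiableAt_const u)
  have key (u v w : E) : fderiv ℝ (gauge Γ g ξ J c) y u v w = fderiv ℝ Γ y u v w
      + (c * g y (ξ y) v) • (J y (Γ y u w) - Γ y u (J y w))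
      + (c * g y (ξ y) (Γ y u v)) • J y w := by
    have e1 := hΓ.clm_apply (differentiableAt_const v)
    have e2 := e1.clm_apply (differentiableAt_const w)
    have e3 := hJ.clm_apply (differentiableAt_const w)
    rw [← fderiv_apply_const hΓ', ← fderiv_apply_const (hΓ'.clm_apply (differentiableAt_const v))]
    simp only [gauge_apply]
    rw [fderiv_fun_add e2 (((hθ v).const_mul c).fun_smul e3), add_apply,
      fderiv_fun_smul ((hθ v).const_mul c) e3, fderiv_const_mul (hθ v)]
    simp only [add_apply, smul_apply, ContinuousLinearMap.smulRight_apply, h.fderiv_θ hy,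
      fderiv_apply_const e1, fderiv_apply_const hΓ, fderiv_apply_const hJ, h.diff_J y hy,
      smul_eq_mul]
    abel
  rw [← h.θ_torsion hy]
  simp only [chartCurv, add_apply, sub_apply, ContinuousLinearMap.comp_apply, key, gauge_apply,
    map_add, map_sub, map_smul]
  module

/-- The involution `-1 + 2 θ ⊗ ξ`. -/
def involution {g : E →L[ℝ] E →L[ℝ] ℝ} {ξ : E} (hξ : g ξ ξ = 1) : E ≃L[ℝ] E :=
  have hs (a : E) : -(-a + (2 * g ξ a) • ξ) + (2 * g ξ (-a + (2 * g ξ a) • ξ)) • ξ = a := by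
    simp only [map_add, map_neg, map_smul, hξ, smul_eq_mul, mul_one]
    module
  ContinuousLinearEquiv.equivOfInverse
    (-ContinuousLinearMap.id ℝ E + (2 : ℝ) • (g ξ).smulRight ξ)
    (-ContinuousLinearMap.id ℝ E + (2 : ℝ) • (g ξ).smulRight ξ)
    (fun a ↦ by simpa [smul_smul] using hs a) (fun a ↦ by simpa [smul_smul] using hs a)

theorem involution_apply {g : E →L[ℝ] E →L[ℝ] ℝ} {ξ : E} (hξ : g ξ ξ = 1) (a : E) :
    involution hξ a = -a + (2 * g ξ a) • ξ := by
  simp [involution, smul_smul]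

theorem intertwines_involution (h : IsWebsterChart U Γ g ξ J τ) {x : E} (hx : x ∈ U) :
    (tensors g ξ J τ).Intertwines x x (involution (h.g_ξ_ξ x hx)) := by
  have hp := h.isWebsterPoint hx
  refine ⟨fun a b ↦ ?_, fun i a ↦ ?_, ?_⟩
  · change g x (involution (h.g_ξ_ξ x hx) a) (involution (h.g_ξ_ξ x hx) b) = g x a b
    simp only [involution_apply, map_add, map_neg, map_smul, add_apply, neg_apply, smul_apply,
      hp.g_ξ_ξ, smul_eq_mul, hp.g_symm a (ξ x)]
    ring
  · cases i
    · change involution (h.g_ξ_ξ x hx) (τ x a) = τ x (involution (h.g_ξ_ξ x hx) a)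
      simp [involution_apply, hp.τ_ξ, hp.θ_τ]
    · change involution (h.g_ξ_ξ x hx) (J x a) = J x (involution (h.g_ξ_ξ x hx) a)
      simp [involution_apply, hp.J_ξ, hp.θ_J]
  · change involution (h.g_ξ_ξ x hx) (ξ x) = ξ x
    rw [involution_apply, hp.g_ξ_ξ]
    module

/-- The scalars that determine the curvature are locally constant. -/
theorem exists_constants [FiniteDimensional ℝ E] (h : IsWebsterChart U Γ g ξ J τ)
    (hU : IsPreconnected U) {d : ℕ} (hfin : Module.finrank ℝ E = 2 * d + 1)
    (hframe : ∀ y ∈ U, ∃ e : Fin (2 * d) → E, (∀ i, g y (ξ y) (e i) = 0) ∧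
      ∀ i j, g y (e i) (e j) = if i = j then 1 else 0) (hτ : ∀ y ∈ U, τ y ≠ 0) :
    ∃ l c : ℝ, ∀ y ∈ U, (∀ x, nu Γ ξ τ y x = (-2 * c) • J y (τ y x)) ∧
      ∀ X Y Z V, -g y (chartCurv Γ y X Y Z) V =
        IsWebsterPoint.curvatureForm (g y) (ξ y) (J y) (τ y) l c X Y Z V := by
  rcases U.eq_empty_or_nonempty with rfl | ⟨x₀, hx₀⟩
  · exact ⟨0, 0, fun y hy ↦ absurd hy (Set.notMem_empty y)⟩
  choose! e he using hframe
  have hm (y) (hy : y ∈ U) :=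
    (h.isWebsterPoint hy).exists_model hfin (he y hy).1 (he y hy).2 (hτ y hy)
  have hd : d ≠ 0 := (hm x₀ hx₀).1
  have hd' : (0 : ℝ) < d := Nat.cast_pos.2 (Nat.pos_of_ne_zero hd)
  have hH (y) (hy : y ∈ U) : ∃ v, v ≠ 0 ∧ g y (ξ y) v = 0 := by
    refine ⟨e y ⟨0, by omega⟩, fun h0 ↦ ?_, (he y hy).1 _⟩
    have := (he y hy).2 ⟨0, by omega⟩ ⟨0, by omega⟩
    simp [h0] at this
  have hs1 : ContDiffOn ℝ ∞ (fun z ↦ traceL E (τ z ∘L τ z)) U :=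
    (traceL E).contDiff.comp_contDiffOn (h.smooth_τ.clm_comp h.smooth_τ)
  have hs2 : ContDiffOn ℝ ∞ (fun z ↦ traceL E (nu Γ ξ τ z ∘L J z ∘L τ z)) U :=
    (traceL E).contDiff.comp_contDiffOn
      (h.smooth_nu.clm_comp (h.smooth_J.clm_comp h.smooth_τ))
  have hc1 {y} (hy : y ∈ U) : traceL E (τ y ∘L τ y) = traceL E (τ x₀ ∘L τ x₀) :=
    h.isOpen.is_const_of_fderiv_eq_zero hU (hs1.differentiableOn (by simp))
      (fun y hy ↦ h.fderiv_trace_sq hH hy) hy hx₀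
  have hc2 {y} (hy : y ∈ U) : traceL E (nu Γ ξ τ y ∘L J y ∘L τ y) =
      traceL E (nu Γ ξ τ x₀ ∘L J x₀ ∘L τ x₀) :=
    h.isOpen.is_const_of_fderiv_eq_zero hU (hs2.differentiableOn (by simp))
      (fun y hy ↦ h.fderiv_trace_deriv hH hy) hy hx₀
  obtain ⟨-, l, c, hl, hlτ, hcν, -, -⟩ := hm x₀ hx₀
  refine ⟨l, c, fun y hy ↦ ?_⟩
  obtain ⟨-, l', c', hl', hlτ', hcν', -, hR⟩ := hm y hy
  -- The traces are constant on `U`. The first determines `l²`, hence `l > 0`; being non-zero, it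
  -- then determines `c` from the second.
  have e1 := (h.isWebsterPoint hy).trace_sq hfin hlτ'
  have e2 := (h.isWebsterPoint hx₀).trace_sq hfin hlτ
  have e3 := (h.isWebsterPoint hy).trace_deriv hcν'
  have e4 := (h.isWebsterPoint hx₀).trace_deriv hcν
  rw [← traceL_apply] at e1 e2
  rw [← traceL_apply, ← traceL_apply] at e3 e4
  rw [hc1 hy] at e1 e3
  rw [hc2 hy] at e3
  have hll : l' = l := by
    have : 2 * d * (l' ^ 2 - l ^ 2) = 0 := by rw [e2] at e1; linarith
    have h5 : l' ^ 2 = l ^ 2 := by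
      rcases mul_eq_zero.1 this with h6 | h6
      · exact absurd h6 (by positivity)
      · linarith
    exact (pow_left_inj₀ hl'.le hl.le two_ne_zero).1 h5
  have hcc : c' = c := by
    have hpos : traceL E (τ x₀ ∘L τ x₀) ≠ 0 := by rw [e2]; positivity
    have h5 : (-2 * c') = -2 * c := mul_right_cancel₀ hpos (e3.symm.trans e4)
    linarith
  subst hll hcc
  exact ⟨hcν', hR⟩

/-- The local symmetry in a chart. -/
theorem exists_local_symmetry [FiniteDimensional ℝ E] (h : IsWebsterChart U Γ g ξ J τ) {d : ℕ}
    (hfin : Module.finrank ℝ E = 2 * d + 1)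
    (hframe : ∀ y ∈ U, ∃ e : Fin (2 * d) → E, (∀ i, g y (ξ y) (e i) = 0) ∧
      ∀ i j, g y (e i) (e j) = if i = j then 1 else 0) (hτ : ∀ y ∈ U, τ y ≠ 0)
    {x₀ : E} (hx₀ : x₀ ∈ U) :
    ∃ ψ : OpenPartialHomeomorph E E, x₀ ∈ ψ.source ∧ ψ.source ⊆ U ∧ ψ.target ⊆ U ∧
      ContDiffOn ℝ ∞ ψ ψ.source ∧ ContDiffOn ℝ ∞ ψ.symm ψ.target ∧ ψ x₀ = x₀ ∧
      (∀ u, g x₀ (ξ x₀) u = 0 → fderiv ℝ ψ x₀ u = -u) ∧ ∀ x ∈ ψ.source,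
        (∀ a b, g (ψ x) (fderiv ℝ ψ x a) (fderiv ℝ ψ x b) = g x a b) ∧
        fderiv ℝ ψ x (ξ x) = ξ (ψ x) := by
  -- On a ball, which is connected, the scalars `l` and `c` are true constants.
  obtain ⟨r, hr, hrU⟩ := Metric.isOpen_iff.1 h.isOpen x₀ hx₀
  have hB := h.mono Metric.isOpen_ball hrU
  have hx₀B : x₀ ∈ Metric.ball x₀ r := Metric.mem_ball_self hr
  obtain ⟨l, c, hlc⟩ := hB.exists_constants (convex_ball x₀ r).isPreconnected hfin
    (fun y hy ↦ hframe y (hrU hy)) (fun y hy ↦ hτ y (hrU hy))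
  have hI {x y : E} {f : E →L[ℝ] E} (hf : (tensors g ξ J τ).Intertwines x y f) :
      (∀ a b, g y (f a) (f b) = g x a b) ∧ f (ξ x) = ξ y ∧ (∀ a, f (J x a) = J y (f a)) ∧
        ∀ a, f (τ x a) = τ y (f a) :=
    ⟨hf.g, hf.ξ, hf.P true, hf.P false⟩
  obtain ⟨ψ, h1, h2, h3, h4, h5, h6, h7, h8⟩ :=
    TensorFields.exists_local_automorphism (S := tensors g ξ J τ) (Γ := gauge Γ g ξ J c)
      Metric.isOpen_ball (hB.smooth_gauge c) hx₀B
      (fun x hx ↦ hB.isParallelAt_gauge hx (hlc x hx).1)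
      (fun x hx y hy f hf hI' a b ↦ by
        obtain ⟨hIg, hIξ, hIJ, hIτ⟩ := hI hI'
        rw [hB.chartTorsion_gauge c hx, hB.chartTorsion_gauge c hy]
        simp only [websterTorsion, map_add, map_sub, map_smul, ← hIξ, ← hIJ, ← hIτ, hIg])
      (fun x hx y hy f hf hI' a b z ↦ by
        obtain ⟨hIg, hIξ, hIJ, hIτ⟩ := hI hI'
        rw [hB.chartCurv_gauge c hx, hB.chartCurv_gauge c hy, map_add, map_smul, ← hIJ, ← hIJ, hIg]
        congr 1
        -- The curvature endomorphism is known through the form `-g(R X Y Z, V)`. As `f` is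
        -- invertible, test vectors may be taken in its image, where naturality of the form applies.
        refine (hB.isWebsterPoint hy).eq_of_forall fun w ↦ ?_
        obtain ⟨u, hu⟩ := hf
        obtain ⟨w', rfl⟩ : ∃ w', f w' = w := ⟨(↑u⁻¹ : E →L[ℝ] E) w, by
          rw [← hu]; exact congrArg (fun A : E →L[ℝ] E ↦ A w) u.mul_inv⟩
        have e1 := (hlc x hx).2 a b z w'
        have e2 := (hlc y hy).2 (f a) (f b) (f z) (f w')
        rw [IsWebsterPoint.curvatureForm_map hIg hIξ hIJ hIτ] at e2
        rw [hIg]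
        linarith)
      (involution (hB.g_ξ_ξ x₀ hx₀B)) (hB.intertwines_involution hx₀B)
  refine ⟨ψ, h1, h2.trans hrU, h3.trans hrU, h4, h5, h6, fun u hu ↦ ?_, fun x hx ↦
    ⟨(h8 x hx).g, (h8 x hx).ξ⟩⟩
  rw [h7]
  change involution (hB.g_ξ_ξ x₀ hx₀B) u = -u
  rw [involution_apply, hu]
  simp

end IsWebsterChart

end

/-! ### Vector fields and Lie brackets in a chart -/

noncomputable section

set_option synthInstance.maxHeartbeats 200000

section ChartRepresentation

variable {E : Type*} [NormedAddCommGroup E] [NormedSpace ℝ E]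
  {M : Type*} [TopologicalSpace M] [ChartedSpace E M] [IsManifold 𝓘(ℝ, E) ∞ M]

/-- Tangent vectors at `x`, in the coordinates of the chart at `p`. -/
def toModel (p x : M) : TangentSpace 𝓘(ℝ, E) x →L[ℝ] E :=
  (trivializationAt E (TangentSpace 𝓘(ℝ, E)) p).continuousLinearMapAt ℝ x

/-- The tangent vector at `x` with given coordinates in the chart at `p`. -/
def ofModel (p x : M) : E →L[ℝ] TangentSpace 𝓘(ℝ, E) x :=
  (trivializationAt E (TangentSpace 𝓘(ℝ, E)) p).symmL ℝ x

theorem toModel_ofModel {p x : M} (hx : x ∈ (chartAt E p).source) (a : E) :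
    toModel p x (ofModel p x a) = a :=
  (trivializationAt E (TangentSpace 𝓘(ℝ, E)) p).continuousLinearMapAt_symmL (by simpa using hx) a

theorem ofModel_toModel {p x : M} (hx : x ∈ (chartAt E p).source) (v : TangentSpace 𝓘(ℝ, E) x) :
    ofModel p x (toModel p x v) = v :=
  (trivializationAt E (TangentSpace 𝓘(ℝ, E)) p).symmL_continuousLinearMapAt (by simpa using hx) v

theorem toModel_eq_mfderiv {p x : M} (hx : x ∈ (chartAt E p).source) :
    toModel p x = mfderiv 𝓘(ℝ, E) 𝓘(ℝ, E) (chartAt E p) x :=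
  TangentBundle.continuousLinearMapAt_trivializationAt (I := 𝓘(ℝ, E)) hx

theorem ofModel_eq_mfderiv {p : M} {z : E} (hz : z ∈ (chartAt E p).target) :
    ofModel (E := E) p ((chartAt E p).symm z) =
      mfderiv 𝓘(ℝ, E) 𝓘(ℝ, E) (chartAt E p).symm z := by
  have h := TangentBundle.symmL_trivializationAt (I := 𝓘(ℝ, E)) ((chartAt E p).map_target hz)
  simp only [mfld_simps, mfderivWithin_univ] at h
  -- The derivatives at `w` and `w'` live on different tangent spaces. Both are read as maps of `E`,
  -- so that the equality of base points can be substituted.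
  have h2 : ∀ w w' : E, w = w' →
      (mfderiv 𝓘(ℝ, E) 𝓘(ℝ, E) (chartAt E p).symm w : E →L[ℝ] E) =
        (mfderiv 𝓘(ℝ, E) 𝓘(ℝ, E) (chartAt E p).symm w' : E →L[ℝ] E) := by
    rintro w _ rfl
    rfl
  exact h.trans (h2 _ _ ((chartAt E p).right_inv hz))

/-- A vector field, in the coordinates of the chart at `p`. -/
def chartRep (p : M) (V : ∀ x : M, TangentSpace 𝓘(ℝ, E) x) (z : E) : E :=
  toModel p ((chartAt E p).symm z) (V ((chartAt E p).symm z))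

theorem chartRep_chartAt {p x : M} (hx : x ∈ (chartAt E p).source)
    (V : ∀ x : M, TangentSpace 𝓘(ℝ, E) x) : chartRep p V (chartAt E p x) = toModel p x (V x) := by
  rw [chartRep, (chartAt E p).left_inv hx]

theorem contMDiffAt_chartAt_symm {p x : M} (hx : x ∈ (chartAt E p).source) :
    ContMDiffAt 𝓘(ℝ, E) 𝓘(ℝ, E) ∞ (chartAt E p).symm (chartAt E p x) :=
  (contMDiffOn_chart_symm (I := 𝓘(ℝ, E)) (x := p)).contMDiffAt
    ((chartAt E p).open_target.mem_nhds ((chartAt E p).map_source hx))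

theorem contMDiffAt_chartAt {p x : M} (hx : x ∈ (chartAt E p).source) :
    ContMDiffAt 𝓘(ℝ, E) 𝓘(ℝ, E) ∞ (chartAt E p) x :=
  (contMDiffOn_chart (I := 𝓘(ℝ, E)) (x := p)).contMDiffAt
    ((chartAt E p).open_source.mem_nhds hx)

theorem chartRep_comp_chartAt {p x : M} (hx : x ∈ (chartAt E p).source)
    (V : ∀ x : M, TangentSpace 𝓘(ℝ, E) x) : (fun y ↦ chartRep p V (chartAt E p y)) =ᶠ[𝓝 x]
      fun y ↦ (trivializationAt E (TangentSpace 𝓘(ℝ, E)) p ⟨y, V y⟩).2 := by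
  filter_upwards [(chartAt E p).open_source.mem_nhds hx] with y hy
  rw [chartRep_chartAt hy]
  exact Trivialization.continuousLinearMapAt_apply_of_mem _ _ (by simpa using hy) _

theorem contDiffAt_chartRep {p x : M} (hx : x ∈ (chartAt E p).source)
    {V : ∀ x : M, TangentSpace 𝓘(ℝ, E) x} :
    ContDiffAt ℝ ∞ (chartRep p V) (chartAt E p x) ↔
    ContMDiffAt 𝓘(ℝ, E) (𝓘(ℝ, E).prod 𝓘(ℝ, E)) ∞ (fun y ↦ TotalSpace.mk' E y (V y)) x := by
  rw [Trivialization.contMDiffAt_section_iff (e := trivializationAt E (TangentSpace 𝓘(ℝ, E)) p)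
    (by simpa using hx), ← (chartRep_comp_chartAt hx V).contMDiffAt_iff, ← contMDiffAt_iff_contDiffAt]
  refine ⟨fun h ↦ h.comp x (contMDiffAt_chartAt hx), fun h ↦ ?_⟩
  have h1 := h.comp_of_eq (contMDiffAt_chartAt_symm hx) ((chartAt E p).left_inv hx)
  refine h1.congr_of_eventuallyEq ?_
  filter_upwards [(chartAt E p).open_target.mem_nhds ((chartAt E p).map_source hx)] with z hz
  simp [(chartAt E p).right_inv hz]

theorem differentiableAt_chartRep {p x : M} (hx : x ∈ (chartAt E p).source)
    {V : ∀ x : M, TangentSpace 𝓘(ℝ, E) x} :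
    DifferentiableAt ℝ (chartRep p V) (chartAt E p x) ↔
    MDifferentiableAt 𝓘(ℝ, E) (𝓘(ℝ, E).prod 𝓘(ℝ, E)) (fun y ↦ TotalSpace.mk' E y (V y)) x := by
  rw [Trivialization.mdifferentiableAt_section_iff (e := trivializationAt E (TangentSpace 𝓘(ℝ, E)) p)
    _ _ (by simpa using hx), ← (chartRep_comp_chartAt hx V).mdifferentiableAt_iff,
    ← mdifferentiableAt_iff_differentiableAt]
  refine ⟨fun h ↦ h.comp x ((contMDiffAt_chartAt hx).mdifferentiableAt (by simp)), fun h ↦ ?_⟩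
  have h1 := MDifferentiableAt.comp_of_eq
    (f := (chartAt E p).symm) _ h
    ((contMDiffAt_chartAt_symm hx).mdifferentiableAt (by simp)) ((chartAt E p).left_inv hx)
  refine h1.congr_of_eventuallyEq ?_
  filter_upwards [(chartAt E p).open_target.mem_nhds ((chartAt E p).map_source hx)] with z hz
  simp [(chartAt E p).right_inv hz]

/-- The derivative of a function along a tangent vector, in coordinates. -/
theorem mvfderiv_eq_fderiv {F : Type*} [NormedAddCommGroup F] [NormedSpace ℝ F]
    {p x : M} (hx : x ∈ (chartAt E p).source) {f : M → F} {f' : E → F}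
    (hf : DifferentiableAt ℝ f' (chartAt E p x))
    (hff : ∀ z ∈ (chartAt E p).target, f' z = f ((chartAt E p).symm z))
    (u : TangentSpace 𝓘(ℝ, E) x) :
    mvfderiv 𝓘(ℝ, E) f x u = fderiv ℝ f' (chartAt E p x) (toModel p x u) := by
  have h1 : f =ᶠ[𝓝 x] f' ∘ chartAt E p := by
    filter_upwards [(chartAt E p).open_source.mem_nhds hx] with y hy
    simp [hff _ ((chartAt E p).map_source hy), (chartAt E p).left_inv hy]
  rw [mvfderiv, h1.mfderiv_eq, mfderiv_comp x hf.mdifferentiableAt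
    ((contMDiffAt_chartAt hx).mdifferentiableAt (by simp)), toModel_eq_mfderiv hx, mfderiv_eq_fderiv]
  rfl

theorem mlieBracket_model (V W : ∀ z : E, TangentSpace 𝓘(ℝ, E) z) (z : E) :
    mlieBracket 𝓘(ℝ, E) V W z = lieBracket ℝ V W z := by
  have h := mlieBracketWithin_eq_lieBracketWithin (V := V) (W := W) (s := Set.univ)
  rw [mlieBracketWithin_univ] at h
  exact (congrFun h z).trans (congrFun (lieBracketWithin_univ (𝕜 := ℝ) (V := V) (W := W)) z)

/-- The Lie bracket of vector fields, in coordinates. -/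
theorem toModel_mlieBracket [CompleteSpace E] {p x : M} (hx : x ∈ (chartAt E p).source)
    {V W : ∀ x : M, TangentSpace 𝓘(ℝ, E) x}
    (hV : DifferentiableAt ℝ (chartRep p V) (chartAt E p x))
    (hW : DifferentiableAt ℝ (chartRep p W) (chartAt E p x)) :
    toModel p x (mlieBracket 𝓘(ℝ, E) V W x) =
      fderiv ℝ (chartRep p W) (chartAt E p x) (toModel p x (V x)) -
        fderiv ℝ (chartRep p V) (chartAt E p x) (toModel p x (W x)) := by
  -- The coordinate representative of a field is its pullback by the inverse chart, and the bracket
  -- commutes with pullbacks.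
  have key : ∀ z ∈ (chartAt E p).target, ∀ X : ∀ x : M, TangentSpace 𝓘(ℝ, E) x,
      mpullback 𝓘(ℝ, E) 𝓘(ℝ, E) (chartAt E p).symm X z = chartRep p X z := by
    intro z hz X
    have hy := (chartAt E p).map_target hz
    rw [mpullback_apply, chartRep, ← ofModel_eq_mfderiv hz]
    have h : ofModel p ((chartAt E p).symm z) =
      ((ContinuousLinearEquiv.equivOfInverse (ofModel p ((chartAt E p).symm z))
        (toModel p ((chartAt E p).symm z)) (toModel_ofModel hy) (ofModel_toModel hy) : _ ≃L[ℝ] _)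
        : E →L[ℝ] TangentSpace 𝓘(ℝ, E) ((chartAt E p).symm z)) := rfl
    rw [h]
    erw [ContinuousLinearMap.inverse_equiv]
    rfl
  have hz := (chartAt E p).map_source hx
  have hev : ∀ X : ∀ x : M, TangentSpace 𝓘(ℝ, E) x,
      mpullback 𝓘(ℝ, E) 𝓘(ℝ, E) (chartAt E p).symm X =ᶠ[𝓝 (chartAt E p x)] chartRep p X := by
    intro X
    filter_upwards [(chartAt E p).open_target.mem_nhds hz] with z hz using key z hz X
  have hV' := (differentiableAt_chartRep hx).1 hV
  have hW' := (differentiableAt_chartRep hx).1 hW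
  have hxx := (chartAt E p).left_inv hx
  have : IsManifold 𝓘(ℝ, E) (minSmoothness ℝ 2) M := .of_le (n := ∞) (by simp [two_le_infty])
  have h1 := mpullback_mlieBracket (V := V) (W := W) (by rwa [hxx]) (by rwa [hxx])
    (contMDiffAt_chartAt_symm hx) (by simp [two_le_infty])
  rw [key _ hz, chartRep_chartAt hx] at h1
  rw [h1, (hev V).mlieBracket_vectorField_eq (hev W), ← chartRep_chartAt hx,
    ← chartRep_chartAt hx]
  exact mlieBracket_model _ _ _

end ChartRepresentation

end

/-! ### Christoffel symbols -/

noncomputable section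

set_option synthInstance.maxHeartbeats 200000
set_option linter.unusedSectionVars false

section ChristoffelSymbols

variable {E : Type*} [NormedAddCommGroup E] [NormedSpace ℝ E]
  {M : Type*} [TopologicalSpace M] [ChartedSpace E M] [IsManifold 𝓘(ℝ, E) ∞ M]

/-- The flat connection of the chart at `p`. -/
def flatConnection (p : M) (Y : ∀ x : M, TangentSpace 𝓘(ℝ, E) x) (x : M) :
    TangentSpace 𝓘(ℝ, E) x →L[ℝ] TangentSpace 𝓘(ℝ, E) x :=
  ofModel p x ∘L fderiv ℝ (chartRep p Y) (chartAt E p x) ∘L toModel p x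

theorem flatConnection_apply (p : M) (Y : ∀ x : M, TangentSpace 𝓘(ℝ, E) x) (x : M)
    (u : TangentSpace 𝓘(ℝ, E) x) : flatConnection p Y x u =
      ofModel p x (fderiv ℝ (chartRep p Y) (chartAt E p x) (toModel p x u)) := rfl

theorem differentiableAt_comp_chartAt_symm {F : Type*} [NormedAddCommGroup F] [NormedSpace ℝ F]
    {p x : M} (hx : x ∈ (chartAt E p).source) {f : M → F} (hf : MDifferentiableAt 𝓘(ℝ, E) 𝓘(ℝ, F) f x) :
    DifferentiableAt ℝ (fun z ↦ f ((chartAt E p).symm z)) (chartAt E p x) :=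
  mdifferentiableAt_iff_differentiableAt.1 <| MDifferentiableAt.comp_of_eq
    (f := (chartAt E p).symm) _ hf
    ((contMDiffAt_chartAt_symm hx).mdifferentiableAt (by simp)) ((chartAt E p).left_inv hx)

theorem contDiffAt_comp_chartAt_symm {F : Type*} [NormedAddCommGroup F] [NormedSpace ℝ F]
    {p x : M} (hx : x ∈ (chartAt E p).source) {f : M → F} (hf : ContMDiffAt 𝓘(ℝ, E) 𝓘(ℝ, F) ∞ f x) :
    ContDiffAt ℝ ∞ (fun z ↦ f ((chartAt E p).symm z)) (chartAt E p x) :=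
  contMDiffAt_iff_contDiffAt.1 <| ContMDiffAt.comp_of_eq
    (f := (chartAt E p).symm) hf (contMDiffAt_chartAt_symm hx) ((chartAt E p).left_inv hx)

/-- A reference connection over the chart domain: the difference of two covariant derivatives is
tensorial, and this difference defines the Christoffel symbols. -/
theorem isCovariantDerivativeOn_flatConnection (p : M) :
    IsCovariantDerivativeOn (I := 𝓘(ℝ, E)) E (flatConnection p) (chartAt E p).source where
  add {σ σ' x} hσ hσ' hx := by
    have h1 := (differentiableAt_chartRep hx).2 hσ
    have h2 := (differentiableAt_chartRep hx).2 hσ'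
    have h3 : chartRep p (σ + σ') = chartRep p σ + chartRep p σ' := by
      ext z
      simp [chartRep]
    ext u
    rw [flatConnection_apply, h3, fderiv_add h1 h2]
    simp [flatConnection_apply]
  leibniz {σ f x} hσ hf hx := by
    have h1 := (differentiableAt_chartRep hx).2 hσ
    have h2 := differentiableAt_comp_chartAt_symm hx hf
    have h3 : chartRep p (f • σ) = (fun z ↦ f ((chartAt E p).symm z)) • chartRep p σ := by
      ext z
      simp [chartRep]
    ext u
    rw [flatConnection_apply, h3, fderiv_smul h2 h1]
    simp [flatConnection_apply, mvfderiv_eq_fderiv hx h2 (fun z _ ↦ rfl), chartRep_chartAt hx,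
      ofModel_toModel hx, (chartAt E p).left_inv hx]

variable [FiniteDimensional ℝ E]
  (cov : CovariantDerivative 𝓘(ℝ, E) E (fun x : M ↦ TangentSpace 𝓘(ℝ, E) x))

/-- The Christoffel symbols of a connection in the chart at `p`. -/
def christoffel (p : M) (z : E) : E →L[ℝ] E →L[ℝ] E :=
  (LinearMap.mk₂ ℝ (fun u a ↦ toModel p ((chartAt E p).symm z)
    ((cov.isCovariantDerivativeOn (s := (chartAt E p).source)).difference
      (isCovariantDerivativeOn_flatConnection p) ((chartAt E p).symm z)
      (ofModel p ((chartAt E p).symm z) a) (ofModel p ((chartAt E p).symm z) u)))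
    (by simp) (by simp) (by simp) (by simp)).toContinuousBilinearMap

/-- A connection in coordinates. -/
theorem toModel_cov {p x : M} (hx : x ∈ (chartAt E p).source)
    {V : ∀ x : M, TangentSpace 𝓘(ℝ, E) x}
    (hV : DifferentiableAt ℝ (chartRep p V) (chartAt E p x)) (u : TangentSpace 𝓘(ℝ, E) x) :
    toModel p x (cov V x u) = fderiv ℝ (chartRep p V) (chartAt E p x) (toModel p x u) +
      christoffel cov p (chartAt E p x) (toModel p x u) (toModel p x (V x)) := by
  have h := (cov.isCovariantDerivativeOn (s := (chartAt E p).source)).difference_apply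
      (isCovariantDerivativeOn_flatConnection p) hx ((differentiableAt_chartRep hx).1 hV)
  have h2 := congrArg (fun A ↦ toModel p x (A u)) h
  simp only [sub_apply, map_sub, flatConnection_apply, toModel_ofModel hx] at h2
  have h3 : christoffel cov p (chartAt E p x) (toModel p x u) (toModel p x (V x)) =
    toModel p x ((cov.isCovariantDerivativeOn (s := (chartAt E p).source)).difference
      (isCovariantDerivativeOn_flatConnection p) x (V x) u) := by
    have h4 : ∀ y, y = x → ∀ a b : E, toModel p y
      ((cov.isCovariantDerivativeOn (s := (chartAt E p).source)).difference
      (isCovariantDerivativeOn_flatConnection p) y (ofModel p y a) (ofModel p y b)) = toModel p x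
      ((cov.isCovariantDerivativeOn (s := (chartAt E p).source)).difference
      (isCovariantDerivativeOn_flatConnection p) x (ofModel p x a) (ofModel p x b)) := by
      rintro y rfl a b
      rfl
    rw [← ofModel_toModel hx (V x)]
    nth_rw 2 [← ofModel_toModel hx u]
    rw [← h4 _ ((chartAt E p).left_inv hx), toModel_ofModel hx]
    rfl
  rw [h3, h2]
  abel

end ChristoffelSymbols

end

/-! ### Smoothness of coordinate expressions -/

noncomputable section

set_option synthInstance.maxHeartbeats 200000
set_option linter.unusedSectionVars false

section Smoothness

variable {E : Type*} [NormedAddCommGroup E] [NormedSpace ℝ E] [FiniteDimensional ℝ E]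
  {M : Type*} [TopologicalSpace M] [ChartedSpace E M] [IsManifold 𝓘(ℝ, E) ∞ M]

theorem chartRep_ofModel {p : M} {z : E} (hz : z ∈ (chartAt E p).target) (a : E) :
    chartRep p (fun x ↦ ofModel p x a) z = a :=
  toModel_ofModel ((chartAt E p).map_target hz) a

theorem contMDiffAt_ofModel {p x : M} (hx : x ∈ (chartAt E p).source) (a : E) :
    ContMDiffAt 𝓘(ℝ, E) (𝓘(ℝ, E).prod 𝓘(ℝ, E)) ∞ (fun y ↦ TotalSpace.mk' E y (ofModel p y a)) x := by
  refine (contDiffAt_chartRep (V := fun y ↦ ofModel p y a) hx).1 ?_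
  refine (contDiffAt_const (c := a)).congr_of_eventuallyEq ?_
  filter_upwards [(chartAt E p).open_target.mem_nhds ((chartAt E p).map_source hx)] with z hz
  exact chartRep_ofModel hz a

theorem chartRep_eventuallyEq {p x : M} (hx : x ∈ (chartAt E p).source)
    {V W : ∀ x : M, TangentSpace 𝓘(ℝ, E) x} (h : ∀ᶠ y in 𝓝 x, V y = W y) :
    chartRep p V =ᶠ[𝓝 (chartAt E p x)] chartRep p W := by
  have h1 := (contMDiffAt_chartAt_symm hx).continuousAt
  rw [ContinuousAt, (chartAt E p).left_inv hx] at h1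
  filter_upwards [h1.eventually h] with z hz
  rw [chartRep, chartRep, hz]

/-- Smoothness of the connection is used on globally smooth fields, so fields with constant
coordinates are cut off by a bump function. -/
theorem exists_contMDiff_eventuallyEq_ofModel [T2Space M] {p x : M}
    (hx : x ∈ (chartAt E p).source) (a : E) : ∃ σ : ∀ x : M, TangentSpace 𝓘(ℝ, E) x,
      ContMDiff 𝓘(ℝ, E) (𝓘(ℝ, E).prod 𝓘(ℝ, E)) ∞ (fun y ↦ TotalSpace.mk' E y (σ y)) ∧
      ∀ᶠ y in 𝓝 x, σ y = ofModel p y a := by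
  obtain ⟨f, -, hf⟩ := (SmoothBumpFunction.nhds_basis_tsupport (I := 𝓘(ℝ, E)) x).mem_iff.1
    ((chartAt E p).open_source.mem_nhds hx)
  refine ⟨fun y ↦ f y • ofModel p y a, fun y ↦ ?_, ?_⟩
  · by_cases hy : y ∈ tsupport f
    · exact (f.contMDiff y).smul_section (contMDiffAt_ofModel (hf hy) a)
    · refine (contMDiffAt_zeroSection ℝ (fun x : M ↦ TangentSpace 𝓘(ℝ, E) x)).congr_of_eventuallyEq ?_
      filter_upwards [(isClosed_tsupport f).isOpen_compl.mem_nhds hy] with w hw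
      have : f w = 0 := image_eq_zero_of_notMem_tsupport hw
      simp [this, zeroSection]
  · filter_upwards [f.eventuallyEq_one] with y hy
    simp [hy]

theorem contDiffOn_target_of_chartAt {F : Type*} [NormedAddCommGroup F] [NormedSpace ℝ F] {p : M}
    {f : E → F} (h : ∀ x ∈ (chartAt E p).source, ContDiffAt ℝ ∞ f (chartAt E p x)) :
    ContDiffOn ℝ ∞ f (chartAt E p).target := by
  intro z hz
  have h1 := h _ ((chartAt E p).map_target hz)
  rw [(chartAt E p).right_inv hz] at h1
  exact h1.contDiffWithinAt

/-- On a field with constant coordinates `a` the flat derivative vanishes, and the connection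
returns `Γ(u) a`; smoothness is read off there. -/
theorem contDiffOn_christoffel [T2Space M]
    (cov : CovariantDerivative 𝓘(ℝ, E) E (fun x : M ↦ TangentSpace 𝓘(ℝ, E) x))
    (hcov : CovariantDerivative.ContMDiffCovariantDerivative cov ∞) (p : M) :
    ContDiffOn ℝ ∞ (christoffel cov p) (chartAt E p).target := by
  rw [contDiffOn_clm_apply]
  intro u
  rw [contDiffOn_clm_apply]
  intro a
  refine contDiffOn_target_of_chartAt fun x hx ↦ ?_
  obtain ⟨σ, hσ, hσa⟩ := exists_contMDiff_eventuallyEq_ofModel hx a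
  have h1 := hcov.contMDiff.contMDiff (σ := σ) (fun y _ ↦ (hσ y).contMDiffWithinAt)
  have h2 := ((h1 x trivial).contMDiffAt Filter.univ_mem).clm_bundle_apply (contMDiffAt_ofModel hx u)
  have h3 := (contDiffAt_chartRep hx).2 h2
  refine h3.congr_of_eventuallyEq ?_
  have h4 : ∀ᶠ y in 𝓝 x, chartRep p (fun y ↦ cov σ y (ofModel p y u)) (chartAt E p y) =
      christoffel cov p (chartAt E p y) u a := by
    filter_upwards [hσa.eventually_nhds, (chartAt E p).open_source.mem_nhds hx] with y hy hy'
    have h5 : chartRep p σ =ᶠ[𝓝 (chartAt E p y)] fun _ ↦ a := by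
      refine (chartRep_eventuallyEq hy' hy).trans ?_
      filter_upwards [(chartAt E p).open_target.mem_nhds ((chartAt E p).map_source hy')] with z hz
      exact chartRep_ofModel hz a
    rw [chartRep_chartAt hy', toModel_cov cov hy'
      ((differentiableAt_const a).congr_of_eventuallyEq h5), h5.fderiv_eq, ← chartRep_chartAt hy' σ,
      h5.eq_of_nhds, toModel_ofModel hy']
    simp
  have h6 := (contMDiffAt_chartAt_symm hx).continuousAt
  rw [ContinuousAt, (chartAt E p).left_inv hx] at h6
  filter_upwards [h6.eventually h4,
    (chartAt E p).open_target.mem_nhds ((chartAt E p).map_source hx)] with z hz hz'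
  rw [(chartAt E p).right_inv hz'] at hz
  exact hz.symm

/-- A field of endomorphisms, in coordinates. -/
def chartEnd (p : M) (A : ∀ x : M, TangentSpace 𝓘(ℝ, E) x →L[ℝ] TangentSpace 𝓘(ℝ, E) x) (z : E) :
    E →L[ℝ] E :=
  toModel p ((chartAt E p).symm z) ∘L A ((chartAt E p).symm z) ∘L ofModel p ((chartAt E p).symm z)

theorem chartEnd_toModel {p x : M} (hx : x ∈ (chartAt E p).source)
    (A : ∀ x : M, TangentSpace 𝓘(ℝ, E) x →L[ℝ] TangentSpace 𝓘(ℝ, E) x)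
    (u : TangentSpace 𝓘(ℝ, E) x) :
    chartEnd p A (chartAt E p x) (toModel p x u) = toModel p x (A x u) := by
  have h : ∀ y, y = x → ∀ a : E, toModel p y (A y (ofModel p y a)) =
      toModel p x (A x (ofModel p x a)) := by
    rintro y rfl a
    rfl
  refine (h _ ((chartAt E p).left_inv hx) _).trans ?_
  rw [ofModel_toModel hx]

theorem chartRep_apply (p : M)
    (A : ∀ x : M, TangentSpace 𝓘(ℝ, E) x →L[ℝ] TangentSpace 𝓘(ℝ, E) x)
    (V : ∀ x : M, TangentSpace 𝓘(ℝ, E) x) {z : E} (hz : z ∈ (chartAt E p).target) :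
    chartRep p (fun y ↦ A y (V y)) z = chartEnd p A z (chartRep p V z) := by
  simp only [chartRep, chartEnd, ContinuousLinearMap.comp_apply]
  rw [ofModel_toModel ((chartAt E p).map_target hz)]

theorem contDiffOn_chartEnd {p : M}
    {A : ∀ x : M, TangentSpace 𝓘(ℝ, E) x →L[ℝ] TangentSpace 𝓘(ℝ, E) x}
    (hA : ContMDiff 𝓘(ℝ, E) (𝓘(ℝ, E).prod 𝓘(ℝ, E →L[ℝ] E)) ∞
      (fun x ↦ TotalSpace.mk' (E →L[ℝ] E) x (A x))) :
    ContDiffOn ℝ ∞ (chartEnd p A) (chartAt E p).target := by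
  rw [contDiffOn_clm_apply]
  intro a
  refine contDiffOn_target_of_chartAt fun x hx ↦ ?_
  exact (contDiffAt_chartRep hx).2 ((hA x).clm_bundle_apply (contMDiffAt_ofModel hx a))

theorem contDiffOn_chartRep {p : M} {V : ∀ x : M, TangentSpace 𝓘(ℝ, E) x}
    (hV : ContMDiff 𝓘(ℝ, E) (𝓘(ℝ, E).prod 𝓘(ℝ, E)) ∞ (fun x ↦ TotalSpace.mk' E x (V x))) :
    ContDiffOn ℝ ∞ (chartRep p V) (chartAt E p).target :=
  contDiffOn_target_of_chartAt fun x hx ↦ (contDiffAt_chartRep hx).2 (hV x)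

/-- A `1`-form, in coordinates. -/
def chartForm (p : M) (θ : ∀ x : M, TangentSpace 𝓘(ℝ, E) x →L[ℝ] ℝ) (z : E) : E →L[ℝ] ℝ :=
  θ ((chartAt E p).symm z) ∘L ofModel p ((chartAt E p).symm z)

theorem contDiffOn_chartForm {p : M} {θ : ∀ x : M, TangentSpace 𝓘(ℝ, E) x →L[ℝ] ℝ}
    (hθ : ContMDiff 𝓘(ℝ, E) (𝓘(ℝ, E).prod 𝓘(ℝ, E →L[ℝ] ℝ)) ∞
      (fun x ↦ TotalSpace.mk' (E →L[ℝ] ℝ) x (θ x))) :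
    ContDiffOn ℝ ∞ (chartForm p θ) (chartAt E p).target := by
  rw [contDiffOn_clm_apply]
  intro a
  refine contDiffOn_target_of_chartAt fun x hx ↦ ?_
  have h := (hθ x).clm_bundle_apply (E₂ := Bundle.Trivial M ℝ) (contMDiffAt_ofModel hx a)
  rw [contMDiffAt_section] at h
  exact contDiffAt_comp_chartAt_symm hx h

theorem chartForm_toModel {p x : M} (hx : x ∈ (chartAt E p).source)
    (θ : ∀ x : M, TangentSpace 𝓘(ℝ, E) x →L[ℝ] ℝ) (u : TangentSpace 𝓘(ℝ, E) x) :
    chartForm p θ (chartAt E p x) (toModel p x u) = θ x u := by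
  have h : ∀ y, y = x → ∀ a : E, θ y (ofModel p y a) = θ x (ofModel p x a) := by
    rintro y rfl a
    rfl
  refine (h _ ((chartAt E p).left_inv hx) _).trans ?_
  rw [ofModel_toModel hx]

/-- A metric, in coordinates. -/
def chartMetric (p : M)
    (g : ∀ x : M, TangentSpace 𝓘(ℝ, E) x →L[ℝ] TangentSpace 𝓘(ℝ, E) x →L[ℝ] ℝ) (z : E) :
    E →L[ℝ] E →L[ℝ] ℝ :=
  (LinearMap.mk₂ ℝ (fun a b ↦ g ((chartAt E p).symm z) (ofModel p ((chartAt E p).symm z) a)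
    (ofModel p ((chartAt E p).symm z) b))
    (by simp) (by simp) (by simp) (by simp)).toContinuousBilinearMap

theorem chartMetric_toModel {p x : M} (hx : x ∈ (chartAt E p).source)
    (g : ∀ x : M, TangentSpace 𝓘(ℝ, E) x →L[ℝ] TangentSpace 𝓘(ℝ, E) x →L[ℝ] ℝ)
    (u v : TangentSpace 𝓘(ℝ, E) x) :
    chartMetric p g (chartAt E p x) (toModel p x u) (toModel p x v) = g x u v := by
  have h : ∀ y, y = x → ∀ a b : E, g y (ofModel p y a) (ofModel p y b) =
      g x (ofModel p x a) (ofModel p x b) := by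
    rintro y rfl a b
    rfl
  refine (h _ ((chartAt E p).left_inv hx) _ _).trans ?_
  rw [ofModel_toModel hx, ofModel_toModel hx]

theorem contDiffOn_chartMetric {p : M}
    {g : ∀ x : M, TangentSpace 𝓘(ℝ, E) x →L[ℝ] TangentSpace 𝓘(ℝ, E) x →L[ℝ] ℝ}
    (hg : ContMDiff 𝓘(ℝ, E) (𝓘(ℝ, E).prod 𝓘(ℝ, E →L[ℝ] E →L[ℝ] ℝ)) ∞
      (fun x ↦ TotalSpace.mk' (E →L[ℝ] E →L[ℝ] ℝ) x (g x))) :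
    ContDiffOn ℝ ∞ (chartMetric p g) (chartAt E p).target := by
  rw [contDiffOn_clm_apply]
  intro a
  rw [contDiffOn_clm_apply]
  intro b
  refine contDiffOn_target_of_chartAt fun x hx ↦ ?_
  have h := (hg x).clm_bundle_apply₂ (E₃ := Bundle.Trivial M ℝ) (contMDiffAt_ofModel hx a)
    (contMDiffAt_ofModel hx b)
  rw [contMDiffAt_section] at h
  exact contDiffAt_comp_chartAt_symm hx h

end Smoothness

end

/-! ### Exterior derivative, torsion, curvature and `N` in coordinates -/

noncomputable section

set_option synthInstance.maxHeartbeats 200000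
set_option linter.unusedSectionVars false

section Coordinates

variable {d : ℕ} {M : Type*} [TopologicalSpace M]
  [ChartedSpace (EuclideanSpace ℝ (Fin (2 * d + 1))) M] [IsManifold (𝓡 (2 * d + 1)) ∞ M]

local notation "𝔼" => EuclideanSpace ℝ (Fin (2 * d + 1))

theorem contDiffAt_chartRep_extend {p x : M} (hx : x ∈ (chartAt 𝔼 p).source)
    (u : TangentSpace (𝓡 (2 * d + 1)) x) :
    ContDiffAt ℝ ∞ (chartRep p (extend 𝔼 u)) (chartAt 𝔼 p x) :=
  (contDiffAt_chartRep hx).2 (contMDiffAt_extend (𝓡 (2 * d + 1)) 𝔼 u)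

theorem chartRep_extend {p x : M} (hx : x ∈ (chartAt 𝔼 p).source)
    (u : TangentSpace (𝓡 (2 * d + 1)) x) :
    chartRep p (extend 𝔼 u) (chartAt 𝔼 p x) = toModel p x u := by
  rw [chartRep_chartAt hx, extend_apply_self]

/-- The derivatives of the extending fields cancel against the bracket, which also shows
independence of the extensions. -/
theorem extDerivForm_eq {p x : M} (hx : x ∈ (chartAt 𝔼 p).source)
    {θ : ∀ x : M, TangentSpace (𝓡 (2 * d + 1)) x →L[ℝ] ℝ}
    (hθ : DifferentiableAt ℝ (chartForm p θ) (chartAt 𝔼 p x))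
    (u v : TangentSpace (𝓡 (2 * d + 1)) x) :
    extDerivForm θ x u v =
      fderiv ℝ (chartForm p θ) (chartAt 𝔼 p x) (toModel p x u) (toModel p x v) -
        fderiv ℝ (chartForm p θ) (chartAt 𝔼 p x) (toModel p x v) (toModel p x u) := by
  have hd := fun u ↦ (contDiffAt_chartRep_extend hx u).differentiableAt (by simp)
  have h1 : ∀ u v : TangentSpace (𝓡 (2 * d + 1)) x,
      mvfderiv (𝓡 (2 * d + 1)) (fun y ↦ θ y (extend 𝔼 v y)) x u =
      fderiv ℝ (chartForm p θ) (chartAt 𝔼 p x) (toModel p x u) (toModel p x v) +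
        chartForm p θ (chartAt 𝔼 p x)
          (fderiv ℝ (chartRep p (extend 𝔼 v)) (chartAt 𝔼 p x) (toModel p x u)) := by
    intro u v
    rw [mvfderiv_eq_fderiv hx (f' := fun z ↦ chartForm p θ z (chartRep p (extend 𝔼 v) z))
      (hθ.clm_apply (hd v)), fderiv_apply_apply hθ (hd v), chartRep_extend hx]
    intro z hz
    simp only [chartForm, chartRep, ContinuousLinearMap.comp_apply]
    rw [ofModel_toModel ((chartAt 𝔼 p).map_target hz)]
  simp only [extDerivForm]
  rw [h1, h1, ← chartForm_toModel hx, toModel_mlieBracket hx (hd u) (hd v), extend_apply_self,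
    extend_apply_self, map_sub]
  ring

theorem covEnd_eq {p x : M} (hx : x ∈ (chartAt 𝔼 p).source)
    (cov : CovariantDerivative (𝓡 (2 * d + 1)) 𝔼 (fun x : M ↦ TangentSpace (𝓡 (2 * d + 1)) x))
    {A : ∀ x : M, TangentSpace (𝓡 (2 * d + 1)) x →L[ℝ] TangentSpace (𝓡 (2 * d + 1)) x}
    (hA : DifferentiableAt ℝ (chartEnd p A) (chartAt 𝔼 p x))
    (u v : TangentSpace (𝓡 (2 * d + 1)) x) :
    toModel p x (ContactMetricStructure.covEnd cov (fun y ↦ A y) x u v) =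
      chartCovEnd (christoffel cov p) (chartEnd p A) (chartAt 𝔼 p x) (toModel p x u)
        (toModel p x v) := by
  have hv := (contDiffAt_chartRep_extend hx v).differentiableAt (by simp)
  have h1 : chartRep p (fun y ↦ A y (extend 𝔼 v y)) =ᶠ[𝓝 (chartAt 𝔼 p x)]
      fun z ↦ chartEnd p A z (chartRep p (extend 𝔼 v) z) := by
    filter_upwards [(chartAt 𝔼 p).open_target.mem_nhds ((chartAt 𝔼 p).map_source hx)] with z hz
    exact chartRep_apply p A _ hz
  simp only [ContactMetricStructure.covEnd]
  rw [map_sub, toModel_cov cov hx ((hA.clm_apply hv).congr_of_eventuallyEq h1), h1.fderiv_eq,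
    fderiv_apply_apply hA hv, chartRep_extend hx, ← chartEnd_toModel hx, ← chartEnd_toModel hx,
    toModel_cov cov hx hv, extend_apply_self]
  simp only [chartCovEnd, add_apply, sub_apply, ContinuousLinearMap.comp_apply, map_add]
  abel

theorem toModel_torsion {p x : M} (hx : x ∈ (chartAt 𝔼 p).source)
    (cov : CovariantDerivative (𝓡 (2 * d + 1)) 𝔼 (fun x : M ↦ TangentSpace (𝓡 (2 * d + 1)) x))
    (u v : TangentSpace (𝓡 (2 * d + 1)) x) :
    toModel p x (cov.torsion x u v) =
      christoffel cov p (chartAt 𝔼 p x) (toModel p x u) (toModel p x v) -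
        christoffel cov p (chartAt 𝔼 p x) (toModel p x v) (toModel p x u) := by
  have hd := fun u ↦ (contDiffAt_chartRep_extend hx u).differentiableAt (by simp)
  rw [cov.torsion_apply_eq_extend, map_sub, map_sub, toModel_cov cov hx (hd u),
    toModel_cov cov hx (hd v), toModel_mlieBracket hx (hd u) (hd v)]
  simp only [extend_apply_self]
  abel

-- The sign reflects the two opposite curvature conventions. Second derivatives of the extension of
-- `w` cancel by symmetry, and first derivatives of the extensions of `u` and `v` cancel against the
-- bracket.
set_option maxHeartbeats 1000000 in
theorem toModel_curv {p x : M} (hx : x ∈ (chartAt 𝔼 p).source)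
    (cov : CovariantDerivative (𝓡 (2 * d + 1)) 𝔼 (fun x : M ↦ TangentSpace (𝓡 (2 * d + 1)) x))
    (hΓ : DifferentiableAt ℝ (christoffel cov p) (chartAt 𝔼 p x))
    (u v w : TangentSpace (𝓡 (2 * d + 1)) x) :
    toModel p x (ContactMetricStructure.curv cov x u v w) =
      -chartCurv (christoffel cov p) (chartAt 𝔼 p x) (toModel p x u) (toModel p x v)
        (toModel p x w) := by
  have hc := fun u ↦ contDiffAt_chartRep_extend hx u
  have hd := fun u ↦ (contDiffAt_chartRep_extend hx u).differentiableAt (by simp)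
  have hdd : DifferentiableAt ℝ (fderiv ℝ (chartRep p (extend 𝔼 w))) (chartAt 𝔼 p x) :=
    ((hc w).fderiv_right (m := 1) (by exact two_le_infty)).differentiableAt (by simp)
  have h1 : ∀ u : TangentSpace (𝓡 (2 * d + 1)) x,
      chartRep p (fun y ↦ cov (extend 𝔼 w) y (extend 𝔼 u y)) =ᶠ[𝓝 (chartAt 𝔼 p x)]
      fun z ↦ fderiv ℝ (chartRep p (extend 𝔼 w)) z (chartRep p (extend 𝔼 u) z) +
        christoffel cov p z (chartRep p (extend 𝔼 u) z) (chartRep p (extend 𝔼 w) z) := by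
    intro u
    filter_upwards [(chartAt 𝔼 p).open_target.mem_nhds ((chartAt 𝔼 p).map_source hx),
      ((hc w).of_le two_le_infty).eventually (by simp)] with z hz hz'
    have hy := (chartAt 𝔼 p).map_target hz
    rw [← (chartAt 𝔼 p).right_inv hz] at hz' ⊢
    rw [chartRep_chartAt hy, chartRep_chartAt hy, chartRep_chartAt hy,
      toModel_cov cov hy (hz'.differentiableAt (by simp))]
  have h2 : ∀ u : TangentSpace (𝓡 (2 * d + 1)) x, DifferentiableAt ℝ
      (fun z ↦ fderiv ℝ (chartRep p (extend 𝔼 w)) z (chartRep p (extend 𝔼 u) z) +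
        christoffel cov p z (chartRep p (extend 𝔼 u) z) (chartRep p (extend 𝔼 w) z))
      (chartAt 𝔼 p x) := fun u ↦
    (hdd.clm_apply (hd u)).add ((hΓ.clm_apply (hd u)).clm_apply (hd w))
  have h3 : ∀ u v : TangentSpace (𝓡 (2 * d + 1)) x,
      toModel p x (cov (fun y ↦ cov (extend 𝔼 w) y (extend 𝔼 u y)) x v) =
        fderiv ℝ (fderiv ℝ (chartRep p (extend 𝔼 w))) (chartAt 𝔼 p x) (toModel p x v)
          (toModel p x u) +
        fderiv ℝ (chartRep p (extend 𝔼 w)) (chartAt 𝔼 p x)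
          (fderiv ℝ (chartRep p (extend 𝔼 u)) (chartAt 𝔼 p x) (toModel p x v)) +
        (fderiv ℝ (christoffel cov p) (chartAt 𝔼 p x) (toModel p x v) (toModel p x u)
            (toModel p x w) +
          christoffel cov p (chartAt 𝔼 p x)
            (fderiv ℝ (chartRep p (extend 𝔼 u)) (chartAt 𝔼 p x) (toModel p x v)) (toModel p x w) +
          christoffel cov p (chartAt 𝔼 p x) (toModel p x u)
            (fderiv ℝ (chartRep p (extend 𝔼 w)) (chartAt 𝔼 p x) (toModel p x v))) +
        (christoffel cov p (chartAt 𝔼 p x) (toModel p x v)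
            (fderiv ℝ (chartRep p (extend 𝔼 w)) (chartAt 𝔼 p x) (toModel p x u)) +
          christoffel cov p (chartAt 𝔼 p x) (toModel p x v)
            (christoffel cov p (chartAt 𝔼 p x) (toModel p x u) (toModel p x w))) := by
    intro u v
    rw [toModel_cov cov hx ((h2 u).congr_of_eventuallyEq (h1 u)), (h1 u).fderiv_eq,
      fderiv_fun_add (hdd.clm_apply (hd u)) ((hΓ.clm_apply (hd u)).clm_apply (hd w)), add_apply,
      fderiv_apply_apply hdd (hd u), fderiv_apply_apply (hΓ.clm_apply (hd u)) (hd w),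
      fderiv_apply_apply hΓ (hd u), extend_apply_self, toModel_cov cov hx (hd w), add_apply,
      extend_apply_self, chartRep_extend hx, chartRep_extend hx]
    rw [map_add (christoffel cov p (chartAt 𝔼 p x) (toModel p x v))]
  have h4 : fderiv ℝ (fderiv ℝ (chartRep p (extend 𝔼 w))) (chartAt 𝔼 p x) (toModel p x v)
      (toModel p x u) = fderiv ℝ (fderiv ℝ (chartRep p (extend 𝔼 w))) (chartAt 𝔼 p x)
      (toModel p x u) (toModel p x v) :=
    ((hc w).of_le two_le_infty).isSymmSndFDerivAt (by simp) _ _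
  simp only [ContactMetricStructure.curv]
  rw [map_sub, map_sub, h3, h3, h4, toModel_cov cov hx (hd w), toModel_mlieBracket hx (hd v) (hd u),
    extend_apply_self, extend_apply_self, extend_apply_self]
  have h5 : ∀ a b : 𝔼, christoffel cov p (chartAt 𝔼 p x) (a - b) =
      christoffel cov p (chartAt 𝔼 p x) a - christoffel cov p (chartAt 𝔼 p x) b :=
    fun a b ↦ map_sub _ _ _
  rw [h5]
  simp only [chartCurv, map_sub, add_apply, sub_apply, ContinuousLinearMap.comp_apply]
  abel

namespace ContactMetricStructure

variable (S : ContactMetricStructure d M)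

theorem contDiffAt_chartEnd_J {p x : M} (hx : x ∈ (chartAt 𝔼 p).source) :
    ContDiffAt ℝ ∞ (chartEnd p S.J) (chartAt 𝔼 p x) :=
  (contDiffOn_chartEnd S.smooth_J).contDiffAt
    ((chartAt 𝔼 p).open_target.mem_nhds ((chartAt 𝔼 p).map_source hx))

/-- All derivatives of the extending fields cancel; only derivatives of `J` are left. -/
theorem toModel_nijenhuis {p x : M} (hx : x ∈ (chartAt 𝔼 p).source)
    (u v : TangentSpace (𝓡 (2 * d + 1)) x) :
    toModel p x (S.nijenhuis x u v) =
      fderiv ℝ (chartEnd p S.J) (chartAt 𝔼 p x)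
        (chartEnd p S.J (chartAt 𝔼 p x) (toModel p x u)) (toModel p x v) -
      fderiv ℝ (chartEnd p S.J) (chartAt 𝔼 p x)
        (chartEnd p S.J (chartAt 𝔼 p x) (toModel p x v)) (toModel p x u) -
      chartEnd p S.J (chartAt 𝔼 p x)
        (fderiv ℝ (chartEnd p S.J) (chartAt 𝔼 p x) (toModel p x u) (toModel p x v)) +
      chartEnd p S.J (chartAt 𝔼 p x)
        (fderiv ℝ (chartEnd p S.J) (chartAt 𝔼 p x) (toModel p x v) (toModel p x u)) +
      S.omega x u v • toModel p x (S.ξ x) := by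
  have hJ := (S.contDiffAt_chartEnd_J hx).differentiableAt (by simp)
  have hd := fun u ↦ (contDiffAt_chartRep_extend hx u).differentiableAt (by simp)
  have h1 : ∀ u : TangentSpace (𝓡 (2 * d + 1)) x,
      chartRep p (fun y ↦ S.J y (extend 𝔼 u y)) =ᶠ[𝓝 (chartAt 𝔼 p x)]
        fun z ↦ chartEnd p S.J z (chartRep p (extend 𝔼 u) z) := by
    intro u
    filter_upwards [(chartAt 𝔼 p).open_target.mem_nhds ((chartAt 𝔼 p).map_source hx)] with z hz
    exact chartRep_apply p S.J _ hz
  have h2 : ∀ u : TangentSpace (𝓡 (2 * d + 1)) x, DifferentiableAt ℝ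
      (chartRep p (fun y ↦ S.J y (extend 𝔼 u y))) (chartAt 𝔼 p x) := fun u ↦
    (hJ.clm_apply (hd u)).congr_of_eventuallyEq (h1 u)
  have h3 : ∀ (u : TangentSpace (𝓡 (2 * d + 1)) x) (a : 𝔼),
      fderiv ℝ (chartRep p (fun y ↦ S.J y (extend 𝔼 u y))) (chartAt 𝔼 p x) a =
        fderiv ℝ (chartEnd p S.J) (chartAt 𝔼 p x) a (toModel p x u) +
        chartEnd p S.J (chartAt 𝔼 p x)
          (fderiv ℝ (chartRep p (extend 𝔼 u)) (chartAt 𝔼 p x) a) := by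
    intro u a
    rw [(h1 u).fderiv_eq, fderiv_apply_apply hJ (hd u), chartRep_extend hx]
  simp only [nijenhuis]
  rw [map_add, map_sub, map_sub, map_add, map_smul, ← chartEnd_toModel hx, ← chartEnd_toModel hx,
    ← chartEnd_toModel hx, ← chartEnd_toModel hx, toModel_mlieBracket hx (hd u) (hd v),
    toModel_mlieBracket hx (h2 u) (h2 v), toModel_mlieBracket hx (hd u) (h2 v),
    toModel_mlieBracket hx (h2 u) (hd v)]
  simp only [h3, extend_apply_self, ← chartEnd_toModel hx, map_sub, map_add]
  abel

end ContactMetricStructure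

end Coordinates

end

/-! ### From the Tanaka-Webster connection to its chart data -/

noncomputable section

set_option synthInstance.maxHeartbeats 200000
set_option linter.unusedSectionVars false

section WebsterChart

variable {d : ℕ} {M : Type*} [TopologicalSpace M]
  [ChartedSpace (EuclideanSpace ℝ (Fin (2 * d + 1))) M] [IsManifold (𝓡 (2 * d + 1)) ∞ M]

local notation "𝔼" => EuclideanSpace ℝ (Fin (2 * d + 1))

namespace ContactMetricStructure

variable (S : ContactMetricStructure d M)
  (cov : CovariantDerivative (𝓡 (2 * d + 1)) (EuclideanSpace ℝ (Fin (2 * d + 1)))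
    (fun x : M ↦ TangentSpace (𝓡 (2 * d + 1)) x))

theorem omega_swap (x : M) (u v : TangentSpace (𝓡 (2 * d + 1)) x) :
    S.omega x u v = -S.omega x v u := by
  have h : DifferentiableAt ℝ (chartForm x S.θ) (chartAt 𝔼 x x) :=
    ((contDiffOn_chartForm S.smooth_θ).contDiffAt ((chartAt 𝔼 x).open_target.mem_nhds
      (mem_chart_target 𝔼 x))).differentiableAt (by simp)
  rw [omega, omega, extDerivForm_eq (mem_chart_source 𝔼 x) h,
    extDerivForm_eq (mem_chart_source 𝔼 x) h]
  ring

theorem met_J (x : M) (u v : TangentSpace (𝓡 (2 * d + 1)) x) :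
    S.met x (S.J x u) v = S.omega x u v := S.g_J x u v

theorem met_symm (x : M) (u v : TangentSpace (𝓡 (2 * d + 1)) x) :
    S.met x u v = S.met x v u := S.g.symm x u v

theorem met_J_left (x : M) (u v : TangentSpace (𝓡 (2 * d + 1)) x) :
    S.met x (S.J x u) v = -S.met x u (S.J x v) := by
  rw [met_J, omega_swap, ← met_J, met_symm]

theorem eq_zero_of_met {x : M} {u : TangentSpace (𝓡 (2 * d + 1)) x}
    (h : ∀ v, S.met x u v = 0) : u = 0 := by
  by_contra hu
  exact (S.g.pos x u hu).ne' (h u)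

theorem J_ξ (x : M) : S.J x (S.ξ x) = 0 := by
  have h : S.J x (S.J x (S.ξ x)) = 0 := by rw [S.J_J, S.θ_ξ]; simp
  by_contra hu
  have h1 := S.g.pos x _ hu
  have h2 := S.met_J_left x (S.ξ x) (S.J x (S.ξ x))
  rw [h] at h2
  simp only [met, map_zero, neg_zero] at h2
  exact h1.ne' h2

theorem θ_J (x : M) (u : TangentSpace (𝓡 (2 * d + 1)) x) : S.θ x (S.J x u) = 0 := by
  rw [← S.g_ξ, ← met, met_symm, met_J_left, J_ξ]
  simp [met]

/-- The Tanaka-Webster torsion as a field of continuous linear maps. -/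
def tauL (x : M) : TangentSpace (𝓡 (2 * d + 1)) x →L[ℝ] TangentSpace (𝓡 (2 * d + 1)) x :=
  -cov.torsion x (S.ξ x)

theorem tauL_apply (x : M) (u : TangentSpace (𝓡 (2 * d + 1)) x) :
    S.tauL cov x u = S.tau cov x u := rfl

/-- The Tanaka-Webster torsion, in coordinates. -/
def chartTau (p : M) (z : 𝔼) : 𝔼 →L[ℝ] 𝔼 :=
  (christoffel cov p z).flip (chartRep p S.ξ z) - christoffel cov p z (chartRep p S.ξ z)

theorem chartTau_apply (p : M) (z a : 𝔼) : S.chartTau cov p z a =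
    christoffel cov p z a (chartRep p S.ξ z) - christoffel cov p z (chartRep p S.ξ z) a := rfl

theorem chartTau_toModel {p x : M} (hx : x ∈ (chartAt 𝔼 p).source)
    (u : TangentSpace (𝓡 (2 * d + 1)) x) :
    S.chartTau cov p (chartAt 𝔼 p x) (toModel p x u) = toModel p x (S.tau cov x u) := by
  rw [tau, tors, map_neg, toModel_torsion hx, chartTau_apply, chartRep_chartAt hx, neg_sub]

theorem chartEnd_tauL {p x : M} (hx : x ∈ (chartAt 𝔼 p).source) :
    chartEnd p (S.tauL cov) =ᶠ[𝓝 (chartAt 𝔼 p x)] S.chartTau cov p := by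
  filter_upwards [(chartAt 𝔼 p).open_target.mem_nhds ((chartAt 𝔼 p).map_source hx)] with z hz
  have hy := (chartAt 𝔼 p).map_target hz
  rw [← (chartAt 𝔼 p).right_inv hz]
  ext1 a
  rw [← toModel_ofModel hy a, chartEnd_toModel hy, chartTau_toModel S cov hy, tauL_apply]

end ContactMetricStructure

namespace ContactMetricStructure.IsTanakaWebster

variable {S : ContactMetricStructure d M}
  {cov : CovariantDerivative (𝓡 (2 * d + 1)) (EuclideanSpace ℝ (Fin (2 * d + 1)))
    (fun x : M ↦ TangentSpace (𝓡 (2 * d + 1)) x)}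

/-- The derivative of `J` is measured by `N` on `H`, which integrability makes zero. -/
theorem covEnd_J (h : S.IsTanakaWebster cov) (hCR : S.IsStrictlyPseudoconvexCR) (x : M)
    (u v : TangentSpace (𝓡 (2 * d + 1)) x) : covEnd cov (fun y ↦ S.J y) x u v = 0 := by
  apply S.eq_zero_of_met
  intro w
  rw [h.cov_J, hCR, omega_swap, omega, ← S.g_J]
  simp

variable [T2Space M]

set_option maxHeartbeats 1600000 in
theorem isWebsterChart (h : S.IsTanakaWebster cov) (hCR : S.IsStrictlyPseudoconvexCR)
    (hpar : ∀ (x : M) (u v : TangentSpace (𝓡 (2 * d + 1)) x), S.θ x u = 0 →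
      covEnd cov (S.tau cov) x u v = 0) (p : M) :
    IsWebsterChart (chartAt 𝔼 p).target (christoffel cov p) (chartMetric p S.g.inner)
      (chartRep p S.ξ) (chartEnd p S.J) (S.chartTau cov p) := by
  have hΓ := contDiffOn_christoffel cov h.smooth p
  have hg := contDiffOn_chartMetric (p := p) S.g.contMDiff
  have hξ := contDiffOn_chartRep (p := p) S.smooth_ξ
  have hJ := contDiffOn_chartEnd (p := p) S.smooth_J
  have hτ : ContDiffOn ℝ ∞ (S.chartTau cov p) (chartAt 𝔼 p).target := by
    rw [contDiffOn_clm_apply]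
    intro a
    exact ((hΓ.clm_apply contDiffOn_const).clm_apply hξ).sub
      ((hΓ.clm_apply hξ).clm_apply contDiffOn_const)
  -- Points and vectors of the chart come from points and tangent vectors of `M`, so each property
  -- is checked on `M`.
  have pull : ∀ {P : 𝔼 → Prop}, (∀ x ∈ (chartAt 𝔼 p).source, P (chartAt 𝔼 p x)) →
      ∀ y ∈ (chartAt 𝔼 p).target, P y := by
    intro P hP y hy
    have := hP _ ((chartAt 𝔼 p).map_target hy)
    rwa [(chartAt 𝔼 p).right_inv hy] at this
  have vec : ∀ {x : M}, x ∈ (chartAt 𝔼 p).source → ∀ {P : 𝔼 → Prop},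
      (∀ u : TangentSpace (𝓡 (2 * d + 1)) x, P (toModel p x u)) → ∀ a, P a := by
    intro x hx P hP a
    have := hP (ofModel p x a)
    rwa [toModel_ofModel hx] at this
  have dif : ∀ {F : Type} [NormedAddCommGroup F] [NormedSpace ℝ F] {f : 𝔼 → F},
      ContDiffOn ℝ ∞ f (chartAt 𝔼 p).target → ∀ {x : M}, x ∈ (chartAt 𝔼 p).source →
      DifferentiableAt ℝ f (chartAt 𝔼 p x) := fun hf x hx ↦
    (hf.contDiffAt ((chartAt 𝔼 p).open_target.mem_nhds
      ((chartAt 𝔼 p).map_source hx))).differentiableAt (by simp)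
  have θ_eq : ∀ {x : M}, x ∈ (chartAt 𝔼 p).source → ∀ u : TangentSpace (𝓡 (2 * d + 1)) x,
      chartMetric p S.g.inner (chartAt 𝔼 p x) (chartRep p S.ξ (chartAt 𝔼 p x)) (toModel p x u) =
        S.θ x u := by
    intro x hx u
    rw [chartRep_chartAt hx, chartMetric_toModel hx, S.g_ξ]
  have hDJ : ∀ y ∈ (chartAt 𝔼 p).target, ∀ u a, fderiv ℝ (chartEnd p S.J) y u a =
      chartEnd p S.J y (christoffel cov p y u a) - christoffel cov p y u (chartEnd p S.J y a) := by
    refine pull fun x hx ↦ vec hx fun u ↦ vec hx fun a ↦ ?_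
    have h1 := covEnd_eq hx cov (dif hJ hx) u a
    rw [h.covEnd_J hCR, map_zero] at h1
    simp only [chartCovEnd, add_apply, sub_apply, ContinuousLinearMap.comp_apply] at h1
    rw [eq_comm, sub_eq_zero] at h1
    rw [← h1]
    abel
  have hτξ : ∀ y ∈ (chartAt 𝔼 p).target, S.chartTau cov p y (chartRep p S.ξ y) = 0 := by
    intro y hy
    rw [chartTau_apply, sub_self]
  -- By definition `2τ = -N(ξ, ·)`. Replacing derivatives of `J` by Christoffel symbols, through `∇J
  -- = 0`, and using `Jξ = 0`, one finds `2τ = JτJ - J²τ`. Since `J` has horizontal values, `θ ∘ τ =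
  -- 0`.
  have htwo : ∀ x ∈ (chartAt 𝔼 p).source, ∀ u : TangentSpace (𝓡 (2 * d + 1)) x,
      (2 : ℝ) • S.tau cov x u = S.J x (S.tau cov x (S.J x u)) - S.J x (S.J x (S.tau cov x u)) := by
    intro x hx u
    have hy := (chartAt 𝔼 p).map_source hx
    have h1 : (2 : ℝ) • S.tau cov x u = -S.nijenhuis x (S.ξ x) u := by
      rw [tau, h.tors_ξ]
      module
    have h2 : S.omega x (S.ξ x) u = 0 := S.dθ_ξ x u
    have h3 : chartEnd p S.J (chartAt 𝔼 p x) (toModel p x (S.ξ x)) = 0 := by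
      rw [chartEnd_toModel hx, S.J_ξ, map_zero]
    have h4 := S.toModel_nijenhuis hx (S.ξ x) u
    rw [h2, zero_smul, h3] at h4
    simp only [hDJ _ hy, h3, map_zero, zero_apply, map_sub, sub_zero, zero_sub, add_zero] at h4
    have h5 : toModel p x ((2 : ℝ) • S.tau cov x u) = toModel p x (S.J x (S.tau cov x (S.J x u)) -
        S.J x (S.J x (S.tau cov x u))) := by
      rw [h1, map_neg, h4, map_sub, ← chartEnd_toModel hx, ← chartEnd_toModel hx,
        ← chartEnd_toModel hx, ← chartTau_toModel S cov hx, ← chartTau_toModel S cov hx,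
        ← chartEnd_toModel hx, chartTau_apply, chartTau_apply, chartRep_chartAt hx]
      simp only [map_sub]
      abel
    rw [← ofModel_toModel hx ((2 : ℝ) • S.tau cov x u), h5, ofModel_toModel hx]
  have hθτ : ∀ x ∈ (chartAt 𝔼 p).source, ∀ u : TangentSpace (𝓡 (2 * d + 1)) x,
      S.θ x (S.tau cov x u) = 0 := by
    intro x hx u
    have h1 := congrArg (S.θ x) (htwo x hx u)
    rw [map_smul, map_sub, S.θ_J, S.θ_J, sub_zero, smul_eq_mul] at h1
    linarith
  exact
  { isOpen := (chartAt 𝔼 p).open_target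
    smooth_Γ := hΓ
    smooth_g := hg
    smooth_ξ := hξ
    smooth_J := hJ
    smooth_τ := hτ
    g_symm := pull fun x hx ↦ vec hx fun u ↦ vec hx fun v ↦ by
      rw [chartMetric_toModel hx, chartMetric_toModel hx, S.g.symm]
    g_pos := pull fun x hx ↦ vec hx fun u hu ↦ by
      rw [chartMetric_toModel hx]
      exact S.g.pos x u fun h ↦ hu (by rw [h, map_zero])
    g_ξ_ξ := pull fun x hx ↦ by
      rw [chartRep_chartAt hx, chartMetric_toModel hx, S.g_ξ, S.θ_ξ]
    J_J := pull fun x hx ↦ vec hx fun u ↦ by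
      rw [θ_eq hx, chartRep_chartAt hx, chartEnd_toModel hx, chartEnd_toModel hx, S.J_J, map_add,
        map_neg, map_smul]
    g_J := pull fun x hx ↦ vec hx fun u ↦ vec hx fun v ↦ by
      rw [chartEnd_toModel hx, chartEnd_toModel hx, chartMetric_toModel hx, chartMetric_toModel hx]
      exact S.met_J_left x u v
    τ_ξ := hτξ
    τ_J := pull fun x hx ↦ vec hx fun u ↦ by
      rw [chartEnd_toModel hx, chartTau_toModel S cov hx, chartTau_toModel S cov hx,
        chartEnd_toModel hx, ← map_neg]
      -- With `θ ∘ τ = 0`, the identity `htwo` becomes `τ = JτJ`, which is equivalent to `τJ = -Jτ`.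
      have h1 := htwo x hx u
      rw [S.J_J, hθτ x hx, zero_smul, add_zero, sub_neg_eq_add, two_smul, add_left_inj] at h1
      rw [h1, S.J_J, hθτ x hx, zero_smul, add_zero, neg_neg]
    diff_g := pull fun x hx ↦ vec hx fun u ↦ vec hx fun a ↦ vec hx fun b ↦ by
      have hy := (chartAt 𝔼 p).map_source hx
      have h1 : ∀ a : 𝔼, chartRep p (fun x ↦ ofModel p x a) =ᶠ[𝓝 (chartAt 𝔼 p x)] fun _ ↦ a := by
        intro a
        filter_upwards [(chartAt 𝔼 p).open_target.mem_nhds hy] with z hz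
        exact chartRep_ofModel hz a
      have h2 : ∀ a : 𝔼, DifferentiableAt ℝ (chartRep p (fun x ↦ ofModel p x a))
        (chartAt 𝔼 p x) := fun a ↦ (differentiableAt_const a).congr_of_eventuallyEq (h1 a)
      obtain ⟨a, rfl⟩ : ∃ a', a = ofModel p x a' := ⟨_, (ofModel_toModel hx a).symm⟩
      obtain ⟨b, rfl⟩ : ∃ b', b = ofModel p x b' := ⟨_, (ofModel_toModel hx b).symm⟩
      -- Metricity is tested on fields with constant coordinates, whose covariant derivatives are
      -- given by `Γ` alone.
      have h3 := h.cov_g (fun x ↦ ofModel p x a) (fun x ↦ ofModel p x b) x u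
        ((differentiableAt_chartRep hx).1 (h2 a)) ((differentiableAt_chartRep hx).1 (h2 b))
      have h4 : ∀ a : 𝔼, toModel p x (cov (fun x ↦ ofModel p x a) x u) =
          christoffel cov p (chartAt 𝔼 p x) (toModel p x u) a := by
        intro a
        rw [toModel_cov cov hx (h2 a), (h1 a).fderiv_eq, toModel_ofModel hx]
        simp
      rw [mvfderiv_eq_fderiv hx (f' := fun z ↦ chartMetric p S.g.inner z a b)
        (((dif hg hx).clm_apply (differentiableAt_const a)).clm_apply (differentiableAt_const b))
        (fun z _ ↦ rfl), fderiv_apply_const ((dif hg hx).clm_apply (differentiableAt_const a)),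
        fderiv_apply_const (dif hg hx), met, met, ← chartMetric_toModel hx,
        ← chartMetric_toModel hx, h4, h4] at h3
      rw [toModel_ofModel hx, toModel_ofModel hx] at h3 ⊢
      exact h3
    diff_ξ := pull fun x hx ↦ vec hx fun u ↦ by
      have h1 := toModel_cov cov hx (dif hξ hx) u
      rw [h.cov_ξ, map_zero] at h1
      rw [chartRep_chartAt hx]
      exact eq_neg_of_add_eq_zero_left h1.symm
    diff_J := hDJ
    diff_τ_H := pull fun x hx ↦ vec hx fun u hu ↦ vec hx fun a ↦ by
      rw [θ_eq hx] at hu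
      have h1 := covEnd_eq hx cov (((dif hτ hx).congr_of_eventuallyEq (S.chartEnd_tauL cov hx))) u a
      have h2 := hpar x u a hu
      have h3 : covEnd cov (fun y ↦ S.tauL cov y) x u a = 0 := h2
      rw [h3, map_zero] at h1
      simp only [chartCovEnd, add_apply, sub_apply, ContinuousLinearMap.comp_apply] at h1
      rw [(S.chartEnd_tauL cov hx).fderiv_eq, (S.chartEnd_tauL cov hx).eq_of_nhds, eq_comm,
        sub_eq_zero] at h1
      rw [← h1]
      abel
    torsion := pull fun x hx ↦ vec hx fun u ↦ vec hx fun v ↦ by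
      -- The torsion is split along `H` and `ξ`: the horizontal part is `ω ⊗ ξ`, and the mixed terms
      -- are given by `τ`.
      have h1 : cov.torsion x (S.projH x u) (S.projH x v) = S.omega x u v • S.ξ x := by
        have h2 := h.tors_H x (S.projH x u) (S.projH x v) (by simp [projH, S.θ_ξ])
          (by simp [projH, S.θ_ξ])
        rw [tors, neg_inj] at h2
        rw [h2, ← S.met_J, ← S.met_J]
        simp only [projH, met, map_sub, map_smul, S.J_ξ, smul_zero, sub_zero]
        rw [S.g.symm x _ (S.ξ x), S.g_ξ, S.θ_J, smul_zero, sub_zero]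
      have h2 : cov.torsion x u v = S.omega x u v • S.ξ x - S.θ x u • S.tau cov x v +
          S.θ x v • S.tau cov x u := by
        rw [← h1, tau, tau, tors, tors]
        simp only [projH, map_sub, map_smul, sub_apply, smul_apply, cov.torsion_self]
        rw [cov.torsion_antisymm u (S.ξ x)]
        module
      rw [← toModel_torsion hx, websterTorsion, θ_eq hx, θ_eq hx, chartEnd_toModel hx,
        chartMetric_toModel hx, chartTau_toModel S cov hx, chartTau_toModel S cov hx, h2, map_add,
        map_sub, map_smul, map_smul, map_smul, chartRep_chartAt hx, S.g_J]
      rfl }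

end ContactMetricStructure.IsTanakaWebster

end WebsterChart

end

/-! ### The curvature formulas at a point -/

open TensorAlg

noncomputable section

set_option synthInstance.maxHeartbeats 200000
set_option linter.unusedSectionVars false

section Pointwise

variable {d : ℕ} {M : Type*} [TopologicalSpace M] [T2Space M]
  [ChartedSpace (EuclideanSpace ℝ (Fin (2 * d + 1))) M] [IsManifold (𝓡 (2 * d + 1)) ∞ M]

local notation "𝔼" => EuclideanSpace ℝ (Fin (2 * d + 1))

namespace ContactMetricStructure.IsTanakaWebster

variable {S : ContactMetricStructure d M}
  {cov : CovariantDerivative (𝓡 (2 * d + 1)) (EuclideanSpace ℝ (Fin (2 * d + 1)))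
    (fun x : M ↦ TangentSpace (𝓡 (2 * d + 1)) x)}

theorem curvature_formulas (h : S.IsTanakaWebster cov) (hCR : S.IsStrictlyPseudoconvexCR)
    (hpar : ∀ (x : M) (u v : TangentSpace (𝓡 (2 * d + 1)) x), S.θ x u = 0 →
      covEnd cov (S.tau cov) x u v = 0) {x : M}
    (hτ : ∃ v : TangentSpace (𝓡 (2 * d + 1)) x, S.tau cov x v ≠ 0)
    {e : Fin (2 * d) → TangentSpace (𝓡 (2 * d + 1)) x} (he : S.IsHorizontalFrame x e) :
    0 < S.tauNormSq cov x e ∧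
      ∀ X Y Z W : TangentSpace (𝓡 (2 * d + 1)) x,
        S.θ x X = 0 → S.θ x Y = 0 → S.θ x Z = 0 → S.θ x W = 0 →
        S.curvW cov x X Y Z W = S.scalW cov x e / (d : ℝ) ^ 2 *
          (holoCurv (S.met x) (S.omega x) X Y Z W
            + 2 * d / S.tauNormSq cov x e * S.tensT cov x X Y Z W) ∧
        S.chernMoser cov x e X Y Z W = S.scalW cov x e / (d : ℝ) ^ 2 *
          (1 / (d + 1) * primitivePart e (S.J x) (S.omega x)
              (holoCurv (S.met x) (S.omega x)) X Y Z W
            + 2 * d / S.tauNormSq cov x e * primitivePart e (S.J x) (S.omega x)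
              (S.tensT cov x) X Y Z W) := by
  have hx := mem_chart_source 𝔼 x
  have hy := (chartAt 𝔼 x).map_source hx
  have hC := h.isWebsterChart hCR hpar x
  have hP := hC.isWebsterPoint hy
  have hΓ := hC.differentiableAt_of_mem hC.smooth_Γ hy
  set y := chartAt 𝔼 x x with hydef
  set g := chartMetric x S.g.inner y with hg
  set ξ := chartRep x S.ξ y with hξ
  have hfin : Module.finrank ℝ 𝔼 = 2 * d + 1 := finrank_euclideanSpace_fin
  have hθ (u : TangentSpace (𝓡 (2 * d + 1)) x) : g ξ (toModel x x u) = S.θ x u := by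
    rw [hξ, chartRep_chartAt hx, chartMetric_toModel hx, S.g_ξ]
  have hmet (u v : TangentSpace (𝓡 (2 * d + 1)) x) :
      g (toModel x x u) (toModel x x v) = S.met x u v := chartMetric_toModel hx _ u v
  have hτ0 : S.chartTau cov x y ≠ 0 := by
    obtain ⟨v, hv⟩ := hτ
    intro h0
    apply hv
    rw [← ofModel_toModel hx (S.tau cov x v), ← chartTau_toModel S cov hx, ← hydef, h0]
    simp
  obtain ⟨hd, l, c, hl, hττ, -, hmodel, -⟩ := hP.exists_model hfin (e := fun i ↦ toModel x x (e i))
    (fun i ↦ by rw [hθ, he.1]) (fun i j ↦ by rw [hmet, he.2]) hτ0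
  -- An identification of the hyperplane in coordinates with `H_x`. All tensors, and the frame, are
  -- transported through it to the algebraic setting.
  let ι : IsWebsterPoint.hplane g ξ → TangentSpace (𝓡 (2 * d + 1)) x := fun a ↦ ofModel x x a
  have hLι (a : IsWebsterPoint.hplane g ξ) : toModel x x (ι a) = a := toModel_ofModel hx _
  have hι (u : TangentSpace (𝓡 (2 * d + 1)) x) (hu : S.θ x u = 0) : ∃ a, u = ι a :=
    ⟨⟨toModel x x u, (hθ u).trans hu⟩, (ofModel_toModel hx u).symm⟩
  have hιι {u : TangentSpace (𝓡 (2 * d + 1)) x} {a : IsWebsterPoint.hplane g ξ}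
      (hu : toModel x x u = a) : u = ι a := by
    rw [← ofModel_toModel hx u, hu]
  have hιmet (a b : IsWebsterPoint.hplane g ξ) :
      S.met x (ι a) (ι b) = IsWebsterPoint.gH g ξ a b := by
    rw [← hmet, hLι, hLι]
    rfl
  have hιJ (a : IsWebsterPoint.hplane g ξ) :
      S.J x (ι a) = ι (IsWebsterPoint.restrH g hP.g_ξ_ξ (chartEnd x S.J y) a) := by
    apply hιι
    rw [IsWebsterPoint.coe_restrH hP.g_ξ_ξ hP.θ_J, ← chartEnd_toModel hx, hLι]
  have hιτ (a : IsWebsterPoint.hplane g ξ) :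
      S.tau cov x (ι a) = ι (IsWebsterPoint.restrH g hP.g_ξ_ξ (S.chartTau cov x y) a) := by
    apply hιι
    rw [IsWebsterPoint.coe_restrH hP.g_ξ_ξ hP.θ_τ, ← chartTau_toModel S cov hx, hLι]
  have hιω (a b : IsWebsterPoint.hplane g ξ) : S.omega x (ι a) (ι b) =
      IsWebsterPoint.gH g ξ (IsWebsterPoint.restrH g hP.g_ξ_ξ (chartEnd x S.J y) a) b := by
    rw [← S.met_J, hιJ, hιmet]
  have hcurv (X Y Z V : IsWebsterPoint.hplane g ξ) :
      S.met x (curv cov x (ι X) (ι Y) (ι Z)) (ι V) =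
        -g (chartCurv (christoffel cov x) y X Y Z) V := by
    rw [← hmet, toModel_curv hx cov hΓ, hLι, hLι, hLι, hLι, map_neg, neg_apply]
  have hW := hP.isWebsterCurvature
  have hK (X Y Z V : IsWebsterPoint.hplane g ξ) :
      S.curvW cov x (ι X) (ι Y) (ι Z) (ι V) = IsWebsterCurvature.model (IsWebsterPoint.gH g ξ)
        (IsWebsterPoint.restrH g hP.g_ξ_ξ (chartEnd x S.J y))
        (IsWebsterPoint.restrH g hP.g_ξ_ξ (S.chartTau cov x y)) l (2 * c) (2 * c) X Y Z V := by
    -- Taking the `J`-invariant part of the curvature removes `torsionPart` and leaves the model.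
    have h1 := hW.half_add X Y Z V
    have h2 := hmodel X Y Z V
    rw [← hcurv] at h2
    rw [← hcurv, ← hcurv, ← hιJ, ← hιJ, h2, add_sub_cancel_right, ← h2] at h1
    rw [← h1, curvW]
    simp only [met, map_smul, map_add, smul_apply, add_apply, smul_eq_mul]
  choose e' he' using fun i ↦ hι (e i) (he.1 i)
  have hF : IsOrthonormalFrame (IsWebsterPoint.gH g ξ) e' := hP.isOrthonormalFrame hfin fun i j ↦ by
    have h1 := he.2 i j
    rwa [he', he', hιmet] at h1
  obtain rfl : e = fun i ↦ ι (e' i) := funext he'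
  have ht : S.tauNormSq cov x (fun i ↦ ι (e' i)) = ∑ i, IsWebsterPoint.gH g ξ
      (IsWebsterPoint.restrH g hP.g_ξ_ξ (S.chartTau cov x y) (e' i))
      (IsWebsterPoint.restrH g hP.g_ξ_ξ (S.chartTau cov x y) (e' i)) := by
    simp only [tauNormSq, hιτ, hιmet]
  have hττ' (a : IsWebsterPoint.hplane g ξ) :
      IsWebsterPoint.restrH g hP.g_ξ_ξ (S.chartTau cov x y)
        (IsWebsterPoint.restrH g hP.g_ξ_ξ (S.chartTau cov x y) a) = l ^ 2 • a := by
    ext1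
    rw [IsWebsterPoint.coe_restrH hP.g_ξ_ξ hP.θ_τ, IsWebsterPoint.coe_restrH hP.g_ξ_ξ hP.θ_τ,
      hττ _ a.2]
    rfl
  refine ⟨?_, fun X Y Z V hX hY hZ hV ↦ ?_⟩
  · have h1 : S.tauNormSq cov x (fun i ↦ ι (e' i)) = 2 * d * l ^ 2 := by
      simp only [ht, hW.τ_symm, hττ', map_smul, smul_eq_mul, ← Finset.mul_sum, hF.sum_self]
      push_cast
      ring
    rw [h1]
    have : (0 : ℝ) < d := Nat.cast_pos.2 (Nat.pos_of_ne_zero hd)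
    positivity
  · obtain ⟨X, rfl⟩ := hι X hX
    obtain ⟨Y, rfl⟩ := hι Y hY
    obtain ⟨Z, rfl⟩ := hι Z hZ
    obtain ⟨V, rfl⟩ := hι V hV
    have key := hW.frame_formulas hd hF hl hττ' c
      (K := fun X Y Z V ↦ S.curvW cov x (ι X) (ι Y) (ι Z) (ι V)) hK rfl ht
      (G := fun a b ↦ S.met x (ι a) (ι b)) (Om := fun a b ↦ S.omega x (ι a) (ι b))
      (T := fun X Y Z V ↦ S.tensT cov x (ι X) (ι Y) (ι Z) (ι V))
      (by simp only [hιmet]) (by simp only [hιω])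
      (by
        funext X Y Z V
        simp only [tensT, kulkarni, symProd, tensA, tensB, hιτ, hιmet, hιω]) X Y Z V
    have hlef (γ : TangentSpace (𝓡 (2 * d + 1)) x → TangentSpace (𝓡 (2 * d + 1)) x → ℝ) :
        lefschetzAdj (fun i ↦ ι (e' i)) (S.J x) γ = lefschetzAdj e'
          (IsWebsterPoint.restrH g hP.g_ξ_ξ (chartEnd x S.J y)) (fun a b ↦ γ (ι a) (ι b)) := by
      simp only [lefschetzAdj, hιJ]
    have hρ : primitiveForm e' (IsWebsterPoint.restrH g hP.g_ξ_ξ (chartEnd x S.J y))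
          (fun a b ↦ S.omega x (ι a) (ι b)) (fun u v ↦ -hatAction e'
            (fun X Y Z V ↦ S.curvW cov x (ι X) (ι Y) (ι Z) (ι V))
            (fun a b ↦ S.omega x (ι a) (ι b)) u v) =
        fun a b ↦ primitiveForm (fun i ↦ ι (e' i)) (S.J x) (S.omega x)
          (S.rhoW cov x (fun i ↦ ι (e' i))) (ι a) (ι b) := by
      funext a b
      simp only [primitiveForm, hlef]
      rfl
    refine ⟨key.1, ?_⟩
    have key2 := key.2
    rw [hρ] at key2
    refine Eq.trans ?_ (key2.trans ?_)
    · rfl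
    · simp only [primitivePart, hlef]
      rfl

end ContactMetricStructure.IsTanakaWebster

end Pointwise

end

/-! ### From charts to the manifold -/

open TensorAlg

noncomputable section

set_option synthInstance.maxHeartbeats 200000
set_option linter.unusedSectionVars false

section Global

variable {d : ℕ} {M : Type*} [TopologicalSpace M]
  [ChartedSpace (EuclideanSpace ℝ (Fin (2 * d + 1))) M] [IsManifold (𝓡 (2 * d + 1)) ∞ M]

local notation "𝔼" => EuclideanSpace ℝ (Fin (2 * d + 1))

/-- The differential of a map, in coordinates. -/
theorem toModel_mfderiv {p x : M} (hx : x ∈ (chartAt 𝔼 p).source) {f : M → M}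
    (hf : MDifferentiableAt (𝓡 (2 * d + 1)) (𝓡 (2 * d + 1)) f x)
    (hfx : f x ∈ (chartAt 𝔼 p).source) {f' : 𝔼 → 𝔼}
    (hf' : DifferentiableAt ℝ f' (chartAt 𝔼 p x))
    (hff' : ∀ᶠ y in 𝓝 x, chartAt 𝔼 p (f y) = f' (chartAt 𝔼 p y))
    (u : TangentSpace (𝓡 (2 * d + 1)) x) :
    toModel p (f x) (mfderiv (𝓡 (2 * d + 1)) (𝓡 (2 * d + 1)) f x u) =
      fderiv ℝ f' (chartAt 𝔼 p x) (toModel p x u) := by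
  have h1 : mfderiv (𝓡 (2 * d + 1)) 𝓘(ℝ, 𝔼) (chartAt 𝔼 p ∘ f) x =
      mfderiv (𝓡 (2 * d + 1)) 𝓘(ℝ, 𝔼) (f' ∘ chartAt 𝔼 p) x :=
    Filter.EventuallyEq.mfderiv_eq hff'
  rw [mfderiv_comp x ((contMDiffAt_chartAt hfx).mdifferentiableAt (by simp)) hf,
    mfderiv_comp x hf'.mdifferentiableAt ((contMDiffAt_chartAt hx).mdifferentiableAt (by simp)),
    ← toModel_eq_mfderiv hfx, ← toModel_eq_mfderiv hx, mfderiv_eq_fderiv] at h1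
  exact congrArg (fun A : TangentSpace (𝓡 (2 * d + 1)) x →L[ℝ] 𝔼 ↦ A u) h1

namespace ContactMetricStructure

variable (S : ContactMetricStructure d M)
  (cov : CovariantDerivative (𝓡 (2 * d + 1)) (EuclideanSpace ℝ (Fin (2 * d + 1)))
    (fun x : M ↦ TangentSpace (𝓡 (2 * d + 1)) x))

theorem chartMetric_ξ {p x : M} (hx : x ∈ (chartAt 𝔼 p).source)
    (u : TangentSpace (𝓡 (2 * d + 1)) x) :
    chartMetric p S.g.inner (chartAt 𝔼 p x) (chartRep p S.ξ (chartAt 𝔼 p x)) (toModel p x u) =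
      S.θ x u := by
  rw [chartRep_chartAt hx, chartMetric_toModel hx, S.g_ξ]

theorem exists_chart_frame (p : M) {y : 𝔼} (hy : y ∈ (chartAt 𝔼 p).target) :
    ∃ e : Fin (2 * d) → 𝔼, (∀ i, chartMetric p S.g.inner y (chartRep p S.ξ y) (e i) = 0) ∧
      ∀ i j, chartMetric p S.g.inner y (e i) (e j) = if i = j then 1 else 0 := by
  have hx := (chartAt 𝔼 p).map_target hy
  obtain ⟨e, he⟩ := S.exists_isHorizontalFrame ((chartAt 𝔼 p).symm y)
  refine ⟨fun i ↦ toModel p _ (e i), fun i ↦ ?_, fun i j ↦ ?_⟩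
  · have h1 := S.chartMetric_ξ hx (e i)
    rw [he.1, (chartAt 𝔼 p).right_inv hy] at h1
    exact h1
  · have h1 := chartMetric_toModel hx S.g.inner (e i) (e j)
    rw [(chartAt 𝔼 p).right_inv hy] at h1
    exact h1.trans (he.2 i j)

theorem chartTau_ne_zero_iff {p x : M} (hx : x ∈ (chartAt 𝔼 p).source) :
    S.chartTau cov p (chartAt 𝔼 p x) ≠ 0 ↔ ∃ v, S.tau cov x v ≠ 0 := by
  constructor
  · intro h
    by_contra! h0
    apply h
    ext1 a
    rw [← toModel_ofModel hx a, chartTau_toModel S cov hx, h0]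
    simp
  · rintro ⟨v, hv⟩ h0
    apply hv
    rw [← ofModel_toModel hx (S.tau cov x v), ← chartTau_toModel S cov hx, h0]
    simp

namespace IsTanakaWebster

variable {S : ContactMetricStructure d M}
  {cov : CovariantDerivative (𝓡 (2 * d + 1)) (EuclideanSpace ℝ (Fin (2 * d + 1)))
    (fun x : M ↦ TangentSpace (𝓡 (2 * d + 1)) x)}

variable [T2Space M]

theorem trace_sq_chartTau_ne_zero (h : S.IsTanakaWebster cov) (hCR : S.IsStrictlyPseudoconvexCR)
    (hpar : ∀ (x : M) (u v : TangentSpace (𝓡 (2 * d + 1)) x), S.θ x u = 0 →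
      covEnd cov (S.tau cov) x u v = 0) {p : M} {y : 𝔼} (hy : y ∈ (chartAt 𝔼 p).target)
    (hτ : S.chartTau cov p y ≠ 0) :
    d ≠ 0 ∧ traceL 𝔼 (S.chartTau cov p y ∘L S.chartTau cov p y) ≠ 0 := by
  have hfin : Module.finrank ℝ 𝔼 = 2 * d + 1 := finrank_euclideanSpace_fin
  have hP := (h.isWebsterChart hCR hpar p).isWebsterPoint hy
  obtain ⟨e, he1, he2⟩ := S.exists_chart_frame p hy
  obtain ⟨hd, l, c, hl, hττ, -⟩ := hP.exists_model hfin he1 he2 hτ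
  refine ⟨hd, ?_⟩
  rw [traceL_apply, hP.trace_sq hfin hττ]
  have : (0 : ℝ) < d := Nat.cast_pos.2 (Nat.pos_of_ne_zero hd)
  positivity

/-- In a chart `tr τ²` is locally constant, and it vanishes exactly where `τ` does. Non-vanishing of
`τ` is thus a locally constant property, and connectedness concludes. -/
theorem exists_tau_ne_zero [ConnectedSpace M] (h : S.IsTanakaWebster cov)
    (hCR : S.IsStrictlyPseudoconvexCR)
    (hpar : ∀ (x : M) (u v : TangentSpace (𝓡 (2 * d + 1)) x), S.θ x u = 0 →
      covEnd cov (S.tau cov) x u v = 0)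
    (hτ : ∃ (x : M) (v : TangentSpace (𝓡 (2 * d + 1)) x), S.tau cov x v ≠ 0) (x : M) :
    ∃ v : TangentSpace (𝓡 (2 * d + 1)) x, S.tau cov x v ≠ 0 := by
  obtain ⟨x₁, hx₁⟩ := hτ
  have hd : d ≠ 0 := (h.trace_sq_chartTau_ne_zero hCR hpar (mem_chart_target 𝔼 x₁)
    ((S.chartTau_ne_zero_iff cov (mem_chart_source 𝔼 x₁)).2 hx₁)).1
  have hloc : IsLocallyConstant fun x : M ↦ ∃ v : TangentSpace (𝓡 (2 * d + 1)) x,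
      S.tau cov x v ≠ 0 := by
    rw [IsLocallyConstant.iff_eventually_eq]
    intro p
    have hC := h.isWebsterChart hCR hpar p
    obtain ⟨r, hr, hrU⟩ := Metric.isOpen_iff.1 hC.isOpen _ (mem_chart_target 𝔼 p)
    have hB := hC.mono Metric.isOpen_ball hrU
    have hconst : ∀ z ∈ Metric.ball (chartAt 𝔼 p p) r,
        traceL 𝔼 (S.chartTau cov p z ∘L S.chartTau cov p z) = traceL 𝔼
          (S.chartTau cov p (chartAt 𝔼 p p) ∘L S.chartTau cov p (chartAt 𝔼 p p)) := by
      intro z hz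
      refine Metric.isOpen_ball.is_const_of_fderiv_eq_zero (𝕜 := ℝ)
        (f := fun z ↦ traceL 𝔼 (S.chartTau cov p z ∘L S.chartTau cov p z))
        (convex_ball (chartAt 𝔼 p p) r).isPreconnected ?_ ?_ hz (Metric.mem_ball_self hr)
      · exact ((traceL 𝔼).contDiff.comp_contDiffOn
          (hB.smooth_τ.clm_comp hB.smooth_τ)).differentiableOn (by simp)
      · intro y hy
        refine hB.fderiv_trace_sq (fun y hy ↦ ?_) hy
        obtain ⟨e, he1, he2⟩ := S.exists_chart_frame p (hrU hy)
        refine ⟨e ⟨0, by omega⟩, fun h0 ↦ ?_, he1 _⟩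
        have h1 := he2 ⟨0, by omega⟩ ⟨0, by omega⟩
        rw [h0] at h1
        simp at h1
    have hiff : ∀ z ∈ (chartAt 𝔼 p).target, (S.chartTau cov p z ≠ 0 ↔
        traceL 𝔼 (S.chartTau cov p z ∘L S.chartTau cov p z) ≠ 0) := fun z hz ↦
      ⟨fun h0 ↦ (h.trace_sq_chartTau_ne_zero hCR hpar hz h0).2, fun h0 h1 ↦ h0 (by simp [h1])⟩
    have hcont := (contMDiffAt_chartAt (mem_chart_source 𝔼 p)).continuousAt
    filter_upwards [(chartAt 𝔼 p).open_source.mem_nhds (mem_chart_source 𝔼 p),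
      hcont (Metric.ball_mem_nhds _ hr)] with x hx hx'
    rw [eq_iff_iff, ← S.chartTau_ne_zero_iff cov hx,
      ← S.chartTau_ne_zero_iff cov (mem_chart_source 𝔼 p), hiff _ (hrU hx'), hconst _ hx',
      hiff _ (mem_chart_target 𝔼 p)]
  have heq := hloc.apply_eq_of_preconnectedSpace x₁ x
  exact heq.mp hx₁

/-- The symmetry of the chart at `x₀` is conjugated back to `M`. It preserves `θ` because it
preserves `g` and `ξ`, and `θ = g(ξ, ·)`. -/
theorem isContactLocallySubSymmetric (h : S.IsTanakaWebster cov)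
    (hCR : S.IsStrictlyPseudoconvexCR)
    (hpar : ∀ (x : M) (u v : TangentSpace (𝓡 (2 * d + 1)) x), S.θ x u = 0 →
      covEnd cov (S.tau cov) x u v = 0)
    (hτ : ∀ x : M, ∃ v : TangentSpace (𝓡 (2 * d + 1)) x, S.tau cov x v ≠ 0) :
    S.IsContactLocallySubSymmetric := by
  intro x₀
  have hfin : Module.finrank ℝ 𝔼 = 2 * d + 1 := finrank_euclideanSpace_fin
  have hC := h.isWebsterChart hCR hpar x₀
  obtain ⟨ψ, hxψ, hsU, htU, hψ, hψ', hψx, hψd, hψI⟩ := hC.exists_local_symmetry hfin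
    (fun y hy ↦ S.exists_chart_frame x₀ hy)
    (fun y hy ↦ by
      have h1 := (S.chartTau_ne_zero_iff cov ((chartAt 𝔼 x₀).map_target hy)).2 (hτ _)
      rwa [(chartAt 𝔼 x₀).right_inv hy] at h1) (mem_chart_target 𝔼 x₀)
  set φ := chartAt 𝔼 x₀ with hφ
  have hx₀ : x₀ ∈ φ.source := mem_chart_source 𝔼 x₀
  set Ψ : OpenPartialHomeomorph M M := (φ.trans ψ).trans φ.symm with hΨ
  have hsrc : ∀ x, x ∈ Ψ.source ↔ x ∈ φ.source ∧ φ x ∈ ψ.source := by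
    intro x
    simp only [hΨ, OpenPartialHomeomorph.trans_source, OpenPartialHomeomorph.symm_source,
      Set.mem_inter_iff, Set.mem_preimage, OpenPartialHomeomorph.coe_trans, Function.comp_apply]
    exact ⟨fun hx ↦ hx.1, fun hx ↦ ⟨hx, htU (ψ.map_source hx.2)⟩⟩
  have htgt : ∀ x, x ∈ Ψ.target ↔ x ∈ φ.source ∧ φ x ∈ ψ.target := by
    intro x
    simp only [hΨ, OpenPartialHomeomorph.trans_target, OpenPartialHomeomorph.symm_target,
      Set.mem_inter_iff, Set.mem_preimage, OpenPartialHomeomorph.symm_symm]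
    exact ⟨fun hx ↦ ⟨hx.1, hx.2.1⟩, fun hx ↦ ⟨hx.1, hx.2, hsU (ψ.map_target hx.2)⟩⟩
  have hΨx : ∀ x, Ψ x = φ.symm (ψ (φ x)) := fun x ↦ rfl
  have hΨs : ∀ x ∈ Ψ.source, Ψ x ∈ φ.source := fun x hx ↦
    φ.map_target (htU (ψ.map_source ((hsrc x).1 hx).2))
  have hφΨ : ∀ x ∈ Ψ.source, φ (Ψ x) = ψ (φ x) := fun x hx ↦
    φ.right_inv (htU (ψ.map_source ((hsrc x).1 hx).2))
  have hφs : ContMDiffOn (𝓡 (2 * d + 1)) 𝓘(ℝ, 𝔼) ∞ φ φ.source := contMDiffOn_chart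
  have hφs' : ContMDiffOn 𝓘(ℝ, 𝔼) (𝓡 (2 * d + 1)) ∞ φ.symm φ.target := contMDiffOn_chart_symm
  have hsm : ContMDiffOn (𝓡 (2 * d + 1)) (𝓡 (2 * d + 1)) ∞ Ψ Ψ.source := by
    refine hφs'.comp (t := φ.target) (f := fun x ↦ ψ (φ x)) ?_
      fun x hx ↦ htU (ψ.map_source ((hsrc x).1 hx).2)
    exact hψ.contMDiffOn.comp (hφs.mono fun x hx ↦ ((hsrc x).1 hx).1)
      fun x hx ↦ ((hsrc x).1 hx).2
  have hsm' : ContMDiffOn (𝓡 (2 * d + 1)) (𝓡 (2 * d + 1)) ∞ Ψ.symm Ψ.target := by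
    refine hφs'.comp (t := φ.target) (f := fun x ↦ ψ.symm (φ x)) ?_
      fun x hx ↦ hsU (ψ.map_target ((htgt x).1 hx).2)
    exact hψ'.contMDiffOn.comp (hφs.mono fun x hx ↦ ((htgt x).1 hx).1)
      fun x hx ↦ ((htgt x).1 hx).2
  have hder : ∀ x ∈ Ψ.source, ∀ u : TangentSpace (𝓡 (2 * d + 1)) x,
      toModel x₀ (Ψ x) (mfderiv (𝓡 (2 * d + 1)) (𝓡 (2 * d + 1)) Ψ x u) =
        fderiv ℝ ψ (φ x) (toModel x₀ x u) := by
    intro x hx u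
    have hx' := (hsrc x).1 hx
    refine toModel_mfderiv hx'.1 ((hsm.contMDiffAt (Ψ.open_source.mem_nhds hx)).mdifferentiableAt
      (by simp)) (hΨs x hx) ((hψ.contDiffAt (ψ.open_source.mem_nhds hx'.2)).differentiableAt
      (by simp)) ?_ u
    filter_upwards [Ψ.open_source.mem_nhds hx] with y hy using hφΨ y hy
  have hxΨ : x₀ ∈ Ψ.source := (hsrc _).2 ⟨hx₀, hxψ⟩
  have hfix : Ψ x₀ = x₀ := by rw [hΨx, hψx, φ.left_inv hx₀]
  refine ⟨Ψ, hxΨ, hsm, hsm', fun x hx u v ↦ ?_, fun x hx u ↦ ?_, hfix, fun u hu ↦ ?_⟩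
  · have hx' := (hsrc x).1 hx
    have h1 := chartMetric_toModel (hΨs x hx) S.g.inner
      (mfderiv (𝓡 (2 * d + 1)) (𝓡 (2 * d + 1)) Ψ x u)
      (mfderiv (𝓡 (2 * d + 1)) (𝓡 (2 * d + 1)) Ψ x v)
    rw [hder x hx, hder x hx, ← hφ, hφΨ x hx, (hψI _ hx'.2).1, chartMetric_toModel hx'.1] at h1
    exact h1.symm
  · have hx' := (hsrc x).1 hx
    have h1 := S.chartMetric_ξ (hΨs x hx) (mfderiv (𝓡 (2 * d + 1)) (𝓡 (2 * d + 1)) Ψ x u)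
    rw [hder x hx, ← hφ, hφΨ x hx, ← (hψI _ hx'.2).2, (hψI _ hx'.2).1, S.chartMetric_ξ hx'.1] at h1
    exact h1.symm
  · have h1 := hder x₀ hxΨ u
    rw [hψd _ ((S.chartMetric_ξ hx₀ u).trans hu), ← map_neg] at h1
    -- The image vector lives over `Ψ x₀`, which equals `x₀` only propositionally; the base point is
    -- generalized before it is substituted.
    have h2 : ∀ y, y = x₀ → ∀ w : TangentSpace (𝓡 (2 * d + 1)) y,
        toModel x₀ y w = toModel x₀ x₀ (-u) →
        (⟨y, w⟩ : TangentBundle (𝓡 (2 * d + 1)) M) = ⟨x₀, -u⟩ := by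
      rintro _ rfl w hw
      rw [← ofModel_toModel hx₀ w, hw, ofModel_toModel hx₀]
    exact h2 _ hfix _ h1

end IsTanakaWebster

end ContactMetricStructure

end Global

end

theorem theorem3p3 (d : ℕ) (M : Type*) [TopologicalSpace M] [T2Space M] [ConnectedSpace M]
    [ChartedSpace (EuclideanSpace ℝ (Fin (2 * d + 1))) M] [IsManifold (𝓡 (2 * d + 1)) ∞ M]
    (S : ContactMetricStructure d M) (hCR : S.IsStrictlyPseudoconvexCR)
    (cov : CovariantDerivative (𝓡 (2 * d + 1)) (EuclideanSpace ℝ (Fin (2 * d + 1)))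
      (fun x : M ↦ TangentSpace (𝓡 (2 * d + 1)) x))
    (hcov : S.IsTanakaWebster cov)
    (hpar : ∀ (x : M) (u v : TangentSpace (𝓡 (2 * d + 1)) x), S.θ x u = 0 →
      ContactMetricStructure.covEnd cov (S.tau cov) x u v = 0)
    (hτ : ∃ (x : M) (v : TangentSpace (𝓡 (2 * d + 1)) x), S.tau cov x v ≠ 0) :
    (∀ (x : M) (e : Fin (2 * d) → TangentSpace (𝓡 (2 * d + 1)) x), S.IsHorizontalFrame x e →
      0 < S.tauNormSq cov x e ∧
      ∀ X Y Z W : TangentSpace (𝓡 (2 * d + 1)) x,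
        S.θ x X = 0 → S.θ x Y = 0 → S.θ x Z = 0 → S.θ x W = 0 →
        S.curvW cov x X Y Z W = S.scalW cov x e / (d : ℝ) ^ 2 *
          (TensorAlg.holoCurv (S.met x) (S.omega x) X Y Z W
            + 2 * d / S.tauNormSq cov x e * S.tensT cov x X Y Z W) ∧
        S.chernMoser cov x e X Y Z W = S.scalW cov x e / (d : ℝ) ^ 2 *
          (1 / (d + 1) * TensorAlg.primitivePart e (S.J x) (S.omega x)
              (TensorAlg.holoCurv (S.met x) (S.omega x)) X Y Z W
            + 2 * d / S.tauNormSq cov x e * TensorAlg.primitivePart e (S.J x) (S.omega x)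
              (S.tensT cov x) X Y Z W)) ∧
    (2 ≤ d → S.IsContactLocallySubSymmetric) := by

  have hne := hcov.exists_tau_ne_zero hCR hpar hτ
  exact ⟨fun x e he ↦ hcov.curvature_formulas hCR hpar (hne x) he,
    fun _ ↦ hcov.isContactLocallySubSymmetric hCR hpar hne⟩
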